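/- **Setting.** Let $\mathcal S=[-1,1]^{d_S}$, $\mathcal A=[-1,1]^{d_A}$, $\mathcal Z=\mathcal S\times\mathcal A=[-1,1]^d$ with $d=d_S+d_A\ge 1$, and let $H$ be the horizon. An MDP has (measurable) transition kernels $p_h(\cdot\mid z)$ on $\mathcal S$ and deterministic rewards $R_h(z)\in[0,1]$, $h=1,\dots,H$; one sample of the generative model at $(z,h)$ returns $s'\sim p_h(\cdot\mid z)$ and $R_h(z)$. The Bellman optimality operator is $\mathcal T_hf(z)=R_h(z)+\mathbb E_{s'\sim p_h(\cdot|z)}[\sup_{a'}f(s',a')]$; $Q^*_{H+1}=0$, $Q_h^*=\mathcal T_hQ^*_{h+1}$, $V_h^*(s)=\sup_aQ_h^*(s,a)$; and $V_1^\pi(s)=\mathbb E_\pi[\sum_{\ell=1}^HR_\ell(s_\ell,a_\ell)\mid s_1=s]$. A policy $\pi$ is $\varepsilon$-optimal if $\sup_s|V_1^*(s)-V_1^\pi(s)|\le\varepsilon$; in particular $V_1^{\pi'}\le V_1^\pi+\varepsilon$ for every policy $\pi'$. $\mathcal C_p^{\nu,1}$ ($\nu\in\mathbb N$) is the space of functions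 on $\mathcal Z$ whose $2$-periodic extension is $\nu$ times continuously differentiable with Lipschitz derivatives of order $\nu$, with $\|f\|_{\mathcal C^{\nu,1}}=\max_{|\alpha|\le\nu+1}\|D^\alpha f\|_{L^\infty}$. The MDP is $\nu$-smooth with constant $C_{\mathcal T}$ if for all $h\in\{1,\dots,H\}$ and $f\in\mathcal C_p^{\nu,1}$ one has $\mathcal T_hf\in\mathcal C_p^{\nu,1}$ and $\|\mathcal T_hf\|_{\mathcal C^{\nu,1}}\le C_{\mathcal T}(\|f\|_{\mathcal C^{\nu,1}}+1)$. For $N\ge 1$ let $\boldsymbol\varphi_N(z)=(\prod_i\mathrm{soc}(n_i,z_i))_{\|n\|_1\le N}$, $n\in\mathbb Z^d$, with $\mathrm{soc}(n,t)=1,\ \sin(n\pi t),\ \cos(n\pi t)$ for $n=0,\ n>0,\ n<0$, and let $\widetilde N=|\{n\in\mathbb Z^d:\|n\|_1\le N\}|$. For even $N$ the de la Vallée-Poussin kernel is $D_N=\frac1{N/2+1}\sum_{n=N/2}^{N}D_n^0$ with $D_n^0(x)=2^{-d}\sum_{\|k\|_1\le n}e^{i\pi k\cdot x}$. Write $D_N=\beta_+D_N^+-\beta_-D_N^-$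 on $[-1,1]^d$, where $D_N^\pm$ are the positive and negative parts normalized to be probability densities. A quasi-optimal design is a finitely supported probability distribution $\rho$ on $\mathcal Z$ with $|\mathrm{supp}\,\rho|\le4\widetilde N\log\log\widetilde N+16$, such that $\Sigma=\mathbb E_{z\sim\rho}[\boldsymbol\varphi_N(z)\boldsymbol\varphi_N(z)^\top]$ is invertible and $\boldsymbol\varphi_N(z)^\top\Sigma^{-1}\boldsymbol\varphi_N(z)\le2\widetilde N$ for all $z\in\mathcal Z$. **Algorithm** (input $N$, $n_{\rm tot}$, a quasi-optimal design $\rho$). The dataset $\mathcal D_h$ consists of $\lceil n_{\rm tot}\rho(z)\rceil$ copies of each $z\in\mathrm{supp}\,\rho$. Put $\widehat V_{H+1}=0$. For $h=H,\dots,1$: for each element $z$ of $\mathcal D_h$ draw, with fresh independent randomness, $\eta_\pm\sim D_N^\pm$ and $s^\pm\sim p_h(\cdot\mid z+\eta_\pm)$, $r^\pm=R_h(z+\eta_\pm)$ (with $z+\eta_\pm$ read periodically), and form the target $(\beta_+r^+-\beta_-r^-)+(\beta_+\widehat V_{h+1}(s^+)-\beta_-\widehat V_{h+1}(s^-))$;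 let $\widehat\theta_h$ be a least-squares solution of the regression of the targets on $\boldsymbol\varphi_N(z)$, $\widehat Q_h=\boldsymbol\varphi_N^\top\widehat\theta_h$, $\widehat V_h(s)=\max_a\widehat Q_h(s,a)$. Return $\widehat\pi_h(s)\in\arg\max_a\widehat Q_h(s,a)$ (a measurable selection). **Theorem.** For all $d\ge1$, $H$, $\nu\in\mathbb N$, $C_{\mathcal T}\ge0$ there are constants $C$, $K$ and $q\in\mathbb N$, depending only on $(d,H,\nu,C_{\mathcal T})$, such that for all $d_S+d_A=d$ and every $\varepsilon\in(0,1]$ there is a positive even integer $N\le C\,\varepsilon^{-\frac1{\nu+1}}$ for which a quasi-optimal design exists and the following holds. For every $\delta\in(0,1)$ there is $n_{\rm tot}$ such that, for every quasi-optimal design $\rho$, the algorithm uses in total $$n\le K\,\varepsilon^{-\frac{d+2(\nu+1)}{\nu+1}}\Big(1+\log\frac1{\varepsilon\delta}\Big)^{q}$$ samples of the generative model, and, on every MDP with horizon $H$ that is $\nu$-smooth with constant $C_{\mathcal T}$, with probability at least $1-\delta$ it returns a policy, and every policy it may return is $\varepsilon$-optimal. -/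

import Mathlib

open MeasureTheory ProbabilityTheory Matrix
open scoped NNReal ENNReal

noncomputable section

namespace SmoothMDP

/-! ### The cube `[-1,1]^ι`, periodic extension, and the spaces `C_p^{ν,1}` -/

/-- The cube `[-1,1]^ι`. -/
abbrev Cube (ι : Type) : Type := ι → Set.Icc (-1 : ℝ) 1

/-- The joint index set of the coordinates of a state (`dS` of them) and of an action (`dA`). -/
abbrev Idx (dS dA : ℕ) : Type := Fin dS ⊕ Fin dA

/-- The state-action pair `(s, a)` as a point of `[-1,1]^(dS + dA)`. -/
def pair {dS dA : ℕ} (s : Cube (Fin dS)) (a : Cube (Fin dA)) : Cube (Idx dS dA) := Sum.elim s a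

/-- A point of the cube as a real vector. -/
def toVec {ι : Type} (z : Cube ι) : ι → ℝ := fun i => (z i : ℝ)

/-- Reduction of a real number modulo `2` into `[-1, 1)`. -/
def wrapCoord (t : ℝ) : Set.Icc (-1 : ℝ) 1 :=
  ⟨2 * Int.fract ((t + 1) / 2) - 1, by
    have h0 := Int.fract_nonneg ((t + 1) / 2)
    have h1 := (Int.fract_lt_one ((t + 1) / 2)).le
    constructor <;> linarith⟩

/-- Reduction of a real vector into the cube, coordinatewise modulo `2`. -/
def wrap {ι : Type} (x : ι → ℝ) : Cube ι := fun i => wrapCoord (x i)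

theorem measurable_wrapCoord : Measurable wrapCoord := by
  refine Measurable.subtype_mk ?_
  exact ((measurable_fract.comp ((measurable_id.add_const 1).div_const 2)).const_mul 2).sub_const 1

theorem measurable_wrap {ι : Type} : Measurable (wrap : (ι → ℝ) → Cube ι) :=
  measurable_pi_lambda _ fun i => measurable_wrapCoord.comp (measurable_pi_apply i)

/-- The extension by `2`-periodicity of a function on the cube to all of `ℝ^ι`. -/
def periodize {ι : Type} (f : Cube ι → ℝ) : (ι → ℝ) → ℝ := fun x => f (wrap x)

/-- `f ∈ C_p^{ν,1}([-1,1]^ι)`: `f` takes the same values at opposite boundary points, its periodic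
extension is `ν` times continuously differentiable, and the derivatives of order `ν` are Lipschitz
(that is, the weak derivatives of order `ν + 1` are essentially bounded). -/
structure MemCp {ι : Type} [Fintype ι] (ν : ℕ) (f : Cube ι → ℝ) : Prop where
  boundary : ∀ z : Cube ι, f (wrap (toVec z)) = f z
  contDiff : ContDiff ℝ ν (periodize f)
  lipschitz : ∃ L : ℝ≥0, LipschitzWith L (iteratedFDeriv ℝ ν (periodize f))

/-- The norm `max_{|α| ≤ ν+1} ‖D^α f‖_{L^∞}`. A multi-index `α` of length `k` is listed as the
sequence of the `k` coordinate directions in which one differentiates. For `f ∈ C_p^{ν,1}` the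
derivatives of order `ν + 1` exist almost everywhere. -/
def cpNorm {ι : Type} [Fintype ι] [DecidableEq ι] (ν : ℕ) (f : Cube ι → ℝ) : ℝ≥0∞ :=
  ⨆ (k : ℕ) (_ : k ≤ ν + 1) (i : Fin k → ι),
    eLpNorm (fun x => iteratedFDeriv ℝ k (periodize f) x (fun j => Pi.single (i j) 1)) ∞
      (volume.restrict (Set.Icc (-1 : ι → ℝ) 1))

/-! ### Markov decision processes, value functions -/

/-- A finite-horizon MDP with state space `[-1,1]^dS` and action space `[-1,1]^dA`, transition
kernels `p h` and deterministic rewards `R h` in `[0,1]`. The stages are `h = 1, …, H`, where the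
horizon `H` is supplied separately; `p h` and `R h` play no role for other `h`. -/
structure MDP (dS dA : ℕ) where
  p : ℕ → Kernel (Cube (Idx dS dA)) (Cube (Fin dS))
  markov : ∀ h, IsMarkovKernel (p h)
  R : ℕ → Cube (Idx dS dA) → ℝ
  measurable_R : ∀ h, Measurable (R h)
  R_mem : ∀ h z, R h z ∈ Set.Icc (0 : ℝ) 1

variable {dS dA : ℕ}

/-- The Bellman optimality operator
`T_h f (z) = R_h(z) + E_{s' ∼ p_h(·|z)} [sup_{a'} f(s', a')]`. -/
def MDP.bellman (M : MDP dS dA) (h : ℕ) (f : Cube (Idx dS dA) → ℝ) : Cube (Idx dS dA) → ℝ :=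
  fun z => M.R h z + ∫ s', (⨆ a' : Cube (Fin dA), f (pair s' a')) ∂(M.p h z)

/-- The MDP with horizon `H` is `ν`-smooth with constant `C`: each Bellman operator `T_h`,
`h = 1, …, H`, maps `C_p^{ν,1}` to itself and `‖T_h f‖ ≤ C (‖f‖ + 1)`. -/
def MDP.IsSmooth (M : MDP dS dA) (H ν : ℕ) (C : ℝ≥0) : Prop :=
  ∀ h ∈ Finset.Icc 1 H, ∀ f : Cube (Idx dS dA) → ℝ, MemCp ν f →
    MemCp ν (M.bellman h f) ∧ cpNorm ν (M.bellman h f) ≤ C * (cpNorm ν f + 1)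

/-- The optimal state-action value function: `Q*_h = T_h Q*_{h+1}` for `h ≤ H`, and `0` beyond. -/
def MDP.optQ (M : MDP dS dA) (H : ℕ) (h : ℕ) : Cube (Idx dS dA) → ℝ :=
  if h ≤ H then M.bellman h (M.optQ H (h + 1)) else fun _ => 0
termination_by H + 1 - h

/-- The optimal value function `V*_h(s) = sup_a Q*_h(s, a)`. -/
def MDP.optV (M : MDP dS dA) (H h : ℕ) (s : Cube (Fin dS)) : ℝ :=
  ⨆ a : Cube (Fin dA), M.optQ H h (pair s a)

/-- The law of the state-action pair `(s_{h+j}, a_{h+j})` when `(s_h, a_h) = z`,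
`s_{ℓ+1} ∼ p_ℓ(·|s_ℓ, a_ℓ)` and `a_ℓ ∼ π_ℓ(·|s_ℓ)` for `ℓ > h`. -/
def MDP.pairLaw (M : MDP dS dA) (π : ℕ → Kernel (Cube (Fin dS)) (Cube (Fin dA))) (h : ℕ)
    (z : Cube (Idx dS dA)) : ℕ → Measure (Cube (Idx dS dA))
  | 0 => Measure.dirac z
  | j + 1 => (M.pairLaw π h z j).bind fun z' =>
      ((M.p (h + j) z') ⊗ₘ (π (h + j + 1))).map fun x => pair x.1 x.2

/-- The state-action value function
`Q^π_h(z) = E_π [∑_{ℓ=h}^H R_ℓ(s_ℓ, a_ℓ) | (s_h, a_h) = z]`. -/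
def MDP.polQ (M : MDP dS dA) (H : ℕ) (π : ℕ → Kernel (Cube (Fin dS)) (Cube (Fin dA))) (h : ℕ)
    (z : Cube (Idx dS dA)) : ℝ :=
  ∑ l ∈ Finset.Icc h H, ∫ z', M.R l z' ∂(M.pairLaw π h z (l - h))

/-- The state value function `V^π_h(s) = E_{a ∼ π_h(·|s)} [Q^π_h(s, a)]`. -/
def MDP.polV (M : MDP dS dA) (H : ℕ) (π : ℕ → Kernel (Cube (Fin dS)) (Cube (Fin dA))) (h : ℕ)
    (s : Cube (Fin dS)) : ℝ :=
  ∫ a, M.polQ H π h (pair s a) ∂(π h s)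

/-- `π` is `ε`-optimal: `sup_s |V*_1(s) - V^π_1(s)| ≤ ε`. The second field says the same with the
value of an arbitrary competing policy in place of `V*_1`. -/
structure MDP.IsEpsOptimal (M : MDP dS dA) (H : ℕ) (ε : ℝ)
    (π : ℕ → Kernel (Cube (Fin dS)) (Cube (Fin dA))) : Prop where
  gap : ∀ s, |M.optV H 1 s - M.polV H π 1 s| ≤ ε
  competitor : ∀ π' : ℕ → Kernel (Cube (Fin dS)) (Cube (Fin dA)), (∀ h, IsMarkovKernel (π' h)) →
    ∀ s, M.polV H π' 1 s ≤ M.polV H π 1 s + ε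

/-! ### Trigonometric features and the de la Vallée-Poussin kernel -/

/-- The multi-indices `n ∈ ℤ^ι` with `‖n‖₁ ≤ N`. -/
def freq (ι : Type) [Fintype ι] [DecidableEq ι] (N : ℕ) : Finset (ι → ℤ) :=
  (Fintype.piFinset fun _ : ι => Finset.Icc (-(N : ℤ)) N).filter fun n => ∑ i, |n i| ≤ N

/-- `soc(n, z)`: `1` if `n = 0`, `sin(nπz)` if `n > 0`, `cos(nπz)` if `n < 0`. -/
def soc (n : ℤ) (z : ℝ) : ℝ :=
  if n = 0 then 1 else if 0 < n then Real.sin (n * Real.pi * z) else Real.cos (n * Real.pi * z)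

variable {ι : Type} [Fintype ι] [DecidableEq ι]

/-- The feature map `φ_N : [-1,1]^ι → ℝ^Ñ`, `Ñ = |{n : ‖n‖₁ ≤ N}|`. -/
def feature (N : ℕ) (z : Cube ι) : freq ι N → ℝ := fun n => ∏ i, soc (n.1 i) (z i)

/-- The Dirichlet kernel of order `n`, `2^{-d} ∑_{‖k‖₁ ≤ n} e^{iπ k·x}` (the imaginary parts cancel).
With the factor `2^{-d}`, where `d` is the dimension, circular convolution over `[-1,1]^d` with
Lebesgue measure is exactly the truncation of the Fourier series to `‖k‖₁ ≤ n`. -/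
def dirichletKernel (n : ℕ) (x : ι → ℝ) : ℝ :=
  ((2 : ℝ) ^ Fintype.card ι)⁻¹ * ∑ k ∈ freq ι n, Real.cos (Real.pi * ∑ i, (k i : ℝ) * x i)

/-- The de la Vallée-Poussin kernel `D_N` (for even `N`): the average of the Dirichlet kernels of
orders `N/2, …, N`. -/
def vpKernel (N : ℕ) (x : ι → ℝ) : ℝ :=
  ((N : ℝ) / 2 + 1)⁻¹ * ∑ n ∈ Finset.Icc (N / 2) N, dirichletKernel n x

/-- The measure on `[-1,1]^ι` with density the positive part (`b = true`) or the negative part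
(`b = false`) of `D_N`. -/
def vpPart (ι : Type) [Fintype ι] [DecidableEq ι] (N : ℕ) (b : Bool) : Measure (ι → ℝ) :=
  (volume.restrict (Set.Icc (-1 : ι → ℝ) 1)).withDensity fun x =>
    ENNReal.ofReal (if b then vpKernel N x else -vpKernel N x)

/-- The constants `β₊` (`b = true`) and `β₋` (`b = false`), the masses of the two parts. -/
def beta (ι : Type) [Fintype ι] [DecidableEq ι] (N : ℕ) (b : Bool) : ℝ :=
  (vpPart ι N b Set.univ).toReal

/-- The noise distributions with densities `D_N⁺` (`b = true`) and `D_N⁻` (`b = false`): the two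
parts normalized to mass one, so that `D_N = β₊ D_N⁺ - β₋ D_N⁻`. -/
def noiseLaw (ι : Type) [Fintype ι] [DecidableEq ι] (N : ℕ) (b : Bool) : Measure (ι → ℝ) :=
  (vpPart ι N b Set.univ)⁻¹ • vpPart ι N b

/-! ### Quasi-optimal designs -/

/-- The matrix `Σ = E_{z ∼ ρ} [φ_N(z) φ_N(z)ᵀ]`. -/
def designMatrix (N : ℕ) (ρ : Cube ι →₀ ℝ) : Matrix (freq ι N) (freq ι N) ℝ :=
  ∑ z ∈ ρ.support, ρ z • Matrix.vecMulVec (feature N z) (feature N z)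

/-- `ρ` is a quasi-optimal design for `{φ_N(z) : z ∈ [-1,1]^ι}`: a finitely supported probability
distribution with at most `4 Ñ log log Ñ + 16` support points, whose matrix `Σ` is invertible and
satisfies `φ_N(z)ᵀ Σ⁻¹ φ_N(z) ≤ 2 Ñ` for all `z`. -/
structure IsQuasiOptimalDesign (N : ℕ) (ρ : Cube ι →₀ ℝ) : Prop where
  nonneg : ∀ z, 0 ≤ ρ z
  sum_eq_one : ∑ z ∈ ρ.support, ρ z = 1
  card_support : (ρ.support.card : ℝ) ≤
    4 * (freq ι N).card * Real.log (Real.log (freq ι N).card) + 16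
  isUnit : IsUnit (designMatrix N ρ)
  bound : ∀ z : Cube ι,
    feature N z ⬝ᵥ ((designMatrix N ρ)⁻¹ *ᵥ feature N z) ≤ 2 * (freq ι N).card

/-! ### The algorithm -/

/-- Index set of the dataset `D_h`: `⌈n_tot ρ(z)⌉` copies of each support point `z` of `ρ`. -/
abbrev Item (ntot : ℕ) (ρ : Cube ι →₀ ℝ) : Type :=
  (z : ρ.support) × Fin ⌈(ntot : ℝ) * ρ z⌉₊

/-- The queries to the generative model: at every stage, one query for each element of the dataset
and each sign (`true` for `+`, `false` for `-`). -/
abbrev Query (H ntot : ℕ) (ρ : Cube ι →₀ ℝ) : Type :=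
  Finset.Icc 1 H × Item ntot ρ × Bool

/-- The number of samples taken from the generative model. -/
def numSamples (H ntot : ℕ) (ρ : Cube ι →₀ ℝ) : ℕ := Fintype.card (Query H ntot ρ)

/-- The random data of a run: for every query, the noise `η` and the sampled next state `s'`. The
reward returned by the query is the deterministic `R_h(z + η)`. -/
abbrev Data (H ntot : ℕ) (ρ : Cube (Idx dS dA) →₀ ℝ) : Type :=
  Query H ntot ρ → (Idx dS dA → ℝ) × Cube (Fin dS)

/-- The joint law of `(η, s')` for a query at stage `h` and dataset point `z`: `η ∼ D_N^±` and
`s' ∼ p_h(·|z + η)`, where `z + η` is understood periodically. -/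
def MDP.queryLaw (M : MDP dS dA) (N h : ℕ) (z : Cube (Idx dS dA)) (b : Bool) :
    Measure ((Idx dS dA → ℝ) × Cube (Fin dS)) :=
  (noiseLaw (Idx dS dA) N b) ⊗ₘ ((M.p h).comap (fun η => wrap (toVec z + η))
    (measurable_wrap.comp (measurable_const.add measurable_id)))

/-- The law of the data of a run: the query points do not depend on earlier answers, and all queries
use fresh randomness, so the coordinates are independent. -/
def MDP.dataLaw (M : MDP dS dA) (H N ntot : ℕ) (ρ : Cube (Idx dS dA) →₀ ℝ) :
    Measure (Data H ntot ρ) :=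
  Measure.pi fun q => M.queryLaw N q.1 q.2.1.1.1 q.2.2

/-- `Q̂(s, a) = φ_N(s, a)ᵀ θ`. -/
def qHat (N : ℕ) (θ : freq ι N → ℝ) (z : Cube ι) : ℝ := feature N z ⬝ᵥ θ

/-- `V̂(s) = max_a φ_N(s, a)ᵀ θ`. -/
def vHat (N : ℕ) (θ : freq (Idx dS dA) N → ℝ) (s : Cube (Fin dS)) : ℝ :=
  ⨆ a : Cube (Fin dA), qHat N θ (pair s a)

/-- The regression target of the dataset element `i` at stage `h`,
`(β₊ r⁺ - β₋ r⁻) + (β₊ V̂(s⁺) - β₋ V̂(s⁻))`, where `V̂` is computed from the parameter `θ` of the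
next stage. -/
def MDP.target (M : MDP dS dA) {H N ntot : ℕ} {ρ : Cube (Idx dS dA) →₀ ℝ} (ω : Data H ntot ρ)
    (h : Finset.Icc 1 H) (θ : freq (Idx dS dA) N → ℝ) (i : Item ntot ρ) : ℝ :=
  let r : Bool → ℝ := fun b => M.R h (wrap (toVec i.1.1 + (ω (h, i, b)).1))
  let v : Bool → ℝ := fun b => vHat N θ (ω (h, i, b)).2
  (beta (Idx dS dA) N true * r true - beta (Idx dS dA) N false * r false) +
    (beta (Idx dS dA) N true * v true - beta (Idx dS dA) N false * v false)

/-- The least-squares objective at stage `h`, with the targets computed from the parameter `θnext` of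
stage `h + 1`. -/
def MDP.lsLoss (M : MDP dS dA) {H N ntot : ℕ} {ρ : Cube (Idx dS dA) →₀ ℝ} (ω : Data H ntot ρ)
    (h : Finset.Icc 1 H) (θnext θ : freq (Idx dS dA) N → ℝ) : ℝ :=
  ∑ i : Item ntot ρ, (feature N i.1.1 ⬝ᵥ θ - M.target ω h θnext i) ^ 2

/-- `π` is an output of the algorithm on the data `ω`: for `h = H, …, 1` the parameter `θ h` solves
the least-squares problem of stage `h` (with `Q̂_{H+1} = 0`), and `π h` is a measurable deterministic
policy that is greedy for `Q̂_h`. -/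
def MDP.IsOutput (M : MDP dS dA) {H ntot : ℕ} (N : ℕ) {ρ : Cube (Idx dS dA) →₀ ℝ}
    (ω : Data H ntot ρ) (π : ℕ → Kernel (Cube (Fin dS)) (Cube (Fin dA))) : Prop :=
  (∀ h, IsMarkovKernel (π h)) ∧
  ∃ θ : ℕ → freq (Idx dS dA) N → ℝ, θ (H + 1) = 0 ∧
    ∀ h : Finset.Icc 1 H,
      (∀ θ' : freq (Idx dS dA) N → ℝ, M.lsLoss ω h (θ (h + 1)) (θ h) ≤ M.lsLoss ω h (θ (h + 1)) θ') ∧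
      ∃ (g : Cube (Fin dS) → Cube (Fin dA)) (hg : Measurable g),
        (∀ s a, qHat N (θ h) (pair s a) ≤ qHat N (θ h) (pair s (g s))) ∧
        π h = Kernel.deterministic g hg

/-- The algorithm succeeds on the data `ω`: it returns a policy, and every policy that it may return
(whatever the choice among maximizing actions) is `ε`-optimal. -/
def MDP.Succeeds (M : MDP dS dA) {H ntot : ℕ} (N : ℕ) (ε : ℝ) {ρ : Cube (Idx dS dA) →₀ ℝ}
    (ω : Data H ntot ρ) : Prop :=
  (∃ π, M.IsOutput N ω π) ∧ ∀ π, M.IsOutput N ω π → M.IsEpsOptimal H ε π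

end SmoothMDP

end

/-!
Why the algorithm attains the rate.

*Unbiasedness.* Shifting the query point by noise drawn from the two signed parts of the de la
Vallée-Poussin kernel `D_N`, and combining the observations with the signs `±β_±`, produces targets
whose mean, given the later stages, is the convolution of `D_N` with the Bellman update of the
next-stage estimate (`MDP.beta_integral_sampleReturn`). This convolution is a trigonometric polynomial
of degree at most `N`, so it lies in the span of the features and is reproduced by the regression: the
fitted function differs from it only by a mean-zero fluctuation (`MDP.deviation_eq`), whatever the
Bellman update of the estimate looks like.

*Error recursion.* The convolution has operator norm at most the Lebesgue constant `Λ = ‖D_N‖₁` in the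
sup norm, and the Bellman operator is a contraction, so one stage turns an error `e` into at most
`Λ e + bias + deviation` (`MDP.IsSmooth.abs_qHat_sub_optQ_le`), where the bias is that of smoothing the
optimal function `Q_h^*`. A policy that is greedy for estimates with error `η` loses at most `2 H η`
(`MDP.IsSmooth.isEpsOptimal_of_greedy`). The horizon is fixed, so it remains to make bias and deviation
a small constant multiple of `ε`.

*The Lebesgue constant.* `Λ` is bounded independently of `N` (`integral_abs_vpKernel_le`). The kernel is,
up to a factor `O(1 / N)`, a difference of two Cesàro sums of the `ℓ¹`-ball partial sums, whose generating
function is `(1 - z)⁻²` times a product of one-dimensional Poisson kernels with parameter `z`. In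
Cauchy's formula on the circle of radius `1 - O(1 / N)` (`cesaroSum_eq_integral`), the `L¹` norm of the
product factorizes, and each factor is `O((|1 - z| / (1 - |z|))^s)` for any `s > 0`
(`integral_norm_poissonC_le`); with `s = 1 / (2 d)` the integral over the circle is `O(N)`.

*Bias.* `D_N` reproduces trigonometric polynomials of degree `N / 2`, so the bias is at most `1 + Λ` times
the error of the best approximation by such polynomials, which for functions of `C^{ν,1}_p` is
`O(N^{-(ν+1)})`. This is proved with Fejér–Korovkin means and mixed differences of order `ν + 1`
(`abs_sub_conv_vpKernel_le`, `diffBound_periodize`). The norm bounds on `Q_h^*` come from iterating the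
smoothness assumption (`MDP.IsSmooth.optQ`).

*Deviation.* The fitted value at a point is a weighted sum of the targets, and the squares of the weights
sum to at most `2 Ñ / n_tot` for a quasi-optimal design (`IsQuasiOptimalDesign.sum_lsWeight_sq_le`).
Hoeffding's inequality, conditionally on the later stages (`measure_pi_abs_sum_ge_le_of_local`), bounds the
deviation at a point; the deviation is a trigonometric polynomial, so a union bound over a polynomially
large grid controls its maximum (`abs_trigPoly_le_of_grid`, `MDP.exists_deviation_le`).

Balancing the two, `N ≍ ε^{-1/(ν+1)}` and `n_tot ≍ Ñ ε^{-2} log (1 / (ε δ))` with `Ñ = O(N^d)`. Existence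
is established along the way: the uniform distribution on an equispaced grid is a quasi-optimal design
once `log log Ñ` exceeds a constant depending on `d` (`isQuasiOptimalDesign_gridDesign`), the noise
distributions are well defined since neither part of the kernel vanishes (`vpPart_univ_ne_zero`), and a
greedy policy can be chosen measurably (`exists_measurable_argmax`).
-/

set_option linter.unusedSectionVars false

namespace SmoothMDP

/-! ### Trigonometric polynomials -/

section Trig

variable {ι : Type} [Fintype ι] [DecidableEq ι]

/-- The trigonometric monomial `x ↦ ∏ i, soc (n i) (x i)` on `ℝ^ι`. -/
noncomputable def trigFn (n : ι → ℤ) (x : ι → ℝ) : ℝ := ∏ i, soc (n i) (x i)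

/-- The inverse of the mean square of `trigFn n`: `2` to the number of nonzero entries of `n`. -/
noncomputable def trigWeight (n : ι → ℤ) : ℝ := ∏ i, if n i = 0 then 1 else 2

theorem trigWeight_pos (n : ι → ℤ) : 0 < trigWeight n :=
  Finset.prod_pos fun i _ => by split_ifs <;> norm_num

theorem feature_apply (N : ℕ) (z : Cube ι) (n : freq ι N) :
    feature N z n = trigFn n.1 (toVec z) := rfl

theorem mem_freq {N : ℕ} {k : ι → ℤ} : k ∈ freq ι N ↔ ∑ i, |k i| ≤ N := by
  unfold freq
  simp only [Finset.mem_filter, Fintype.mem_piFinset, Finset.mem_Icc, and_iff_right_iff_imp]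
  intro h i
  rw [← abs_le]
  exact (Finset.single_le_sum (fun i _ => abs_nonneg (k i)) (Finset.mem_univ i)).trans h

theorem abs_le_of_mem_freq {N : ℕ} {k : ι → ℤ} (h : k ∈ freq ι N) (i : ι) : |k i| ≤ N :=
  (Finset.single_le_sum (fun i _ => abs_nonneg (k i)) (Finset.mem_univ i)).trans (mem_freq.1 h)

theorem freq_card_pos (N : ℕ) : 0 < (freq ι N).card :=
  Finset.card_pos.2 ⟨0, mem_freq.2 (by simp)⟩

/-- The index set `freq ι N` is invariant under sign changes of single coordinates, so the summand
may be averaged over all sign changes. -/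
theorem sum_freq_prod_symm {R : Type*} [Field R] [CharZero R] (N : ℕ) (g : ι → ℤ → R) :
    ∑ k ∈ freq ι N, ∏ i, g i (k i) = ∑ k ∈ freq ι N, ∏ i, (g i (k i) + g i (-k i)) / 2 := by
  have hσ : ∀ σ : ι → Bool, ∑ k ∈ freq ι N, ∏ i, g i (k i)
      = ∑ k ∈ freq ι N, ∏ i, g i (if σ i then k i else -k i) := by
    intro σ
    refine Finset.sum_nbij' (fun k i => if σ i then k i else -k i)
      (fun k i => if σ i then k i else -k i) ?_ ?_ ?_ ?_ ?_
    · intro k hk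
      rw [mem_freq] at hk ⊢
      refine le_of_eq_of_le (Finset.sum_congr rfl fun i _ => ?_) hk
      split_ifs <;> simp
    · intro k hk
      rw [mem_freq] at hk ⊢
      refine le_of_eq_of_le (Finset.sum_congr rfl fun i _ => ?_) hk
      split_ifs <;> simp
    · intro k _; funext i; by_cases h : σ i <;> simp [h]
    · intro k _; funext i; by_cases h : σ i <;> simp [h]
    · intro k _
      refine Finset.prod_congr rfl fun i _ => ?_
      by_cases h : σ i <;> simp [h]
  have h1 : ∑ σ : ι → Bool, ∑ k ∈ freq ι N, ∏ i, g i (if σ i then k i else -k i)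
      = ∑ k ∈ freq ι N, ∏ i, (g i (k i) + g i (-k i)) := by
    rw [Finset.sum_comm]
    refine Finset.sum_congr rfl fun k _ => ?_
    have := Finset.prod_univ_sum (fun _ : ι => (Finset.univ : Finset Bool))
      (fun i b => g i (if b then k i else -k i))
    simp only [Fintype.piFinset_univ] at this
    rw [← this]
    simp
  have h2 : (2 : R) ^ Fintype.card ι * ∑ k ∈ freq ι N, ∏ i, g i (k i)
      = ∑ k ∈ freq ι N, ∏ i, (g i (k i) + g i (-k i)) := by
    rw [← h1, Finset.sum_congr rfl fun σ _ => (hσ σ).symm]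
    simp
  have h3 : (2 : R) ^ Fintype.card ι ≠ 0 := pow_ne_zero _ two_ne_zero
  apply mul_left_cancel₀ h3
  rw [h2, Finset.mul_sum]
  refine Finset.sum_congr rfl fun k _ => ?_
  rw [Finset.prod_div_distrib]
  simp only [Finset.prod_const, Finset.card_univ]
  field_simp

/-- The Dirichlet kernel of the `ℓ¹` ball as a sum of tensor products of cosines; everything that has to
factorize over the coordinates uses this form. -/
theorem sum_freq_cos (N : ℕ) (x : ι → ℝ) :
    ∑ k ∈ freq ι N, Real.cos (Real.pi * ∑ i, (k i : ℝ) * x i)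
      = ∑ k ∈ freq ι N, ∏ i, Real.cos (Real.pi * k i * x i) := by
  have h := sum_freq_prod_symm (R := ℂ) N
    (fun i m => Complex.exp ((Real.pi * m * x i : ℝ) * Complex.I))
  have h1 : ∀ k : ι → ℤ, (∏ i, Complex.exp ((Real.pi * k i * x i : ℝ) * Complex.I)).re
      = Real.cos (Real.pi * ∑ i, (k i : ℝ) * x i) := by
    intro k
    rw [← Complex.exp_sum, ← Finset.sum_mul, ← Complex.ofReal_sum, Complex.exp_ofReal_mul_I_re,
      Finset.mul_sum]
    simp only [mul_assoc]
  have h2 : ∀ k : ι → ℤ, (∏ i, (Complex.exp ((Real.pi * k i * x i : ℝ) * Complex.I)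
      + Complex.exp ((Real.pi * (-k i : ℤ) * x i : ℝ) * Complex.I)) / 2)
      = ((∏ i, Real.cos (Real.pi * k i * x i) : ℝ) : ℂ) := by
    intro k
    rw [Complex.ofReal_prod]
    refine Finset.prod_congr rfl fun i _ => ?_
    rw [Complex.ofReal_cos, Complex.cos]
    congr 3
    push_cast
    ring
  have h3 := congrArg Complex.re h
  simp only [Complex.re_sum] at h3
  rw [Finset.sum_congr rfl fun k _ => h1 k] at h3
  rw [h3]
  refine Finset.sum_congr rfl fun k _ => ?_
  rw [h2, Complex.ofReal_re]

theorem soc_of_pos {n : ℤ} (hn : 0 < n) (t : ℝ) : soc n t = Real.sin (n * Real.pi * t) := by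
  simp [soc, hn, hn.ne']

theorem soc_of_nonpos {n : ℤ} (hn : n ≤ 0) (t : ℝ) : soc n t = Real.cos (n * Real.pi * t) := by
  rcases hn.eq_or_lt with rfl | h
  · simp [soc]
  · simp [soc, h.ne, hn.not_gt]

theorem continuous_soc (n : ℤ) : Continuous (soc n) := by
  rcases lt_or_ge 0 n with h | h
  · rw [funext (soc_of_pos h)]; fun_prop
  · rw [funext (soc_of_nonpos h)]; fun_prop

theorem abs_soc_le (n : ℤ) (t : ℝ) : |soc n t| ≤ 1 := by
  rcases lt_or_ge 0 n with h | h
  · rw [soc_of_pos h]; exact Real.abs_sin_le_one _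
  · rw [soc_of_nonpos h]; exact Real.abs_cos_le_one _

theorem soc_mul_soc_symm (m : ℤ) (x y : ℝ) :
    ((if m = 0 then 1 else 2) * (soc m x * soc m y)
      + (if -m = 0 then 1 else 2) * (soc (-m) x * soc (-m) y)) / 2
      = Real.cos (Real.pi * m * (x - y)) := by
  have e : Real.pi * m * (x - y) = m * Real.pi * x - m * Real.pi * y := by ring
  rcases lt_trichotomy m 0 with h | h | h
  · rw [soc_of_nonpos h.le, soc_of_nonpos h.le, soc_of_pos (neg_pos.2 h), soc_of_pos (neg_pos.2 h),
      e, Real.cos_sub]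
    simp only [h.ne, neg_eq_zero, if_false]
    push_cast
    simp only [neg_mul, Real.sin_neg]
    ring
  · subst h; simp [soc]
  · rw [soc_of_pos h, soc_of_pos h, soc_of_nonpos (neg_nonpos.2 h.le),
      soc_of_nonpos (neg_nonpos.2 h.le), e, Real.cos_sub]
    simp only [h.ne', neg_eq_zero, if_false]
    push_cast
    simp only [neg_mul, Real.cos_neg]
    ring

/-- The addition theorem for the trigonometric monomials of total degree at most `N`. -/
theorem sum_trigWeight_mul (N : ℕ) (x y : ι → ℝ) :
    ∑ k ∈ freq ι N, trigWeight k * (trigFn k x * trigFn k y)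
      = ∑ k ∈ freq ι N, ∏ i, Real.cos (Real.pi * k i * (x i - y i)) := by
  have h := sum_freq_prod_symm (R := ℝ) N
    (fun i m => (if m = 0 then 1 else 2) * (soc m (x i) * soc m (y i)))
  simp only [soc_mul_soc_symm] at h
  rw [← h]
  refine Finset.sum_congr rfl fun k _ => ?_
  simp only [trigWeight, trigFn, ← Finset.prod_mul_distrib]

theorem sum_trigWeight_mul_eq_sum_cos (N : ℕ) (x y : ι → ℝ) :
    ∑ k ∈ freq ι N, trigWeight k * (trigFn k x * trigFn k y)
      = ∑ k ∈ freq ι N, Real.cos (Real.pi * ∑ i, (k i : ℝ) * (x i - y i)) := by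
  rw [sum_trigWeight_mul, ← sum_freq_cos N (fun i => x i - y i)]

theorem sum_trigWeight_mul_self (N : ℕ) (x : ι → ℝ) :
    ∑ k ∈ freq ι N, trigWeight k * (trigFn k x * trigFn k x) = (freq ι N).card := by
  rw [sum_trigWeight_mul]; simp

/-- A probability measure on `ℝ` integrating the exponentials of frequency at most `L` like the
uniform distribution on a period. -/
structure IsExact (L : ℕ) (μ : Measure ℝ) : Prop where
  finite : IsFiniteMeasure μ
  cos : ∀ l : ℤ, |l| ≤ L → ∫ y, Real.cos (l * Real.pi * y) ∂μ = if l = 0 then 1 else 0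
  sin : ∀ l : ℤ, |l| ≤ L → ∫ y, Real.sin (l * Real.pi * y) ∂μ = 0

theorem integrable_cos_mul (μ : Measure ℝ) [IsFiniteMeasure μ] (c : ℝ) :
    Integrable (fun y => Real.cos (c * y)) μ :=
  Integrable.of_bound (C := 1) (by fun_prop) (Filter.Eventually.of_forall fun y => by
    simpa using Real.abs_cos_le_one _)

theorem integrable_sin_mul (μ : Measure ℝ) [IsFiniteMeasure μ] (c : ℝ) :
    Integrable (fun y => Real.sin (c * y)) μ :=
  Integrable.of_bound (C := 1) (by fun_prop) (Filter.Eventually.of_forall fun y => by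
    simpa using Real.abs_sin_le_one _)

theorem IsExact.cos_cos {L : ℕ} {μ : Measure ℝ} (h : IsExact L μ) {k n : ℤ} (hk : |k| + |n| ≤ L) :
    ∫ y, Real.cos (k * Real.pi * y) * Real.cos (n * Real.pi * y) ∂μ
      = ((if k = n then 1 else 0) + (if k = -n then 1 else 0)) / 2 := by
  have := h.finite
  have e : ∀ y : ℝ, Real.cos (k * Real.pi * y) * Real.cos (n * Real.pi * y)
      = (Real.cos ((k - n : ℤ) * Real.pi * y) + Real.cos ((k + n : ℤ) * Real.pi * y)) / 2 := by
    intro y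
    push_cast
    rw [sub_mul, sub_mul, add_mul, add_mul, Real.cos_sub, Real.cos_add]; ring
  simp only [e]
  rw [integral_div, integral_add (integrable_cos_mul μ _) (integrable_cos_mul μ _),
    h.cos _ ((abs_sub k n).trans hk), h.cos _ ((abs_add_le k n).trans hk)]
  simp only [sub_eq_zero, add_eq_zero_iff_eq_neg]

theorem IsExact.sin_sin {L : ℕ} {μ : Measure ℝ} (h : IsExact L μ) {k n : ℤ} (hk : |k| + |n| ≤ L) :
    ∫ y, Real.sin (k * Real.pi * y) * Real.sin (n * Real.pi * y) ∂μ
      = ((if k = n then 1 else 0) - (if k = -n then 1 else 0)) / 2 := by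
  have := h.finite
  have e : ∀ y : ℝ, Real.sin (k * Real.pi * y) * Real.sin (n * Real.pi * y)
      = (Real.cos ((k - n : ℤ) * Real.pi * y) - Real.cos ((k + n : ℤ) * Real.pi * y)) / 2 := by
    intro y
    push_cast
    rw [sub_mul, sub_mul, add_mul, add_mul, Real.cos_sub, Real.cos_add]; ring
  simp only [e]
  rw [integral_div, integral_sub (integrable_cos_mul μ _) (integrable_cos_mul μ _),
    h.cos _ ((abs_sub k n).trans hk), h.cos _ ((abs_add_le k n).trans hk)]
  simp only [sub_eq_zero, add_eq_zero_iff_eq_neg]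

theorem IsExact.cos_sin {L : ℕ} {μ : Measure ℝ} (h : IsExact L μ) {k n : ℤ} (hk : |k| + |n| ≤ L) :
    ∫ y, Real.cos (k * Real.pi * y) * Real.sin (n * Real.pi * y) ∂μ = 0 := by
  have := h.finite
  have e : ∀ y : ℝ, Real.cos (k * Real.pi * y) * Real.sin (n * Real.pi * y)
      = (Real.sin ((k + n : ℤ) * Real.pi * y) - Real.sin ((k - n : ℤ) * Real.pi * y)) / 2 := by
    intro y
    push_cast
    rw [sub_mul, sub_mul, add_mul, add_mul, Real.sin_sub, Real.sin_add]; ring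
  simp only [e]
  rw [integral_div, integral_sub (integrable_sin_mul μ _) (integrable_sin_mul μ _),
    h.sin _ ((abs_sub k n).trans hk), h.sin _ ((abs_add_le k n).trans hk)]
  simp

theorem IsExact.soc_soc {L : ℕ} {μ : Measure ℝ} (h : IsExact L μ) {k n : ℤ} (hk : |k| + |n| ≤ L) :
    ∫ y, soc k y * soc n y ∂μ = if k = n then (if n = 0 then 1 else 2)⁻¹ else 0 := by
  rcases lt_or_ge 0 k with hk0 | hk0 <;> rcases lt_or_ge 0 n with hn0 | hn0
  · simp only [soc_of_pos hk0, soc_of_pos hn0, h.sin_sin hk]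
    have : k ≠ -n := by omega
    simp only [this, hn0.ne', if_false]
    split_ifs <;> norm_num
  · simp only [soc_of_pos hk0, soc_of_nonpos hn0]
    have : k ≠ n := by omega
    simp only [this, if_false, mul_comm (Real.sin _)]
    exact h.cos_sin (by rwa [add_comm])
  · simp only [soc_of_pos hn0, soc_of_nonpos hk0]
    have : k ≠ n := by omega
    simp only [this, if_false]
    exact h.cos_sin hk
  · simp only [soc_of_nonpos hn0, soc_of_nonpos hk0, h.cos_cos hk]
    by_cases h0 : n = 0
    · subst h0; by_cases hk1 : k = 0 <;> simp [hk1]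
    · have : k ≠ -n := by omega
      simp only [this, h0, if_false]
      split_ifs <;> norm_num

/-- The convolution of `cos (m π ·)` with a one-dimensional monomial. -/
theorem IsExact.cos_soc_add {L : ℕ} {μ : Measure ℝ} (h : IsExact L μ) {m n : ℤ}
    (hk : |m| + |n| ≤ L) (x : ℝ) :
    ∫ t, Real.cos (Real.pi * m * t) * soc n (x + t) ∂μ
      = (if |m| = |n| then (if n = 0 then 1 else 2)⁻¹ else 0) * soc n x := by
  have := h.finite
  have hcc : Integrable (fun y => Real.cos (m * Real.pi * y) * Real.cos (n * Real.pi * y)) μ :=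
    Integrable.of_bound (C := 1) (by fun_prop) (Filter.Eventually.of_forall fun y => by
      rw [norm_mul]
      exact mul_le_one₀ (Real.abs_cos_le_one _) (norm_nonneg _) (Real.abs_cos_le_one _))
  have hcs : Integrable (fun y => Real.cos (m * Real.pi * y) * Real.sin (n * Real.pi * y)) μ :=
    Integrable.of_bound (C := 1) (by fun_prop) (Filter.Eventually.of_forall fun y => by
      rw [norm_mul]
      exact mul_le_one₀ (Real.abs_cos_le_one _) (norm_nonneg _) (Real.abs_sin_le_one _))
  have hval : ((if m = n then (1 : ℝ) else 0) + (if m = -n then 1 else 0)) / 2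
      = if |m| = |n| then (if n = 0 then 1 else 2)⁻¹ else 0 := by
    by_cases h0 : n = 0
    · subst h0; by_cases hm : m = 0 <;> simp [hm]
    · by_cases h1 : m = n
      · have : m ≠ -n := by omega
        simp [h1, h0, show n ≠ -n by omega]
      · by_cases h2 : m = -n
        · simp [h2, h0, show -n ≠ n by omega]
        · have : |m| ≠ |n| := fun hh => by rcases abs_eq_abs.1 hh with h' | h' <;> contradiction
          simp [h1, h2, this]
  rcases lt_or_ge 0 n with hn0 | hn0
  · have e : ∀ t, Real.cos (Real.pi * m * t) * soc n (x + t)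
        = Real.cos (m * Real.pi * t) * Real.cos (n * Real.pi * t) * soc n x
          + Real.cos (m * Real.pi * t) * Real.sin (n * Real.pi * t) * Real.cos (n * Real.pi * x) := by
      intro t
      rw [soc_of_pos hn0, soc_of_pos hn0, mul_add, Real.sin_add, mul_comm Real.pi]; ring
    simp only [e]
    rw [integral_add (hcc.mul_const _) (hcs.mul_const _), integral_mul_const, integral_mul_const,
      h.cos_cos hk, h.cos_sin hk, hval]
    ring
  · have e : ∀ t, Real.cos (Real.pi * m * t) * soc n (x + t)
        = Real.cos (m * Real.pi * t) * Real.cos (n * Real.pi * t) * soc n x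
          - Real.cos (m * Real.pi * t) * Real.sin (n * Real.pi * t) * Real.sin (n * Real.pi * x) := by
      intro t
      rw [soc_of_nonpos hn0, soc_of_nonpos hn0, mul_add, Real.cos_add, mul_comm Real.pi]; ring
    simp only [e]
    rw [integral_sub (hcc.mul_const _) (hcs.mul_const _), integral_mul_const, integral_mul_const,
      h.cos_cos hk, h.cos_sin hk, hval]
    ring

/-- The uniform distribution on `[-1,1]`. -/
noncomputable def unifIcc : Measure ℝ := (2 : ℝ≥0∞)⁻¹ • volume.restrict (Set.Icc (-1 : ℝ) 1)

theorem integral_unifIcc (f : ℝ → ℝ) :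
    ∫ y, f y ∂unifIcc = (∫ y in Set.Icc (-1 : ℝ) 1, f y) / 2 := by
  rw [unifIcc, integral_smul_measure]
  simp
  ring

theorem isExact_unifIcc (L : ℕ) : IsExact L unifIcc := by
  have key : ∀ f : ℝ → ℝ, ∫ y, f y ∂unifIcc = (∫ y in (-1 : ℝ)..1, f y) / 2 := by
    intro f
    rw [integral_unifIcc, integral_Icc_eq_integral_Ioc, intervalIntegral.integral_of_le (by norm_num)]
  refine ⟨⟨?_⟩, ?_, ?_⟩
  · simp [unifIcc]
    exact ENNReal.mul_lt_top (by simp) (by simp)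
  · intro l _
    rw [key]
    split_ifs with h
    · simp [h]
    · have hl : (l : ℝ) * Real.pi ≠ 0 := mul_ne_zero (by exact_mod_cast h) Real.pi_ne_zero
      rw [intervalIntegral.integral_comp_mul_left (fun y => Real.cos y) hl, integral_cos]
      simp [Real.sin_int_mul_pi]
  · intro l _
    rw [key]
    by_cases h : l = 0
    · simp [h]
    · have hl : (l : ℝ) * Real.pi ≠ 0 := mul_ne_zero (by exact_mod_cast h) Real.pi_ne_zero
      rw [intervalIntegral.integral_comp_mul_left (fun y => Real.sin y) hl, integral_sin]
      simp

/-- The `j`-th of `m` equispaced points of `[-1, 1)`. -/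
noncomputable def gridCoord (m : ℕ) (j : Fin m) : ℝ := -1 + 2 * (j : ℝ) / m

theorem gridCoord_mem (m : ℕ) (j : Fin m) : gridCoord m j ∈ Set.Icc (-1 : ℝ) 1 := by
  have hm : (0 : ℝ) < m := by exact_mod_cast j.pos
  have h1 : (j : ℝ) ≤ m := by exact_mod_cast j.2.le
  have h2 : 2 * (j : ℝ) / m ≤ 2 := by rw [div_le_iff₀ hm]; linarith
  have h3 : 0 ≤ 2 * (j : ℝ) / m := by positivity
  constructor <;> unfold gridCoord <;> linarith

/-- The uniform distribution on `m` equispaced points. -/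
noncomputable def gridMeasure (m : ℕ) : Measure ℝ :=
  (m : ℝ≥0∞)⁻¹ • ∑ j : Fin m, Measure.dirac (gridCoord m j)

theorem integral_gridMeasure (m : ℕ) (f : ℝ → ℝ) :
    ∫ y, f y ∂gridMeasure m = (m : ℝ)⁻¹ * ∑ j : Fin m, f (gridCoord m j) := by
  rw [gridMeasure, integral_smul_measure, integral_finsetSum_measure]
  · simp
  · intro j _; exact integrable_dirac (by simp)

/-- The equispaced points are equidistributed for the frequencies below `m`: the exponential sums are
geometric sums of a nontrivial `m`-th root of unity. -/
theorem isExact_gridMeasure {L m : ℕ} (hm : L < m) : IsExact L (gridMeasure m) := by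
  have hm0 : (m : ℂ) ≠ 0 := by exact_mod_cast (by omega : m ≠ 0)
  have key : ∀ l : ℤ, |l| ≤ L → ∑ j : Fin m, Complex.exp ((l * Real.pi * gridCoord m j : ℝ) * Complex.I)
      = if l = 0 then (m : ℂ) else 0 := by
    intro l hl
    split_ifs with h
    · simp [h]
    set w : ℂ := Complex.exp (2 * Real.pi * Complex.I * (l / m)) with hw
    have e : ∀ j : Fin m, Complex.exp ((l * Real.pi * gridCoord m j : ℝ) * Complex.I)
        = Complex.exp (-(l * Real.pi * Complex.I)) * w ^ (j : ℕ) := by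
      intro j
      rw [hw, ← Complex.exp_nat_mul, ← Complex.exp_add]
      congr 1
      simp only [gridCoord]
      push_cast
      field_simp
    rw [Finset.sum_congr rfl fun j _ => e j, ← Finset.mul_sum, Fin.sum_univ_eq_sum_range (fun j => w ^ j)]
    have hw1 : w ≠ 1 := by
      rw [hw, Ne, Complex.exp_eq_one_iff]
      rintro ⟨n, hn⟩
      have h2 : (2 * Real.pi * Complex.I : ℂ) ≠ 0 := Complex.two_pi_I_ne_zero
      have h3 : (l : ℂ) / m = n := by
        apply mul_left_cancel₀ h2
        rw [hn]; ring
      rw [div_eq_iff hm0] at h3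
      have h4 : l = n * m := by exact_mod_cast h3
      have h5 : n ≠ 0 := by rintro rfl; simp at h4; exact h h4
      have h6 : (1 : ℤ) ≤ |n| := Int.one_le_abs h5
      rw [h4, abs_mul, Nat.abs_cast] at hl
      nlinarith
    have hwm : w ^ m = 1 := by
      rw [hw, ← Complex.exp_nat_mul, Complex.exp_eq_one_iff]
      exact ⟨l, by field_simp⟩
    rw [geom_sum_eq hw1, hwm]; simp
  refine ⟨⟨?_⟩, ?_, ?_⟩
  · simp only [gridMeasure, Measure.smul_apply, Measure.finsetSum_apply, measure_univ, smul_eq_mul]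
    refine ENNReal.mul_lt_top ?_ (by simp)
    simp only [ENNReal.inv_lt_top]
    exact_mod_cast (by omega : 0 < m)
  · intro l hl
    rw [integral_gridMeasure]
    have h := congrArg Complex.re (key l hl)
    rw [Complex.re_sum] at h
    simp only [Complex.exp_ofReal_mul_I_re] at h
    rw [h]
    have : (m : ℝ) ≠ 0 := by exact_mod_cast (by omega : m ≠ 0)
    split_ifs <;> simp [this]
  · intro l hl
    rw [integral_gridMeasure]
    have h := congrArg Complex.im (key l hl)
    rw [Complex.im_sum] at h
    simp only [Complex.exp_ofReal_mul_I_im] at h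
    rw [h]
    split_ifs <;> simp

end Trig

/-! ### Equispaced grids and quasi-optimal designs -/

section Grid

variable {ι : Type} [Fintype ι] [DecidableEq ι]

/-- The points of the cube all of whose coordinates are equispaced points. -/
noncomputable def gridPt (m : ℕ) (j : ι → Fin m) : Cube ι := fun i => ⟨gridCoord m (j i), gridCoord_mem m (j i)⟩

theorem gridPt_injective (m : ℕ) : Function.Injective (gridPt (ι := ι) m) := by
  intro j j' h
  funext i
  have h1 : gridCoord m (j i) = gridCoord m (j' i) := congrArg Subtype.val (congrFun h i)
  have hm : (0 : ℝ) < m := by exact_mod_cast (j i).pos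
  unfold gridCoord at h1
  have h2 : ((j i : ℕ) : ℝ) = (j' i : ℕ) := by
    field_simp at h1
    linarith
  exact Fin.ext (by exact_mod_cast h2)

theorem mean_grid_prod (m : ℕ) (f : ι → ℝ → ℝ) :
    ((m : ℝ) ^ Fintype.card ι)⁻¹ * ∑ j : ι → Fin m, ∏ i, f i (gridCoord m (j i))
      = ∏ i, ∫ y, f i y ∂gridMeasure m := by
  have := Finset.prod_univ_sum (fun _ : ι => (Finset.univ : Finset (Fin m)))
      (fun i b => f i (gridCoord m b))
  simp only [Fintype.piFinset_univ] at this
  rw [← this]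
  simp only [integral_gridMeasure, Finset.prod_mul_distrib, Finset.prod_const, Finset.card_univ,
    inv_pow]

theorem prod_soc_orth {L : ℕ} {μ : Measure ℝ} (h : IsExact L μ) {k n : ι → ℤ}
    (hk : ∀ i, |k i| + |n i| ≤ L) :
    ∏ i, ∫ y, soc (k i) y * soc (n i) y ∂μ = if k = n then (trigWeight n)⁻¹ else 0 := by
  rw [Finset.prod_congr rfl fun i _ => h.soc_soc (hk i)]
  split_ifs with hkn
  · subst hkn
    simp [trigWeight]
  · obtain ⟨i, hi⟩ := Function.ne_iff.1 hkn
    exact Finset.prod_eq_zero (Finset.mem_univ i) (by simp [hi])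

/-- Discrete orthogonality of the trigonometric monomials; products of two of them have frequencies at
most `2 N` in each coordinate, below the number `m` of grid points. -/
theorem mean_grid_trigFn {N m : ℕ} (hm : 2 * N < m) {k n : ι → ℤ} (hk : k ∈ freq ι N)
    (hn : n ∈ freq ι N) :
    ((m : ℝ) ^ Fintype.card ι)⁻¹ * ∑ j : ι → Fin m,
      trigFn k (toVec (gridPt m j)) * trigFn n (toVec (gridPt m j))
      = if k = n then (trigWeight n)⁻¹ else 0 := by
  rw [← prod_soc_orth (isExact_gridMeasure hm) (fun i => by
    have := abs_le_of_mem_freq hk i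
    have := abs_le_of_mem_freq hn i
    push_cast; linarith), ← mean_grid_prod m (fun i y => soc (k i) y * soc (n i) y)]
  congr 1
  refine Finset.sum_congr rfl fun j _ => ?_
  simp only [trigFn, Finset.prod_mul_distrib]
  rfl

/-- A trigonometric polynomial is recovered from its values on a fine grid. -/
theorem trigPoly_eq_mean_grid {N m : ℕ} (hm : 2 * N < m) (θ : freq ι N → ℝ) (x : ι → ℝ) :
    ∑ n, θ n * trigFn n.1 x = ((m : ℝ) ^ Fintype.card ι)⁻¹ * ∑ j : ι → Fin m,
      (∑ n, θ n * trigFn n.1 (toVec (gridPt m j))) *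
        ∑ k ∈ freq ι N, Real.cos (Real.pi * ∑ i, (k i : ℝ) * (x i - toVec (gridPt m j) i)) := by
  simp only [← sum_trigWeight_mul_eq_sum_cos]
  simp only [← Finset.sum_coe_sort (freq ι N)]
  have e : ∀ j : ι → Fin m, (∑ n : freq ι N, θ n * trigFn n.1 (toVec (gridPt m j))) *
        ∑ k : freq ι N, trigWeight k.1 * (trigFn k.1 x * trigFn k.1 (toVec (gridPt m j)))
      = ∑ n : freq ι N, ∑ k : freq ι N, (θ n * trigWeight k.1 * trigFn k.1 x) *
        (trigFn n.1 (toVec (gridPt m j)) * trigFn k.1 (toVec (gridPt m j))) := by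
    intro j
    rw [Finset.sum_mul_sum]
    refine Finset.sum_congr rfl fun n _ => Finset.sum_congr rfl fun k _ => ?_
    ring
  rw [Finset.sum_congr rfl fun j _ => e j, Finset.sum_comm, Finset.mul_sum]
  refine Finset.sum_congr rfl fun n _ => ?_
  rw [Finset.sum_comm, Finset.mul_sum]
  have e2 : ∀ k : freq ι N, ((m : ℝ) ^ Fintype.card ι)⁻¹ * ∑ j : ι → Fin m,
      (θ n * trigWeight k.1 * trigFn k.1 x) *
        (trigFn n.1 (toVec (gridPt m j)) * trigFn k.1 (toVec (gridPt m j)))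
      = if n = k then θ n * trigFn n.1 x else 0 := by
    intro k
    rw [← Finset.mul_sum, mul_left_comm, mean_grid_trigFn hm n.2 k.2]
    by_cases h : n = k
    · subst h
      simp only [if_true]
      have := (trigWeight_pos n.1).ne'
      field_simp
    · have : n.1 ≠ k.1 := fun hh => h (Subtype.ext hh)
      simp [h, this]
  rw [Finset.sum_congr rfl fun k _ => e2 k]
  simp

theorem exists_gridCoord_near {m : ℕ} (hm : 0 < m) {t : ℝ} (ht : t ∈ Set.Icc (-1 : ℝ) 1) :
    ∃ j : Fin m, |t - gridCoord m j| ≤ 2 / m := by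
  have hm' : (0 : ℝ) < m := by exact_mod_cast hm
  have h0 : 0 ≤ (t + 1) / 2 * m := by
    have := ht.1
    have : 0 ≤ (t + 1) / 2 := by linarith
    positivity
  by_cases h1 : t < 1
  · have hlt : ⌊(t + 1) / 2 * m⌋₊ < m := by
      rw [Nat.floor_lt h0]
      nlinarith
    refine ⟨⟨⌊(t + 1) / 2 * m⌋₊, hlt⟩, ?_⟩
    have h2 := Nat.floor_le h0
    have h3 := Nat.lt_floor_add_one ((t + 1) / 2 * m)
    set q : ℝ := (⌊(t + 1) / 2 * m⌋₊ : ℝ)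
    have e : t - gridCoord m ⟨⌊(t + 1) / 2 * m⌋₊, hlt⟩ = ((t + 1) / 2 * m - q) * (2 / m) := by
      change t - (-1 + 2 * q / m) = _
      field_simp
      ring
    rw [e, abs_mul, abs_of_nonneg (by linarith : 0 ≤ (t + 1) / 2 * m - q),
      abs_of_pos (by positivity : (0 : ℝ) < 2 / m)]
    have : (0 : ℝ) < 2 / m := by positivity
    nlinarith
  · have h2 : t = 1 := le_antisymm ht.2 (not_lt.1 h1)
    refine ⟨⟨m - 1, by omega⟩, ?_⟩
    have e : t - gridCoord m ⟨m - 1, by omega⟩ = 2 / m := by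
      unfold gridCoord
      simp only
      rw [Nat.cast_sub (by omega), h2]
      field_simp
      push_cast
      ring
    rw [e, abs_of_pos (by positivity)]

/-- On a grid that is fine compared to the degree, a trigonometric polynomial attains at least half
of its maximum. -/
theorem abs_trigPoly_le_of_grid {N m : ℕ} (hm : 16 * (N + 1) * (freq ι N).card ≤ m)
    (θ : freq ι N → ℝ) {t : ℝ}
    (ht : ∀ j : ι → Fin m, |∑ n, θ n * trigFn n.1 (toVec (gridPt m j))| ≤ t) (z : Cube ι) :
    |∑ n, θ n * trigFn n.1 (toVec z)| ≤ 2 * t := by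
  have hcard := freq_card_pos (ι := ι) N
  have hm2 : 2 * N < m := by nlinarith
  have hm0 : 0 < m := by omega
  have hm' : (0 : ℝ) < m := by exact_mod_cast hm0
  choose j hj using fun i => exists_gridCoord_near hm0 (z i).2
  have ht0 : 0 ≤ t := (abs_nonneg _).trans (ht j)
  have h1 := trigPoly_eq_mean_grid hm2 θ (toVec z)
  have h2 := trigPoly_eq_mean_grid hm2 θ (toVec (gridPt m j))
  set e : (ι → ℝ) → ℝ := fun x => ∑ n, θ n * trigFn n.1 x with he
  -- Compare with the nearest grid point, in the representation by values on the grid.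
  have hdiff : |e (toVec z) - e (toVec (gridPt m j))| ≤ t := by
    simp only [he]
    rw [h1, h2, ← mul_sub, ← Finset.sum_sub_distrib, abs_mul,
      abs_of_nonneg (by positivity : (0 : ℝ) ≤ ((m : ℝ) ^ Fintype.card ι)⁻¹)]
    have hmd : (0 : ℝ) < (m : ℝ) ^ Fintype.card ι := by positivity
    rw [inv_mul_le_iff₀ hmd]
    refine (Finset.abs_sum_le_sum_abs _ _).trans ?_
    have : ∀ j' ∈ (Finset.univ : Finset (ι → Fin m)),
        |(∑ n, θ n * trigFn n.1 (toVec (gridPt m j'))) *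
        ∑ k ∈ freq ι N, Real.cos (Real.pi * ∑ i, (k i : ℝ) * (toVec z i - toVec (gridPt m j') i))
        - (∑ n, θ n * trigFn n.1 (toVec (gridPt m j'))) *
        ∑ k ∈ freq ι N, Real.cos (Real.pi * ∑ i, (k i : ℝ) *
          (toVec (gridPt m j) i - toVec (gridPt m j') i))| ≤ t := by
      intro j' _
      rw [← mul_sub, ← Finset.sum_sub_distrib, abs_mul]
      -- Each of the `Ñ` cosines has frequency at most `N` in `ℓ¹` and hence changes by at most
      -- `π N (2 / m) ≤ 1 / Ñ`.
      have hb : |∑ k ∈ freq ι N,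
          (Real.cos (Real.pi * ∑ i, (k i : ℝ) * (toVec z i - toVec (gridPt m j') i))
          - Real.cos (Real.pi * ∑ i, (k i : ℝ) *
            (toVec (gridPt m j) i - toVec (gridPt m j') i)))| ≤ 1 := by
        refine (Finset.abs_sum_le_sum_abs _ _).trans ?_
        have hk : ∀ k ∈ freq ι N,
            |Real.cos (Real.pi * ∑ i, (k i : ℝ) * (toVec z i - toVec (gridPt m j') i))
            - Real.cos (Real.pi * ∑ i, (k i : ℝ) *
              (toVec (gridPt m j) i - toVec (gridPt m j') i))| ≤ ((freq ι N).card : ℝ)⁻¹ := by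
          intro k hk
          have hl := Real.lipschitzWith_cos.dist_le_mul
            (Real.pi * ∑ i, (k i : ℝ) * (toVec z i - toVec (gridPt m j') i))
            (Real.pi * ∑ i, (k i : ℝ) * (toVec (gridPt m j) i - toVec (gridPt m j') i))
          rw [Real.dist_eq, Real.dist_eq] at hl
          refine hl.trans ?_
          rw [← mul_sub, ← Finset.sum_sub_distrib, abs_mul, abs_of_pos Real.pi_pos]
          have h3 : |∑ i, ((k i : ℝ) * (toVec z i - toVec (gridPt m j') i)
              - (k i : ℝ) * (toVec (gridPt m j) i - toVec (gridPt m j') i))| ≤ N * (2 / m) := by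
            refine (Finset.abs_sum_le_sum_abs _ _).trans ?_
            have hkN : (∑ i, |(k i : ℝ)|) ≤ N := by
              have := mem_freq.1 hk
              exact_mod_cast this
            refine le_trans (Finset.sum_le_sum (g := fun i => |(k i : ℝ)| * (2 / m)) fun i _ => ?_) ?_
            · rw [← mul_sub, abs_mul]
              refine mul_le_mul_of_nonneg_left ?_ (abs_nonneg _)
              have := hj i
              simp only [toVec, gridPt]
              rw [sub_sub_sub_cancel_right]
              exact this
            · rw [← Finset.sum_mul]
              exact mul_le_mul_of_nonneg_right hkN (by positivity)
          have hc : (0 : ℝ) < (freq ι N).card := by exact_mod_cast hcard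
          have hm3 : 16 * ((N : ℝ) + 1) * (freq ι N).card ≤ m := by exact_mod_cast hm
          have h4 : Real.pi * (N * (2 / m)) ≤ ((freq ι N).card : ℝ)⁻¹ := by
            rw [← one_div, le_div_iff₀ hc]
            have : Real.pi * (N * (2 / m)) * (freq ι N).card
                = Real.pi * 2 * N * (freq ι N).card / m := by ring
            rw [this, div_le_one hm']
            have hpi := Real.pi_le_four
            have hN : (0 : ℝ) ≤ N * (freq ι N).card := by positivity
            nlinarith
          refine le_trans ?_ h4
          simp only [NNReal.coe_one, one_mul]
          exact mul_le_mul_of_nonneg_left h3 Real.pi_pos.le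
        refine (Finset.sum_le_sum hk).trans ?_
        have hc : (0 : ℝ) < (freq ι N).card := by exact_mod_cast hcard
        simp [hc.ne']
      calc _ ≤ t * 1 := mul_le_mul (ht j') hb (abs_nonneg _) ht0
        _ = t := mul_one t
    refine (Finset.sum_le_sum this).trans ?_
    simp
  have h5 := ht j
  calc |e (toVec z)| = |(e (toVec z) - e (toVec (gridPt m j))) + e (toVec (gridPt m j))| := by
        rw [sub_add_cancel]
    _ ≤ _ := abs_add_le _ _
    _ ≤ 2 * t := by linarith

/-- The uniform distribution on the grid, as a finitely supported function. -/
noncomputable def gridDesign (ι : Type) [Fintype ι] (m : ℕ) : Cube ι →₀ ℝ := by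
  classical
  exact (Finsupp.equivFunOnFinite.symm
    (fun _ : ι → Fin m => ((m : ℝ) ^ Fintype.card ι)⁻¹)).embDomain ⟨gridPt m, gridPt_injective m⟩

theorem gridDesign_support {m : ℕ} (hm : 0 < m) : (gridDesign ι m).support
    = (Finset.univ : Finset (ι → Fin m)).map ⟨gridPt m, gridPt_injective m⟩ := by
  unfold gridDesign
  rw [Finsupp.support_embDomain]
  congr 1
  ext j
  simp [hm.ne']

theorem gridDesign_apply (m : ℕ) (j : ι → Fin m) :
    gridDesign ι m (gridPt m j) = ((m : ℝ) ^ Fintype.card ι)⁻¹ := by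
  unfold gridDesign
  exact Finsupp.embDomain_apply_self ⟨gridPt m, gridPt_injective m⟩ _ j

theorem gridDesign_matrix {N m : ℕ} (hm : 2 * N < m) :
    designMatrix N (gridDesign ι m) = Matrix.diagonal fun n : freq ι N => (trigWeight n.1)⁻¹ := by
  ext n k
  rw [designMatrix, gridDesign_support (by omega), Finset.sum_map, Matrix.sum_apply]
  simp only [Function.Embedding.coeFn_mk, gridDesign_apply, Matrix.smul_apply, Matrix.vecMulVec_apply,
    smul_eq_mul, ← Finset.mul_sum, feature_apply]
  rw [mean_grid_trigFn hm n.2 k.2, Matrix.diagonal_apply]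
  by_cases h : n = k
  · subst h; simp
  · have : n.1 ≠ k.1 := fun hh => h (Subtype.ext hh)
    simp [h, this]

theorem card_freq_lower {N q : ℕ} (hq : q * Fintype.card ι ≤ N) :
    (2 * q + 1) ^ Fintype.card ι ≤ (freq ι N).card := by
  have h : (Fintype.piFinset fun _ : ι => Finset.Icc (-(q : ℤ)) q) ⊆ freq ι N := by
    intro k hk
    rw [mem_freq]
    rw [Fintype.mem_piFinset] at hk
    calc ∑ i, |k i| ≤ ∑ _i : ι, (q : ℤ) := Finset.sum_le_sum fun i _ => by
          have := hk i
          rw [Finset.mem_Icc] at this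
          exact abs_le.2 this
      _ = (q * Fintype.card ι : ℕ) := by simp [mul_comm]
      _ ≤ N := by exact_mod_cast hq
  have h2 := Finset.card_le_card h
  rw [Fintype.card_piFinset] at h2
  simp only [Int.card_Icc, Finset.prod_const, Finset.card_univ] at h2
  convert h2 using 2
  omega

theorem card_freq_upper (N : ℕ) : (freq ι N).card ≤ (2 * N + 1) ^ Fintype.card ι := by
  have h2 := Finset.card_filter_le (Fintype.piFinset fun _ : ι => Finset.Icc (-(N : ℤ)) N)
    (fun n => ∑ i, |n i| ≤ N)
  rw [Fintype.card_piFinset] at h2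
  simp only [Int.card_Icc, Finset.prod_const, Finset.card_univ] at h2
  refine h2.trans (le_of_eq ?_)
  congr 1
  omega

/-- The uniform distribution on `2 N + 1` equispaced points per coordinate reproduces the second
moments of the uniform distribution on the cube, which is an exactly optimal design by the addition
theorem; its support has at most `d ^ d` times the number of features, and `log log` outgrows this
factor. -/
theorem isQuasiOptimalDesign_gridDesign {d M : ℕ} (hd : 0 < d) (hι : Fintype.card ι = d)
    (hM : Real.exp (Real.exp ((d : ℝ) ^ d)) ≤ M) :
    IsQuasiOptimalDesign (2 * d * M) (gridDesign ι (2 * (2 * d * M) + 1)) := by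
  set N := 2 * d * M with hN
  set m := 2 * N + 1 with hm
  have hmd : (0 : ℝ) < (m : ℝ) ^ Fintype.card ι := by
    have : (0 : ℝ) < m := by rw [hm]; positivity
    positivity
  have hmat := gridDesign_matrix (ι := ι) (show 2 * N < m by omega)
  have hinv : (Matrix.diagonal fun n : freq ι N => (trigWeight n.1)⁻¹) *
      (Matrix.diagonal fun n : freq ι N => trigWeight n.1) = 1 := by
    rw [Matrix.diagonal_mul_diagonal, ← Matrix.diagonal_one]
    congr 1
    funext n
    exact inv_mul_cancel₀ (trigWeight_pos n.1).ne'
  refine ⟨?_, ?_, ?_, ?_, ?_⟩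
  · intro z
    by_cases hz : z ∈ (gridDesign ι m).support
    · rw [gridDesign_support (by omega), Finset.mem_map] at hz
      obtain ⟨j, _, rfl⟩ := hz
      exact (gridDesign_apply m j).symm ▸ (inv_nonneg.2 hmd.le)
    · rw [Finsupp.notMem_support_iff.1 hz]
  · rw [gridDesign_support (by omega), Finset.sum_map]
    simp only [Function.Embedding.coeFn_mk, gridDesign_apply, Finset.sum_const, Finset.card_univ,
      Fintype.card_fun, Fintype.card_fin, nsmul_eq_mul, Nat.cast_pow]
    exact mul_inv_cancel₀ hmd.ne'
  · rw [gridDesign_support (by omega), Finset.card_map]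
    simp only [Finset.card_univ, Fintype.card_fun, Fintype.card_fin, hι]
    -- The `ℓ¹` ball of radius `N = 2 d M` contains the cube of radius `2 M`.
    have h1 := card_freq_lower (ι := ι) (N := N) (q := 2 * M) (by rw [hι, hN]; nlinarith)
    rw [hι] at h1
    have h2 : m ^ d ≤ d ^ d * (freq ι N).card := by
      calc m ^ d ≤ (d * (2 * (2 * M) + 1)) ^ d := by
            apply Nat.pow_le_pow_left
            rw [hm, hN]
            nlinarith
        _ = d ^ d * (2 * (2 * M) + 1) ^ d := by rw [mul_pow]
        _ ≤ _ := Nat.mul_le_mul_left _ h1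
    have h3 : M ≤ (freq ι N).card := by
      refine le_trans ?_ h1
      calc M ≤ 2 * (2 * M) + 1 := by omega
        _ ≤ _ := Nat.le_self_pow hd.ne' _
    have h4 : Real.exp (Real.exp ((d : ℝ) ^ d)) ≤ (freq ι N).card :=
      hM.trans (by exact_mod_cast h3)
    have hc : (0 : ℝ) < (freq ι N).card := by exact_mod_cast freq_card_pos N
    have h5 : Real.exp ((d : ℝ) ^ d) ≤ Real.log (freq ι N).card := (Real.le_log_iff_exp_le hc).2 h4
    have h6 : (d : ℝ) ^ d ≤ Real.log (Real.log (freq ι N).card) :=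
      (Real.le_log_iff_exp_le ((Real.exp_pos _).trans_le h5)).2 h5
    have h7 : ((m ^ d : ℕ) : ℝ) ≤ (d : ℝ) ^ d * (freq ι N).card := by exact_mod_cast h2
    have h8 : (0 : ℝ) ≤ (d : ℝ) ^ d := by positivity
    nlinarith [mul_le_mul_of_nonneg_right h6 hc.le, mul_nonneg h8 hc.le]
  · rw [hmat]
    exact IsUnit.of_mul_eq_one _ hinv
  · intro z
    rw [hmat, Matrix.inv_eq_right_inv hinv]
    have h := sum_trigWeight_mul_self (ι := ι) N (toVec z)
    rw [← Finset.sum_coe_sort] at h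
    have h9 : feature N z ⬝ᵥ ((Matrix.diagonal fun n : freq ι N => trigWeight n.1) *ᵥ feature N z)
        = (freq ι N).card := by
      rw [← h, dotProduct]
      refine Finset.sum_congr rfl fun n _ => ?_
      rw [Matrix.mulVec_diagonal, feature_apply]
      ring
    rw [h9]
    have hc : (0 : ℝ) ≤ (freq ι N).card := by positivity
    linarith

end Grid

/-! ### The `L¹` norm of the de la Vallée-Poussin kernel -/

section Kernel

open Filter Topology

variable {ι : Type} [Fintype ι] [DecidableEq ι]

theorem volume_restrict_cube : (volume : Measure (ι → ℝ)).restrict (Set.Icc (-1) 1)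
    = Measure.pi fun _ : ι => (volume : Measure ℝ).restrict (Set.Icc (-1) 1) := by
  rw [← Set.pi_univ_Icc, volume_pi, Measure.restrict_pi_pi]
  rfl

theorem sum_Icc_neg_eq (f : ℤ → ℂ) (T : ℕ) :
    ∑ k ∈ Finset.Icc (-(T : ℤ)) T, f k
      = ∑ j ∈ Finset.range (T + 1), f j + ∑ j ∈ Finset.range (T + 1), f (-(j : ℤ)) - f 0 := by
  induction T with
  | zero => simp
  | succ T ih =>
    have e : Finset.Icc (-((T + 1 : ℕ) : ℤ)) (T + 1 : ℕ)
        = insert ((T + 1 : ℕ) : ℤ) (insert (-((T + 1 : ℕ) : ℤ)) (Finset.Icc (-(T : ℤ)) T)) := by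
      ext k
      simp only [Finset.mem_Icc, Finset.mem_insert]
      omega
    rw [e, Finset.sum_insert, Finset.sum_insert, ih, Finset.sum_range_succ _ (T + 1),
      Finset.sum_range_succ (fun j : ℕ => f (-(j : ℤ))) (T + 1)]
    · ring
    · simp
    · simp only [Finset.mem_insert, Finset.mem_Icc]
      omega

/-- The Poisson kernel on `ℝ / 2ℤ` continued to complex parameters `z` of the unit disc. -/
noncomputable def poissonC (z : ℂ) (x : ℝ) : ℂ :=
  (1 - z ^ 2) / ((1 - z * Complex.exp ((Real.pi * x : ℝ) * Complex.I))
    * (1 - z * Complex.exp ((-(Real.pi * x) : ℝ) * Complex.I)))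

/-- The partial sums `∑_{|k| ≤ T} z^|k| cos (k π x)` of the Poisson kernel. -/
noncomputable def poissonSum (T : ℕ) (z : ℂ) (x : ℝ) : ℂ :=
  ∑ k ∈ Finset.Icc (-(T : ℤ)) T, z ^ k.natAbs * (Real.cos (Real.pi * k * x) : ℝ)

theorem poissonSum_eq (T : ℕ) (z : ℂ) (x : ℝ) :
    poissonSum T z x
      = ∑ j ∈ Finset.range (T + 1), (z * Complex.exp ((Real.pi * x : ℝ) * Complex.I)) ^ j
        + ∑ j ∈ Finset.range (T + 1), (z * Complex.exp ((-(Real.pi * x) : ℝ) * Complex.I)) ^ j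
        - 1 := by
  rw [poissonSum, sum_Icc_neg_eq]
  congr 1
  · rw [← Finset.sum_add_distrib, ← Finset.sum_add_distrib]
    refine Finset.sum_congr rfl fun j _ => ?_
    rw [mul_pow, mul_pow, ← Complex.exp_nat_mul, ← Complex.exp_nat_mul]
    have e1 : Real.pi * ((-(j : ℤ) : ℤ) : ℝ) * x = -(Real.pi * ((j : ℤ) : ℝ) * x) := by
      push_cast; ring
    rw [e1, Real.cos_neg, Complex.ofReal_cos, Complex.cos]
    simp only [Int.natAbs_neg, Int.natAbs_natCast]
    have e2 : ((Real.pi * ((j : ℤ) : ℝ) * x : ℝ) : ℂ) * Complex.I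
        = (j : ℂ) * ((Real.pi * x : ℝ) * Complex.I) := by push_cast; ring
    have e3 : -((Real.pi * ((j : ℤ) : ℝ) * x : ℝ) : ℂ) * Complex.I
        = (j : ℂ) * ((-(Real.pi * x) : ℝ) * Complex.I) := by push_cast; ring
    rw [e2, e3]
    ring
  · simp

theorem norm_mul_exp_ofReal (z : ℂ) (t : ℝ) : ‖z * Complex.exp ((t : ℝ) * Complex.I)‖ = ‖z‖ := by
  rw [norm_mul, Complex.norm_exp_ofReal_mul_I, mul_one]

theorem one_sub_norm_le (u : ℂ) : 1 - ‖u‖ ≤ ‖1 - u‖ := by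
  have := norm_sub_norm_le (1 : ℂ) u
  simpa using this

theorem one_sub_ne_zero_of_norm_lt {u : ℂ} (h : ‖u‖ < 1) : 1 - u ≠ 0 := by
  rw [← norm_pos_iff]
  linarith [one_sub_norm_le u]

theorem tendsto_poissonSum {z : ℂ} (hz : ‖z‖ < 1) (x : ℝ) :
    Tendsto (fun T => poissonSum T z x) atTop (𝓝 (poissonC z x)) := by
  have hu := norm_mul_exp_ofReal z (Real.pi * x)
  have hv := norm_mul_exp_ofReal z (-(Real.pi * x))
  have huv : (z * Complex.exp ((Real.pi * x : ℝ) * Complex.I))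
      * (z * Complex.exp ((-(Real.pi * x) : ℝ) * Complex.I)) = z ^ 2 := by
    rw [mul_mul_mul_comm, ← Complex.exp_add]
    push_cast
    rw [show (Real.pi * x : ℂ) * Complex.I + -(Real.pi * x : ℂ) * Complex.I = 0 by ring,
      Complex.exp_zero]
    ring
  simp only [poissonSum_eq, poissonC]
  rw [← huv]
  set u := z * Complex.exp ((Real.pi * x : ℝ) * Complex.I)
  set v := z * Complex.exp ((-(Real.pi * x) : ℝ) * Complex.I)
  have hu0 := one_sub_ne_zero_of_norm_lt (u := u) (hu ▸ hz)
  have hv0 := one_sub_ne_zero_of_norm_lt (u := v) (hv ▸ hz)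
  have e : (1 - u * v) / ((1 - u) * (1 - v)) = (1 - u)⁻¹ + (1 - v)⁻¹ - 1 := by
    field_simp
    ring
  rw [e]
  have h1 := ((hasSum_geometric_of_norm_lt_one (hu ▸ hz : ‖u‖ < 1)).tendsto_sum_nat).comp
    (tendsto_add_atTop_nat 1)
  have h2 := ((hasSum_geometric_of_norm_lt_one (hv ▸ hz : ‖v‖ < 1)).tendsto_sum_nat).comp
    (tendsto_add_atTop_nat 1)
  exact (h1.add h2).sub_const 1

theorem norm_geom_sum_le {u : ℂ} (h : ‖u‖ < 1) (n : ℕ) :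
    ‖∑ j ∈ Finset.range n, u ^ j‖ ≤ (1 - ‖u‖)⁻¹ := by
  refine (norm_sum_le _ _).trans ?_
  simp only [norm_pow]
  exact sum_le_hasSum _ (fun j _ => by positivity) (hasSum_geometric_of_lt_one (norm_nonneg u) h)

theorem norm_poissonSum_le {z : ℂ} (hz : ‖z‖ < 1) (T : ℕ) (x : ℝ) :
    ‖poissonSum T z x‖ ≤ (1 - ‖z‖)⁻¹ + (1 - ‖z‖)⁻¹ + 1 := by
  have hu := norm_mul_exp_ofReal z (Real.pi * x)
  have hv := norm_mul_exp_ofReal z (-(Real.pi * x))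
  rw [poissonSum_eq]
  have h1 := norm_geom_sum_le (hu ▸ hz) (T + 1)
  have h2 := norm_geom_sum_le (hv ▸ hz) (T + 1)
  rw [hu] at h1
  rw [hv] at h2
  refine (norm_sub_le _ _).trans (add_le_add ((norm_add_le _ _).trans (add_le_add h1 h2)) (by simp))

theorem tendsto_sum_succ_mul_pow {z : ℂ} (hz : ‖z‖ < 1) :
    Tendsto (fun T : ℕ => ∑ m ∈ Finset.range (T + 1), ((m : ℂ) + 1) * z ^ m) atTop
      (𝓝 (1 / (1 - z) ^ 2)) := by
  have h := (hasSum_choose_mul_geometric_of_norm_lt_one 1 hz).tendsto_sum_nat.comp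
    (tendsto_add_atTop_nat 1)
  refine h.congr fun T => ?_
  simp only [Function.comp]
  refine Finset.sum_congr rfl fun m _ => ?_
  simp

theorem norm_sum_succ_mul_pow_le {z : ℂ} (hz : ‖z‖ < 1) (T : ℕ) :
    ‖∑ m ∈ Finset.range T, ((m : ℂ) + 1) * z ^ m‖ ≤ 1 / (1 - ‖z‖) ^ 2 := by
  refine (norm_sum_le _ _).trans ?_
  have h := hasSum_choose_mul_geometric_of_norm_lt_one (𝕜 := ℝ) 1 (r := ‖z‖) (by simpa using hz)
  refine le_trans (Finset.sum_le_sum fun m _ => ?_) (sum_le_hasSum (Finset.range T)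
    (fun j _ => by positivity) h)
  rw [norm_mul, norm_pow]
  refine mul_le_mul_of_nonneg_right ?_ (by positivity)
  have : ((m : ℂ) + 1) = ((m + 1 : ℕ) : ℂ) := by push_cast; ring
  rw [this, Complex.norm_natCast]
  simp

/-- The sum of the triangular partial sums of orders `0, …, N`. -/
noncomputable def cesaroSum (N : ℕ) (x : ι → ℝ) : ℝ :=
  ∑ k ∈ freq ι N, ((N : ℝ) + 1 - ∑ i, |(k i : ℝ)|) * ∏ i, Real.cos (Real.pi * k i * x i)

/-- A point of the circle of radius `r`. -/
noncomputable def circlePt (r θ : ℝ) : ℂ := r * Complex.exp (θ * Complex.I)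

theorem norm_circlePt {r : ℝ} (hr : 0 ≤ r) (θ : ℝ) : ‖circlePt r θ‖ = r := by
  rw [circlePt, norm_mul_exp_ofReal, Complex.norm_of_nonneg hr]

theorem continuous_circlePt (r : ℝ) : Continuous (circlePt r) := by
  unfold circlePt; fun_prop

theorem integral_circlePt_pow {r : ℝ} (hr : 0 < r) (N m : ℕ) :
    ∫ θ in (-Real.pi)..Real.pi, circlePt r θ ^ m * (circlePt r θ ^ N)⁻¹
      = if m = N then 2 * Real.pi else 0 := by
  have hz : ∀ θ, circlePt r θ ≠ 0 := fun θ => by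
    rw [← norm_pos_iff, norm_circlePt hr.le]; exact hr
  split_ifs with h
  · subst h
    simp only [mul_inv_cancel₀ (pow_ne_zero m (hz _))]
    simp
    ring
  · have hc : ((m : ℂ) - N) * Complex.I ≠ 0 :=
      mul_ne_zero (sub_ne_zero.2 (by exact_mod_cast h)) Complex.I_ne_zero
    have e : ∀ θ : ℝ, circlePt r θ ^ m * (circlePt r θ ^ N)⁻¹
        = (r : ℂ) ^ m * ((r : ℂ) ^ N)⁻¹ * Complex.exp (((m : ℂ) - N) * Complex.I * θ) := by
      intro θ
      rw [circlePt, mul_pow, mul_pow, mul_inv, ← Complex.exp_nat_mul, ← Complex.exp_nat_mul,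
        ← Complex.exp_neg]
      rw [show ((m : ℂ) - N) * Complex.I * θ = m * (θ * Complex.I) + -(N * (θ * Complex.I)) by ring,
        Complex.exp_add]
      ring
    simp only [e]
    rw [intervalIntegral.integral_const_mul, integral_exp_mul_complex hc]
    have : Complex.exp (((m : ℂ) - N) * Complex.I * (Real.pi : ℝ))
        = Complex.exp (((m : ℂ) - N) * Complex.I * (-Real.pi : ℝ)) := by
      rw [Complex.exp_eq_exp_iff_exists_int]
      exact ⟨(m : ℤ) - N, by push_cast; ring⟩
    rw [this]
    simp

theorem prod_poissonSum (T : ℕ) (z : ℂ) (x : ι → ℝ) :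
    ∏ i, poissonSum T z (x i) = ∑ k ∈ Fintype.piFinset fun _ : ι => Finset.Icc (-(T : ℤ)) T,
      z ^ (∑ i, (k i).natAbs) * ((∏ i, Real.cos (Real.pi * k i * x i) : ℝ) : ℂ) := by
  simp only [poissonSum]
  rw [Finset.prod_univ_sum]
  refine Finset.sum_congr rfl fun k _ => ?_
  rw [Finset.prod_mul_distrib, Finset.prod_pow_eq_pow_sum, Complex.ofReal_prod]

/-- Cauchy's formula for the coefficients, for the truncated generating function. -/
theorem integral_truncated {r : ℝ} (hr : 0 < r) {N T : ℕ} (hT : N ≤ T) (x : ι → ℝ) :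
    ∫ θ in (-Real.pi)..Real.pi, (circlePt r θ ^ N)⁻¹ *
        ((∑ m ∈ Finset.range (T + 1), ((m : ℂ) + 1) * circlePt r θ ^ m)
          * ∏ i, poissonSum T (circlePt r θ) (x i))
      = 2 * Real.pi * cesaroSum N x := by
  have hz : ∀ θ, circlePt r θ ≠ 0 := fun θ => by
    rw [← norm_pos_iff, norm_circlePt hr.le]; exact hr
  have hcont : ∀ m : ℕ, Continuous fun θ => circlePt r θ ^ m * (circlePt r θ ^ N)⁻¹ := fun m =>
    ((continuous_circlePt r).pow m).mul (((continuous_circlePt r).pow N).inv₀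
      fun θ => pow_ne_zero _ (hz θ))
  set P := Fintype.piFinset fun _ : ι => Finset.Icc (-(T : ℤ)) T with hP
  have e : ∀ θ, (circlePt r θ ^ N)⁻¹ *
        ((∑ m ∈ Finset.range (T + 1), ((m : ℂ) + 1) * circlePt r θ ^ m)
          * ∏ i, poissonSum T (circlePt r θ) (x i))
      = ∑ m ∈ Finset.range (T + 1), ∑ k ∈ P,
        (((m : ℂ) + 1) * ((∏ i, Real.cos (Real.pi * k i * x i) : ℝ) : ℂ)) *
          (circlePt r θ ^ (m + ∑ i, (k i).natAbs) * (circlePt r θ ^ N)⁻¹) := by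
    intro θ
    rw [prod_poissonSum, Finset.sum_mul_sum, Finset.mul_sum]
    refine Finset.sum_congr rfl fun m _ => ?_
    rw [Finset.mul_sum]
    refine Finset.sum_congr rfl fun k _ => ?_
    rw [pow_add]
    ring
  simp only [e]
  rw [intervalIntegral.integral_finsetSum]
  swap
  · intro m _
    exact (continuous_finsetSum _ fun k _ => continuous_const.mul (hcont _)).intervalIntegrable _ _
  have e2 : ∀ m ∈ Finset.range (T + 1), (∫ θ in (-Real.pi)..Real.pi, ∑ k ∈ P,
        (((m : ℂ) + 1) * ((∏ i, Real.cos (Real.pi * k i * x i) : ℝ) : ℂ)) *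
          (circlePt r θ ^ (m + ∑ i, (k i).natAbs) * (circlePt r θ ^ N)⁻¹))
      = ∑ k ∈ P, (((m : ℂ) + 1) * ((∏ i, Real.cos (Real.pi * k i * x i) : ℝ) : ℂ)) *
          (if m + ∑ i, (k i).natAbs = N then 2 * Real.pi else 0) := by
    intro m _
    rw [intervalIntegral.integral_finsetSum]
    · refine Finset.sum_congr rfl fun k _ => ?_
      rw [intervalIntegral.integral_const_mul, integral_circlePt_pow hr]
    · intro k _
      exact (continuous_const.mul (hcont _)).intervalIntegrable _ _
  rw [Finset.sum_congr rfl e2, Finset.sum_comm, cesaroSum, Complex.ofReal_sum, Finset.mul_sum]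
  -- Only the `k` with `‖k‖₁ ≤ N` contribute, each through the single index `m = N - ‖k‖₁`.
  have hsub : freq ι N ⊆ P := by
    intro k hk
    rw [hP, Fintype.mem_piFinset]
    intro i
    rw [Finset.mem_Icc, ← abs_le]
    exact (abs_le_of_mem_freq hk i).trans (by exact_mod_cast hT)
  have habs : ∀ k : ι → ℤ, ∑ i, |k i| = ((∑ i, (k i).natAbs : ℕ) : ℤ) := fun k => by
    push_cast
    rfl
  rw [← Finset.sum_subset hsub]
  · refine Finset.sum_congr rfl fun k hk => ?_
    have hk1 : ∑ i, (k i).natAbs ≤ N := by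
      have := mem_freq.1 hk
      rw [habs] at this
      exact_mod_cast this
    rw [Finset.sum_eq_single (N - ∑ i, (k i).natAbs)]
    · rw [if_pos (by omega)]
      have e4 : (∑ i, |(k i : ℝ)|) = ((∑ i, (k i).natAbs : ℕ) : ℝ) := by
        rw [Nat.cast_sum]
        exact Finset.sum_congr rfl fun i _ => by rw [Nat.cast_natAbs, Int.cast_abs]
      rw [e4, Nat.cast_sub hk1]
      push_cast
      ring
    · intro m _ hm
      rw [if_neg (by omega), Complex.ofReal_zero, mul_zero]
    · intro h
      exact absurd (Finset.mem_range.2 (by omega)) h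
  · intro k _ hk
    refine Finset.sum_eq_zero fun m _ => ?_
    rw [if_neg, Complex.ofReal_zero, mul_zero]
    intro h
    apply hk
    rw [mem_freq, habs]
    exact_mod_cast (by omega : ∑ i, (k i).natAbs ≤ N)

theorem continuous_poissonC {r : ℝ} (hr0 : 0 ≤ r) (hr : r < 1) :
    Continuous fun p : ℝ × ℝ => poissonC (circlePt r p.1) p.2 := by
  have hc := continuous_circlePt r
  unfold poissonC
  refine Continuous.div (by fun_prop) (by fun_prop) fun p => ?_
  refine mul_ne_zero (one_sub_ne_zero_of_norm_lt ?_) (one_sub_ne_zero_of_norm_lt ?_) <;>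
  rwa [norm_mul_exp_ofReal, norm_circlePt hr0]

/-- Cauchy's formula for the Cesàro sums of the triangular partial sums, whose generating function
is `(1 - z)⁻² ∏ i, P_z (x i)`. -/
theorem cesaroSum_eq_integral {r : ℝ} (hr0 : 0 < r) (hr : r < 1) (N : ℕ) (x : ι → ℝ) :
    (cesaroSum N x : ℂ) = (2 * Real.pi)⁻¹ * ∫ θ in (-Real.pi)..Real.pi, (circlePt r θ ^ N)⁻¹ *
        (1 / (1 - circlePt r θ) ^ 2 * ∏ i, poissonC (circlePt r θ) (x i)) := by
  have hz : ∀ θ, ‖circlePt r θ‖ < 1 := fun θ => by rwa [norm_circlePt hr0.le]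
  have hzne : ∀ θ, circlePt r θ ≠ 0 := fun θ => by
    rw [← norm_pos_iff, norm_circlePt hr0.le]; exact hr0
  have hlim := intervalIntegral.tendsto_integral_filter_of_dominated_convergence
    (μ := volume) (a := -Real.pi) (b := Real.pi) (l := (atTop : Filter ℕ))
    (F := fun T θ => (circlePt r θ ^ N)⁻¹ *
        ((∑ m ∈ Finset.range (T + 1), ((m : ℂ) + 1) * circlePt r θ ^ m)
          * ∏ i, poissonSum T (circlePt r θ) (x i)))
    (f := fun θ => (circlePt r θ ^ N)⁻¹ *
        (1 / (1 - circlePt r θ) ^ 2 * ∏ i, poissonC (circlePt r θ) (x i)))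
    (fun _ => (r ^ N)⁻¹ * (1 / (1 - r) ^ 2 * ((1 - r)⁻¹ + (1 - r)⁻¹ + 1) ^ Fintype.card ι))
    ?_ ?_ ?_ ?_
  · have hev : (fun T : ℕ => ∫ θ in (-Real.pi)..Real.pi, (circlePt r θ ^ N)⁻¹ *
        ((∑ m ∈ Finset.range (T + 1), ((m : ℂ) + 1) * circlePt r θ ^ m)
          * ∏ i, poissonSum T (circlePt r θ) (x i)))
        =ᶠ[atTop] fun _ => 2 * Real.pi * (cesaroSum N x : ℂ) := by
      filter_upwards [eventually_ge_atTop N] with T hT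
      exact integral_truncated hr0 hT x
    have h2 := tendsto_nhds_unique (tendsto_const_nhds.congr' hev.symm) hlim
    rw [← h2]
    have : (Real.pi : ℂ) ≠ 0 := by exact_mod_cast Real.pi_ne_zero
    push_cast
    field_simp
  · refine Eventually.of_forall fun T => Continuous.aestronglyMeasurable ?_
    have hc := continuous_circlePt r
    refine (((hc.pow N).inv₀ fun θ => pow_ne_zero _ (hzne θ)).mul (Continuous.mul ?_ ?_))
    · fun_prop
    · unfold poissonSum
      fun_prop
  · refine Eventually.of_forall fun T => Eventually.of_forall fun θ _ => ?_
    rw [norm_mul, norm_inv, norm_pow, norm_circlePt hr0.le, norm_mul]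
    refine mul_le_mul_of_nonneg_left ?_ (by positivity)
    refine mul_le_mul ?_ ?_ (norm_nonneg _) (by positivity)
    · have := norm_sum_succ_mul_pow_le (hz θ) (T + 1)
      rwa [norm_circlePt hr0.le] at this
    · rw [norm_prod]
      refine (Finset.prod_le_prod (fun i _ => norm_nonneg _) fun i _ =>
        norm_poissonSum_le (hz θ) T (x i)).trans ?_
      rw [norm_circlePt hr0.le]
      simp
  · simp
  · refine Eventually.of_forall fun θ _ => ?_
    exact tendsto_const_nhds.mul ((tendsto_sum_succ_mul_pow (hz θ)).mul
      (tendsto_finsetProd _ fun i _ => tendsto_poissonSum (hz θ) (x i)))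

end Kernel

section KernelBound

open Filter Topology

variable {ι : Type} [Fintype ι] [DecidableEq ι]

/-- The distance of `1` to the point at angle `φ` of the circle of radius `r`. -/
noncomputable def circleDist (r φ : ℝ) : ℝ := ‖1 - circlePt r φ‖

theorem circleDist_ge {r : ℝ} (hr0 : 0 ≤ r) (φ : ℝ) : 1 - r ≤ circleDist r φ := by
  have := one_sub_norm_le (circlePt r φ)
  rwa [norm_circlePt hr0] at this

theorem continuous_circleDist (r : ℝ) : Continuous (circleDist r) := by
  have := continuous_circlePt r
  unfold circleDist
  fun_prop

theorem circleDist_periodic (r : ℝ) : Function.Periodic (circleDist r) (2 * Real.pi) := by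
  intro φ
  unfold circleDist circlePt
  push_cast
  rw [add_mul, Complex.exp_periodic]

theorem circleDist_sq (r φ : ℝ) : circleDist r φ ^ 2 = (1 - r) ^ 2 + 4 * r * Real.sin (φ / 2) ^ 2 := by
  have h : circlePt r φ = (r * Real.cos φ : ℝ) + (r * Real.sin φ : ℝ) * Complex.I := by
    rw [circlePt, Complex.exp_mul_I]
    push_cast
    ring
  rw [circleDist, h, ← Complex.normSq_eq_norm_sq, Complex.normSq_apply]
  simp only [Complex.sub_re, Complex.add_re, Complex.one_re, Complex.ofReal_re, Complex.mul_re,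
    Complex.I_re, Complex.I_im, Complex.ofReal_im, Complex.sub_im, Complex.add_im, Complex.mul_im,
    Complex.one_im]
  have h1 : Real.cos φ = 1 - 2 * Real.sin (φ / 2) ^ 2 := by
    have := Real.cos_two_mul (φ / 2)
    rw [show 2 * (φ / 2) = φ by ring] at this
    nlinarith [Real.sin_sq_add_cos_sq (φ / 2)]
  have h2 := Real.sin_sq_add_cos_sq φ
  have h3 : Real.sin φ ^ 2 = 1 - Real.cos φ ^ 2 := by linarith
  rw [h1] at h3
  rw [h1]
  ring_nf
  ring_nf at h3
  rw [h3]
  ring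

theorem circleDist_lower {r : ℝ} (hr0 : 1 / 2 ≤ r) (hr : r < 1) {φ : ℝ} (hφ : |φ| ≤ Real.pi) :
    ((1 - r) + |φ|) / 4 ≤ circleDist r φ := by
  have h := Real.mul_abs_le_abs_sin (x := φ / 2) (by rw [abs_div]; norm_num; linarith)
  have hs : (2 / Real.pi * |φ / 2|) ^ 2 ≤ Real.sin (φ / 2) ^ 2 := by
    rw [← sq_abs (Real.sin _)]
    exact pow_le_pow_left₀ (by positivity) h 2
  have hs2 : |φ| ^ 2 / 16 ≤ Real.sin (φ / 2) ^ 2 := by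
    refine le_trans ?_ hs
    rw [abs_div, abs_of_pos (by norm_num : (0 : ℝ) < 2)]
    rw [show (2 / Real.pi * (|φ| / 2)) ^ 2 = |φ| ^ 2 / Real.pi ^ 2 by field_simp]
    exact div_le_div_of_nonneg_left (by positivity) (by positivity)
      (by nlinarith [Real.pi_le_four, Real.pi_pos])
  have hd := circleDist_sq r φ
  have h0 : 0 ≤ circleDist r φ := norm_nonneg _
  refine abs_le_of_sq_le_sq' ?_ h0 |>.2
  rw [hd]
  nlinarith [sq_nonneg ((1 - r) - |φ|), sq_nonneg (Real.sin (φ / 2)), abs_nonneg φ]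

theorem integral_shift_rpow_le {δ p : ℝ} (hδ : 0 < δ) (hp : 1 < p) :
    ∫ φ in (0 : ℝ)..Real.pi, (δ + φ) ^ (-p) ≤ δ ^ (1 - p) / (p - 1) := by
  rw [intervalIntegral.integral_comp_add_left (fun x => x ^ (-p)), integral_rpow]
  · have h1 : 0 ≤ (δ + Real.pi) ^ (-p + 1) := by have := Real.pi_pos; positivity
    rw [add_zero, show -p + 1 = 1 - p by ring] at *
    rw [show ((δ + Real.pi) ^ (1 - p) - δ ^ (1 - p)) / (1 - p)
      = (δ ^ (1 - p) - (δ + Real.pi) ^ (1 - p)) / (p - 1) by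
        rw [← neg_div_neg_eq]; congr 1 <;> ring]
    exact div_le_div_of_nonneg_right (by linarith) (by linarith)
  · right
    refine ⟨by linarith, ?_⟩
    rw [Set.uIcc_of_le (by linarith [Real.pi_pos])]
    rintro ⟨h, _⟩
    linarith

theorem continuous_circleDist_rpow {r : ℝ} (hr0 : 0 ≤ r) (hr : r < 1) (p : ℝ) :
    Continuous fun φ => circleDist r φ ^ p :=
  (continuous_circleDist r).rpow_const fun φ => Or.inl
    ((by linarith [circleDist_ge hr0 φ] : 0 < circleDist r φ).ne')

/-- Integrals of `|1 - z|^{-p}` over the circle of radius `r`, by comparing `|1 - z|` with `(1 - r) + |φ|`. -/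
theorem integral_circleDist_rpow_le {r p : ℝ} (hr0 : 1 / 2 ≤ r) (hr : r < 1) (hp : 1 < p) :
    ∫ φ in (-Real.pi)..Real.pi, circleDist r φ ^ (-p)
      ≤ 2 * 4 ^ p * ((1 - r) ^ (1 - p) / (p - 1)) := by
  have hδ : 0 < 1 - r := by linarith
  have hc := continuous_circleDist_rpow (by linarith : 0 ≤ r) hr (-p)
  have hpt : ∀ φ, |φ| ≤ Real.pi → circleDist r φ ^ (-p) ≤ 4 ^ p * ((1 - r) + |φ|) ^ (-p) := by
    intro φ hφ
    have h1 := circleDist_lower hr0 hr hφ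
    have h2 : 0 < ((1 - r) + |φ|) / 4 := by have := abs_nonneg φ; positivity
    refine (Real.rpow_le_rpow_of_nonpos h2 h1 (by linarith)).trans (le_of_eq ?_)
    rw [Real.div_rpow (by have := abs_nonneg φ; positivity) (by norm_num), Real.rpow_neg (by norm_num : (0:ℝ) ≤ 4), div_inv_eq_mul,
      mul_comm]
  have hcr : ContinuousOn (fun φ : ℝ => 4 ^ p * ((1 - r) + φ) ^ (-p)) (Set.uIcc 0 Real.pi) := by
    refine continuousOn_const.mul (ContinuousOn.rpow_const (by fun_prop) fun φ hφ => Or.inl ?_)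
    rw [Set.uIcc_of_le Real.pi_pos.le] at hφ
    have := hφ.1
    positivity
  have hhalf : ∫ φ in (0 : ℝ)..Real.pi, circleDist r φ ^ (-p)
      ≤ 4 ^ p * ((1 - r) ^ (1 - p) / (p - 1)) := by
    refine le_trans (intervalIntegral.integral_mono_on Real.pi_pos.le (hc.intervalIntegrable _ _)
      hcr.intervalIntegrable fun φ hφ => ?_) ?_
    · have := hpt φ (by rw [abs_of_nonneg hφ.1]; exact hφ.2)
      rwa [abs_of_nonneg hφ.1] at this
    · rw [intervalIntegral.integral_const_mul]
      exact mul_le_mul_of_nonneg_left (integral_shift_rpow_le hδ hp) (by positivity)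
  have hneg : ∀ φ, circleDist r (-φ) = circleDist r φ := by
    intro φ
    have h1 := circleDist_sq r (-φ)
    have h2 := circleDist_sq r φ
    rw [neg_div, Real.sin_neg, neg_sq, ← h2] at h1
    exact (pow_left_inj₀ (norm_nonneg _) (norm_nonneg _) two_ne_zero).1 h1
  have hleft : ∫ φ in (-Real.pi)..0, circleDist r φ ^ (-p)
      = ∫ φ in (0 : ℝ)..Real.pi, circleDist r φ ^ (-p) := by
    have := intervalIntegral.integral_comp_neg (a := 0) (b := Real.pi) fun φ => circleDist r φ ^ (-p)
    rw [neg_zero] at this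
    rw [← this]
    simp only [hneg]
  rw [← intervalIntegral.integral_add_adjacent_intervals (hc.intervalIntegrable _ 0)
    (hc.intervalIntegrable _ _), hleft]
  linarith

theorem integral_comp_pi_mul_add {f : ℝ → ℝ} (hper : Function.Periodic f (2 * Real.pi)) (θ : ℝ) :
    ∫ x in (-1 : ℝ)..1, f (θ + Real.pi * x) = Real.pi⁻¹ * ∫ φ in (-Real.pi)..Real.pi, f φ := by
  have h := intervalIntegral.integral_comp_add_mul (a := -1) (b := 1) f Real.pi_ne_zero θ
  rw [h, smul_eq_mul]
  congr 1
  have h2 := hper.intervalIntegral_add_eq (θ + Real.pi * -1) (-Real.pi)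
  rw [show θ + Real.pi * -1 + 2 * Real.pi = θ + Real.pi * 1 by ring,
    show -Real.pi + 2 * Real.pi = Real.pi by ring] at h2
  exact h2

theorem integral_comp_pi_mul_sub {f : ℝ → ℝ} (hper : Function.Periodic f (2 * Real.pi)) (θ : ℝ) :
    ∫ x in (-1 : ℝ)..1, f (θ - Real.pi * x) = Real.pi⁻¹ * ∫ φ in (-Real.pi)..Real.pi, f φ := by
  rw [← integral_comp_pi_mul_add hper θ]
  have := intervalIntegral.integral_comp_neg (a := -1) (b := 1) fun x => f (θ + Real.pi * x)
  rw [neg_neg] at this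
  rw [← this]
  simp only [mul_neg, sub_eq_add_neg]

/-- Decoupling of the two factors in the denominator of the Poisson kernel: the larger of `a` and `b` is
at least `A / 2`, which absorbs all of the numerator but a small power. -/
theorem div_mul_le_rpow {A a b s : ℝ} (hA : 0 < A) (ha : 0 < a) (hb : 0 < b) (hAab : A ≤ a + b)
    (hs0 : 0 < s) (hs1 : s < 1) :
    A / (a * b) ≤ 2 * A ^ s * (a ^ (-(1 + s)) + b ^ (-(1 + s))) := by
  wlog hab : a ≤ b generalizing a b
  · have := this hb ha (by linarith) (by linarith)
    rwa [mul_comm a b, add_comm (a ^ _)]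
  have h1 : A ≤ A ^ s * (2 * b ^ (1 - s)) := by
    calc A = A ^ s * A ^ (1 - s) := by rw [← Real.rpow_add hA]; simp
      _ ≤ A ^ s * (2 * b ^ (1 - s)) := by
        refine mul_le_mul_of_nonneg_left ?_ (by positivity)
        calc A ^ (1 - s) ≤ (2 * b) ^ (1 - s) :=
              Real.rpow_le_rpow hA.le (by linarith) (by linarith)
          _ = 2 ^ (1 - s) * b ^ (1 - s) := Real.mul_rpow (by norm_num) hb.le
          _ ≤ 2 * b ^ (1 - s) := by
            refine mul_le_mul_of_nonneg_right ?_ (by positivity)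
            calc (2 : ℝ) ^ (1 - s) ≤ 2 ^ (1 : ℝ) :=
                  Real.rpow_le_rpow_of_exponent_le (by norm_num) (by linarith)
              _ = 2 := Real.rpow_one 2
  have h2 : A / (a * b) ≤ 2 * A ^ s * (b ^ (-s) * a⁻¹) := by
    rw [div_le_iff₀ (by positivity)]
    refine h1.trans (le_of_eq ?_)
    rw [show 1 - s = -s + 1 by ring, Real.rpow_add_one hb.ne']
    field_simp
  refine h2.trans (mul_le_mul_of_nonneg_left ?_ (by positivity))
  have h3 : b ^ (-s) * a⁻¹ ≤ a ^ (-(1 + s)) := by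
    calc b ^ (-s) * a⁻¹ ≤ a ^ (-s) * a⁻¹ :=
          mul_le_mul_of_nonneg_right (Real.rpow_le_rpow_of_nonpos ha hab (by linarith))
            (by positivity)
      _ = a ^ (-(1 + s)) := by
        rw [← Real.rpow_neg_one a, ← Real.rpow_add ha]
        congr 1
        ring
  have : 0 ≤ b ^ (-(1 + s)) := by positivity
  linarith

theorem circlePt_mul_exp (r θ φ : ℝ) :
    circlePt r θ * Complex.exp ((φ : ℝ) * Complex.I) = circlePt r (θ + φ) := by
  unfold circlePt
  push_cast
  rw [add_mul, Complex.exp_add]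
  ring

/-- The `L¹` norm of the Poisson kernel at a complex parameter `z` exceeds that of the (positive)
kernel with real parameter by a factor that grows slower than any given power of
`|1 - z| / (1 - |z|)`. -/
theorem integral_norm_poissonC_le {r s : ℝ} (hr0 : 1 / 2 ≤ r) (hr : r < 1) (hs0 : 0 < s)
    (hs1 : s < 1) (θ : ℝ) :
    ∫ x in Set.Icc (-1 : ℝ) 1, ‖poissonC (circlePt r θ) x‖
      ≤ 128 / s * (circleDist r θ / (1 - r)) ^ s := by
  have hδ : 0 < 1 - r := by linarith
  have hr0' : 0 ≤ r := by linarith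
  have hpos : ∀ φ, 0 < circleDist r φ := fun φ => by linarith [circleDist_ge hr0' φ]
  have hzz : ‖circlePt r θ‖ < 1 := by rwa [norm_circlePt hr0']
  set A : ℝ := ‖1 - circlePt r θ ^ 2‖ with hA
  have hA0 : 0 < A := norm_pos_iff.2 (one_sub_ne_zero_of_norm_lt (by
    rw [norm_pow]; exact pow_lt_one₀ (norm_nonneg _) hzz two_ne_zero))
  have hpt : ∀ x : ℝ, ‖poissonC (circlePt r θ) x‖ ≤ 2 * A ^ s *
      (circleDist r (θ + Real.pi * x) ^ (-(1 + s)) + circleDist r (θ - Real.pi * x) ^ (-(1 + s))) := by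
    intro x
    have e1 : circlePt r θ * Complex.exp ((Real.pi * x : ℝ) * Complex.I)
        = circlePt r (θ + Real.pi * x) := circlePt_mul_exp _ _ _
    have e2 : circlePt r θ * Complex.exp ((-(Real.pi * x) : ℝ) * Complex.I)
        = circlePt r (θ - Real.pi * x) := by rw [circlePt_mul_exp, ← sub_eq_add_neg]
    have e3 : circlePt r θ ^ 2 = circlePt r (θ + Real.pi * x) * circlePt r (θ - Real.pi * x) := by
      rw [← e1, ← e2, mul_mul_mul_comm, ← Complex.exp_add]
      push_cast
      rw [show (Real.pi * x : ℂ) * Complex.I + -(Real.pi * x : ℂ) * Complex.I = 0 by ring,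
        Complex.exp_zero]
      ring
    rw [poissonC, e1, e2, norm_div, norm_mul]
    refine div_mul_le_rpow hA0 (hpos _) (hpos _) ?_ hs0 hs1
    rw [e3]
    set u := circlePt r (θ + Real.pi * x) with hu
    set v := circlePt r (θ - Real.pi * x)
    calc ‖1 - u * v‖ = ‖(1 - u) + u * (1 - v)‖ := by congr 1; ring
      _ ≤ ‖1 - u‖ + ‖u‖ * ‖1 - v‖ := (norm_add_le _ _).trans (by rw [norm_mul])
      _ ≤ ‖1 - u‖ + 1 * ‖1 - v‖ := by
        have : ‖u‖ ≤ 1 := by rw [hu, norm_circlePt hr0']; exact hr.le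
        gcongr
      _ = _ := by rw [one_mul]
  have hcp : Continuous fun x => ‖poissonC (circlePt r θ) x‖ :=
    ((continuous_poissonC hr0' hr).comp (Continuous.prodMk_right θ)).norm
  have hcd := continuous_circleDist_rpow hr0' hr (-(1 + s))
  have hper : Function.Periodic (fun φ => circleDist r φ ^ (-(1 + s))) (2 * Real.pi) := fun φ => by
    simp only [circleDist_periodic r φ]
  rw [integral_Icc_eq_integral_Ioc, ← intervalIntegral.integral_of_le (by norm_num)]
  have hc1 : Continuous fun x => circleDist r (θ + Real.pi * x) ^ (-(1 + s)) :=
    hcd.comp (by fun_prop)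
  have hc2 : Continuous fun x => circleDist r (θ - Real.pi * x) ^ (-(1 + s)) :=
    hcd.comp (by fun_prop)
  refine (intervalIntegral.integral_mono (by norm_num) (hcp.intervalIntegrable _ _)
    (Continuous.intervalIntegrable (continuous_const.mul (hc1.add hc2)) _ _) hpt).trans ?_
  simp only [Pi.mul_apply, Pi.add_apply]
  rw [intervalIntegral.integral_const_mul, intervalIntegral.integral_add
    (hc1.intervalIntegrable _ _) (hc2.intervalIntegrable _ _),
    integral_comp_pi_mul_add hper, integral_comp_pi_mul_sub hper]
  -- By periodicity both shifted integrals are `π⁻¹` times the integral over a full period.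
  have hI := integral_circleDist_rpow_le (p := 1 + s) hr0 hr (by linarith)
  rw [show 1 - (1 + s) = -s by ring, show 1 + s - 1 = s by ring] at hI
  set I := ∫ φ in (-Real.pi)..Real.pi, circleDist r φ ^ (-(1 + s))
  have h4 : (4 : ℝ) ^ (1 + s) ≤ 16 := by
    calc (4 : ℝ) ^ (1 + s) ≤ 4 ^ (2 : ℝ) := Real.rpow_le_rpow_of_exponent_le (by norm_num) (by linarith)
      _ = 16 := by norm_num
  have hA1 : A ^ s ≤ 2 * circleDist r θ ^ s := by
    have hA2 : A ≤ 2 * circleDist r θ := by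
      rw [hA, show 1 - circlePt r θ ^ 2 = (1 + circlePt r θ) * (1 - circlePt r θ) by ring, norm_mul]
      refine mul_le_mul_of_nonneg_right ?_ (norm_nonneg _)
      refine (norm_add_le _ _).trans ?_
      rw [norm_one, norm_circlePt hr0']
      linarith
    calc A ^ s ≤ (2 * circleDist r θ) ^ s := Real.rpow_le_rpow hA0.le hA2 hs0.le
      _ = 2 ^ s * circleDist r θ ^ s := Real.mul_rpow (by norm_num) (hpos θ).le
      _ ≤ 2 * circleDist r θ ^ s := by
        refine mul_le_mul_of_nonneg_right ?_ (Real.rpow_nonneg (hpos θ).le _)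
        calc (2 : ℝ) ^ s ≤ 2 ^ (1 : ℝ) :=
              Real.rpow_le_rpow_of_exponent_le (by norm_num) hs1.le
          _ = 2 := Real.rpow_one 2
  have hδs : 0 < (1 - r) ^ (-s) := Real.rpow_pos_of_pos hδ _
  have hI2 : I ≤ 32 * ((1 - r) ^ (-s) / s) := by
    refine hI.trans (mul_le_mul_of_nonneg_right (by linarith) (by positivity))
  have hpi : Real.pi⁻¹ * I ≤ 16 * ((1 - r) ^ (-s) / s) := by
    rw [inv_mul_le_iff₀ Real.pi_pos]
    refine hI2.trans ?_
    have : 0 ≤ (1 - r) ^ (-s) / s := by positivity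
    nlinarith [Real.pi_gt_three]
  have hgs := Real.rpow_pos_of_pos (hpos θ) s
  calc 2 * A ^ s * (Real.pi⁻¹ * I + Real.pi⁻¹ * I)
      ≤ 2 * (2 * circleDist r θ ^ s) * (16 * ((1 - r) ^ (-s) / s) + 16 * ((1 - r) ^ (-s) / s)) := by
        refine mul_le_mul (by linarith) (by linarith) ?_ (by positivity)
        have hI0 : 0 ≤ I := intervalIntegral.integral_nonneg (by linarith [Real.pi_pos])
          fun φ _ => Real.rpow_nonneg (hpos φ).le _
        have := Real.pi_pos
        positivity
    _ = 128 / s * (circleDist r θ / (1 - r)) ^ s := by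
        rw [Real.div_rpow (hpos θ).le hδ.le, Real.rpow_neg hδ.le]
        field_simp
        norm_num

end KernelBound

section KernelBound

open Filter Topology

variable {ι : Type} [Fintype ι] [DecidableEq ι]

theorem continuous_cesaroSum (N : ℕ) : Continuous (cesaroSum (ι := ι) N) := by
  unfold cesaroSum; fun_prop

/-- A crude uniform bound, used only for integrability. -/
theorem norm_poissonC_le {r : ℝ} (hr0 : 0 ≤ r) (hr : r < 1) (θ x : ℝ) :
    ‖poissonC (circlePt r θ) x‖ ≤ 2 / ((1 - r) * (1 - r)) := by
  have hδ : 0 < 1 - r := by linarith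
  have hn := norm_circlePt hr0 θ
  rw [poissonC, norm_div, norm_mul]
  refine div_le_div₀ (by norm_num) ?_ (by positivity) ?_
  · refine (norm_sub_le _ _).trans ?_
    rw [norm_one, norm_pow, hn]
    nlinarith
  · refine mul_le_mul ?_ ?_ hδ.le (norm_nonneg _)
    · have := one_sub_norm_le (circlePt r θ * Complex.exp ((Real.pi * x : ℝ) * Complex.I))
      rwa [norm_mul_exp_ofReal, hn] at this
    · have := one_sub_norm_le (circlePt r θ * Complex.exp ((-(Real.pi * x) : ℝ) * Complex.I))
      rwa [norm_mul_exp_ofReal, hn] at this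

/-- The triangular Cesàro sums have `L¹` norm `O(N)`: under Cauchy's formula the `L¹` norm of the
product of Poisson kernels factorizes, and with exponent `s = 1 / (2 d)` for each factor the
remaining integral over the circle behaves like `∫ |1 - z|^{-3/2}`. -/
theorem integral_abs_cesaroSum_le (hd : 0 < Fintype.card ι) (N : ℕ) :
    ∫ x in Set.Icc (-1 : ι → ℝ) 1, |cesaroSum N x|
      ≤ 16 * (256 * Fintype.card ι) ^ Fintype.card ι * (N + 2) := by
  set d := Fintype.card ι with hdd
  have hd' : (0 : ℝ) < d := by exact_mod_cast hd
  have hd1 : (1 : ℝ) ≤ d := by exact_mod_cast hd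
  -- The radius `r` is such that `1 - r = 1 / (N + 2)` while `r ^ (-N) ≤ e ≤ 3`.
  set r : ℝ := (N + 1) / (N + 2) with hr
  have hN : (0 : ℝ) ≤ N := Nat.cast_nonneg N
  have hδe : 1 - r = 1 / (N + 2) := by rw [hr]; field_simp; ring
  have hδ : 0 < 1 - r := by rw [hδe]; positivity
  have hr1 : r < 1 := by linarith
  have hr2 : 1 / 2 ≤ r := by rw [hr, div_le_div_iff₀ (by norm_num) (by positivity)]; linarith
  have hr0 : 0 < r := by linarith
  have hpos : ∀ φ, 0 < circleDist r φ := fun φ => by linarith [circleDist_ge hr0.le φ]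
  -- The `d` factors together contribute the exponent `s d = 1 / 2`, so that the integrand on the circle
  -- has exponent `-2 + 1 / 2 < -1`.
  set s : ℝ := 1 / (2 * d) with hs
  have hs0 : 0 < s := by positivity
  have hs1 : s < 1 := by rw [hs, div_lt_one (by positivity)]; linarith
  set μ : Measure (ι → ℝ) := (volume : Measure (ι → ℝ)).restrict (Set.Icc (-1) 1) with hμ
  have hμp : μ = Measure.pi fun _ : ι => (volume : Measure ℝ).restrict (Set.Icc (-1) 1) :=
    volume_restrict_cube
  have : IsFiniteMeasure μ := by rw [hμp]; infer_instance
  set ν : Measure ℝ := (volume : Measure ℝ).restrict (Set.Ioc (-Real.pi) Real.pi) with hν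
  set G : (ι → ℝ) → ℝ → ℝ := fun x θ =>
    (r ^ N)⁻¹ * ((circleDist r θ ^ 2)⁻¹ * ∏ i, ‖poissonC (circlePt r θ) (x i)‖) with hG
  have hGc : Continuous (Function.uncurry G) := by
    have h1 : Continuous fun p : (ι → ℝ) × ℝ => (circleDist r p.2 ^ 2)⁻¹ :=
      (((continuous_circleDist r).comp continuous_snd).pow 2).inv₀
        fun p => pow_ne_zero _ (hpos _).ne'
    have h2 : ∀ i, Continuous fun p : (ι → ℝ) × ℝ => ‖poissonC (circlePt r p.2) (p.1 i)‖ := fun i =>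
      ((continuous_poissonC hr0.le hr1).comp
        (continuous_snd.prodMk ((continuous_apply i).comp continuous_fst))).norm
    exact continuous_const.mul (h1.mul (continuous_finsetProd _ fun i _ => h2 i))
  have hGi : Integrable (Function.uncurry G) (μ.prod ν) := by
    refine Integrable.of_bound (C := (r ^ N)⁻¹ * (((1 - r) ^ 2)⁻¹ *
      (2 / ((1 - r) * (1 - r))) ^ d)) hGc.aestronglyMeasurable (Eventually.of_forall fun p => ?_)
    rw [Real.norm_eq_abs, abs_of_nonneg]
    · refine mul_le_mul_of_nonneg_left (mul_le_mul ?_ ?_ (by positivity) (by positivity))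
        (by positivity)
      · exact inv_anti₀ (by positivity) (pow_le_pow_left₀ hδ.le (circleDist_ge hr0.le _) 2)
      · refine (Finset.prod_le_prod (fun i _ => norm_nonneg _) fun i _ =>
          norm_poissonC_le hr0.le hr1 _ _).trans ?_
        simp [hdd, div_pow]
    · have := hpos p.2
      simp only [Function.uncurry, hG]
      positivity
  have hle : ∀ x : ι → ℝ, |cesaroSum N x| ≤ (2 * Real.pi)⁻¹ * ∫ θ, G x θ ∂ν := by
    intro x
    have h := congrArg norm (cesaroSum_eq_integral hr0 hr1 N x)
    rw [Complex.norm_real, Real.norm_eq_abs] at h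
    rw [h, norm_mul]
    have hpi := Real.pi_pos
    have h2 : ‖(((2 * Real.pi)⁻¹ : ℝ) : ℂ)‖ = (2 * Real.pi)⁻¹ := by
      rw [Complex.norm_real, Real.norm_eq_abs, abs_of_pos (by positivity)]
    rw [intervalIntegral.integral_of_le (by linarith)]
    refine mul_le_mul (le_of_eq (by exact_mod_cast h2)) ?_ (norm_nonneg _) (by positivity)
    refine (norm_integral_le_integral_norm _).trans (le_of_eq ?_)
    refine integral_congr_ae (Eventually.of_forall fun θ => ?_)
    simp only [hG, norm_mul, norm_inv, norm_pow, norm_prod,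
      norm_circlePt hr0.le, one_div]
    rfl
  have hcs : Integrable (fun x => |cesaroSum (ι := ι) N x|) μ :=
    ((continuous_cesaroSum N).abs.continuousOn.integrableOn_compact isCompact_Icc)
  have hGx : Integrable (fun x => ∫ θ, G x θ ∂ν) μ := hGi.integral_prod_left
  calc ∫ x, |cesaroSum N x| ∂μ ≤ ∫ x, (2 * Real.pi)⁻¹ * ∫ θ, G x θ ∂ν ∂μ :=
        integral_mono hcs (hGx.const_mul _) hle
    _ = (2 * Real.pi)⁻¹ * ∫ θ, ∫ x, G x θ ∂μ ∂ν := by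
        rw [integral_const_mul, integral_integral_swap hGi]
    _ ≤ (2 * Real.pi)⁻¹ * ∫ θ, (r ^ N)⁻¹ * ((256 * d) ^ d * (1 - r) ^ (-(1 / 2) : ℝ)) *
          circleDist r θ ^ (-(3 / 2) : ℝ) ∂ν := by
        refine mul_le_mul_of_nonneg_left ?_ (by have := Real.pi_pos; positivity)
        refine integral_mono hGi.integral_prod_right ?_ fun θ => ?_
        · exact ((continuous_const.mul (continuous_circleDist_rpow hr0.le hr1 _)).integrableOn_Icc
            (a := -Real.pi) (b := Real.pi)).mono_set Set.Ioc_subset_Icc_self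
        · simp only [hG]
          rw [integral_const_mul, integral_const_mul, mul_assoc]
          refine mul_le_mul_of_nonneg_left ?_ (by positivity)
          have hprod : ∫ x, ∏ i, ‖poissonC (circlePt r θ) (x i)‖ ∂μ
              ≤ (128 / s * (circleDist r θ / (1 - r)) ^ s) ^ d := by
            rw [hμp, integral_fintype_prod_eq_pow (fun t => ‖poissonC (circlePt r θ) t‖)]
            exact pow_le_pow_left₀ (integral_nonneg fun _ => norm_nonneg _)
              (integral_norm_poissonC_le hr2 hr1 hs0 hs1 θ) d
          have hg := hpos θ
          refine (mul_le_mul_of_nonneg_left hprod (by positivity)).trans (le_of_eq ?_)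
          have hsd : s * d = 1 / 2 := by rw [hs]; field_simp
          rw [mul_pow, ← Real.rpow_mul_natCast (by positivity), hsd,
            Real.div_rpow hg.le hδ.le, Real.rpow_neg hδ.le,
            show (-(3 / 2) : ℝ) = 1 / 2 + (-2 : ℝ) by norm_num, Real.rpow_add hg,
            Real.rpow_neg hg.le, Real.rpow_two]
          have : 128 / s = 256 * d := by rw [hs]; field_simp; norm_num
          rw [this]
          field_simp
    _ ≤ (2 * Real.pi)⁻¹ * ((r ^ N)⁻¹ * ((256 * d) ^ d * (1 - r) ^ (-(1 / 2) : ℝ)) *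
          (2 * 4 ^ (3 / 2 : ℝ) * ((1 - r) ^ (1 - 3 / 2 : ℝ) / (3 / 2 - 1)))) := by
        refine mul_le_mul_of_nonneg_left ?_ (by have := Real.pi_pos; positivity)
        rw [integral_const_mul]
        refine mul_le_mul_of_nonneg_left ?_ (by positivity)
        have := integral_circleDist_rpow_le (p := 3 / 2) hr2 hr1 (by norm_num)
        rwa [intervalIntegral.integral_of_le (by linarith [Real.pi_pos])] at this
    _ ≤ 16 * (256 * d) ^ d * (N + 2) := by
        have h4 : (4 : ℝ) ^ (3 / 2 : ℝ) = 8 := by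
          rw [show (4 : ℝ) = 2 ^ (2 : ℝ) by norm_num, ← Real.rpow_mul (by norm_num)]
          norm_num
        have hdd2 : (1 - r) ^ (-(1 / 2) : ℝ) * (1 - r) ^ (1 - 3 / 2 : ℝ) = N + 2 := by
          rw [← Real.rpow_add hδ, show (-(1 / 2) + (1 - 3 / 2) : ℝ) = -1 by norm_num,
            Real.rpow_neg_one, hδe]
          simp
        have hrN : (r ^ N)⁻¹ ≤ 3 := by
          have h1 : r⁻¹ = 1 + 1 / (N + 1) := by rw [hr]; field_simp; ring
          rw [← inv_pow, h1]
          calc (1 + 1 / ((N : ℝ) + 1)) ^ N ≤ (Real.exp (1 / (N + 1))) ^ N := by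
                refine pow_le_pow_left₀ (by positivity) ?_ N
                linarith [Real.add_one_le_exp (1 / ((N : ℝ) + 1))]
            _ = Real.exp (N * (1 / (N + 1))) := by rw [Real.exp_nat_mul]
            _ ≤ Real.exp 1 := by
                refine Real.exp_le_exp.2 ?_
                rw [mul_one_div, div_le_one (by positivity)]
                linarith
            _ ≤ 3 := Real.exp_one_lt_d9.le.trans (by norm_num)
        have hpi : (2 * Real.pi)⁻¹ ≤ 1 / 6 := by
          rw [inv_le_comm₀ (by have := Real.pi_pos; positivity) (by norm_num)]
          linarith [Real.pi_gt_three]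
        rw [h4]
        set B : ℝ := (256 * d) ^ d with hB
        have hB0 : 0 < B := by positivity
        calc _ = (2 * Real.pi)⁻¹ * (r ^ N)⁻¹ * (32 * B *
              ((1 - r) ^ (-(1 / 2) : ℝ) * (1 - r) ^ (1 - 3 / 2 : ℝ))) := by ring
          _ = (2 * Real.pi)⁻¹ * (r ^ N)⁻¹ * (32 * B * (N + 2)) := by rw [hdd2]
          _ ≤ 1 / 6 * 3 * (32 * B * (N + 2)) := by
              refine mul_le_mul_of_nonneg_right ?_ (by positivity)
              exact mul_le_mul hpi hrN (by positivity) (by norm_num)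
          _ = 16 * B * (N + 2) := by ring

theorem sum_dirichletKernel (N : ℕ) (x : ι → ℝ) :
    ∑ n ∈ Finset.range (N + 1), dirichletKernel n x
      = ((2 : ℝ) ^ Fintype.card ι)⁻¹ * cesaroSum N x := by
  simp only [dirichletKernel, ← Finset.mul_sum, sum_freq_cos]
  congr 1
  have hsub : ∀ n ∈ Finset.range (N + 1),
      ∑ k ∈ freq ι n, ∏ i, Real.cos (Real.pi * k i * x i)
      = ∑ k ∈ freq ι N, if (∑ i, |k i|) ≤ (n : ℤ) then ∏ i, Real.cos (Real.pi * k i * x i) else 0 := by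
    intro n hn
    rw [← Finset.sum_filter]
    refine Finset.sum_congr ?_ fun _ _ => rfl
    ext k
    rw [Finset.mem_filter, mem_freq, mem_freq]
    rw [Finset.mem_range] at hn
    constructor
    · intro h; exact ⟨by omega, h⟩
    · exact fun h => h.2
  rw [Finset.sum_congr rfl hsub, Finset.sum_comm, cesaroSum]
  refine Finset.sum_congr rfl fun k hk => ?_
  rw [← Finset.sum_filter, Finset.sum_const, nsmul_eq_mul]
  congr 1
  have hk' := mem_freq.1 hk
  have hk0 : 0 ≤ ∑ i, |k i| := Finset.sum_nonneg fun i _ => abs_nonneg _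
  obtain ⟨q, hq⟩ := Int.eq_ofNat_of_zero_le hk0
  have hq2 : (∑ i, |(k i : ℝ)|) = q := by
    have := congrArg (Int.cast : ℤ → ℝ) hq
    push_cast at this
    exact this
  rw [hq2, hq]
  rw [hq] at hk'
  have hqN : q ≤ N := by exact_mod_cast hk'
  have : (Finset.range (N + 1)).filter (fun n : ℕ => (q : ℤ) ≤ n) = Finset.Ico q (N + 1) := by
    ext n
    simp only [Finset.mem_filter, Finset.mem_range, Finset.mem_Ico]
    omega
  rw [this, Nat.card_Ico, Nat.cast_sub (by omega)]
  push_cast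
  ring

theorem continuous_vpKernel (N : ℕ) : Continuous (vpKernel (ι := ι) N) := by
  unfold vpKernel dirichletKernel; fun_prop

/-- The Lebesgue constant of the de la Vallée-Poussin means in dimension `d`. -/
noncomputable def lebesgueConst (d : ℕ) : ℝ := 48 * (256 * d) ^ d

/-- The `L¹` norm of the de la Vallée-Poussin kernel is bounded independently of its order. -/
theorem integral_abs_vpKernel_le (hd : 0 < Fintype.card ι) {q : ℕ} (hq : 0 < q) :
    ∫ x in Set.Icc (-1 : ι → ℝ) 1, |vpKernel (2 * q) x| ≤ lebesgueConst (Fintype.card ι) := by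
  set d := Fintype.card ι with hdd
  have h1 := integral_abs_cesaroSum_le hd (2 * q)
  have h2 := integral_abs_cesaroSum_le hd (q - 1)
  rw [← hdd] at h1 h2
  set c : ℝ := ((2 : ℝ) ^ d)⁻¹ with hc
  have hc0 : 0 ≤ c := by positivity
  have hc1 : c ≤ 1 := inv_le_one_of_one_le₀ (one_le_pow₀ (by norm_num))
  have hq0 : (0 : ℝ) < q := by exact_mod_cast hq
  have hpt : ∀ x : ι → ℝ, |vpKernel (2 * q) x|
      ≤ ((q : ℝ) + 1)⁻¹ * (|cesaroSum (2 * q) x| + |cesaroSum (q - 1) x|) := by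
    intro x
    have e1 : (2 * q) / 2 = q := by omega
    have e2 : Finset.Icc q (2 * q) = Finset.Ico q (2 * q + 1) := by
      ext n; simp only [Finset.mem_Icc, Finset.mem_Ico]; omega
    -- The kernel is a difference of the Cesàro sums of orders `2 q` and `q - 1`.
    rw [vpKernel, e1, e2, Finset.sum_Ico_eq_sub _ (by omega), sum_dirichletKernel,
      show q = (q - 1) + 1 by omega, sum_dirichletKernel]
    rw [show q - 1 + 1 = q by omega, ← hdd, ← hc, ← mul_sub, abs_mul, abs_mul, abs_of_nonneg hc0]
    have e3 : (((2 * q : ℕ) : ℝ) / 2 + 1)⁻¹ = ((q : ℝ) + 1)⁻¹ := by push_cast; congr 2; ring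
    rw [e3, abs_of_pos (by positivity)]
    refine mul_le_mul_of_nonneg_left ?_ (by positivity)
    refine (mul_le_of_le_one_left (abs_nonneg _) hc1).trans ?_
    exact abs_sub _ _
  have hi : ∀ n, Integrable (fun x => |cesaroSum (ι := ι) n x|)
      ((volume : Measure (ι → ℝ)).restrict (Set.Icc (-1) 1)) := fun n =>
    ((continuous_cesaroSum n).abs.continuousOn.integrableOn_compact isCompact_Icc)
  have hv : Integrable (fun x => |vpKernel (ι := ι) (2 * q) x|)
      ((volume : Measure (ι → ℝ)).restrict (Set.Icc (-1) 1)) :=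
    ((continuous_vpKernel _).abs.continuousOn.integrableOn_compact isCompact_Icc)
  refine (integral_mono hv (((hi _).add (hi _)).const_mul _) hpt).trans ?_
  rw [integral_const_mul]
  simp only [Pi.add_apply]
  rw [integral_add (hi _) (hi _), inv_mul_le_iff₀ (by positivity), lebesgueConst]
  have e4 : ((q - 1 : ℕ) : ℝ) = q - 1 := by rw [Nat.cast_sub hq]; simp
  rw [e4] at h2
  push_cast at h1
  have hB : (0 : ℝ) ≤ (256 * d) ^ d := by positivity
  set B : ℝ := (256 * d) ^ d
  nlinarith [mul_nonneg hB hq0.le]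

end KernelBound

/-! ### Periodic convolution -/

section Conv

open Filter Topology

variable {ι : Type} [Fintype ι] [DecidableEq ι]

theorem wrapCoord_add_int (t : ℝ) (n : ℤ) : wrapCoord (t + 2 * n) = wrapCoord t := by
  apply Subtype.ext
  simp only [wrapCoord]
  rw [show (t + 2 * n + 1) / 2 = (t + 1) / 2 + n by ring, Int.fract_add_intCast]

theorem coe_wrapCoord (t : ℝ) : (wrapCoord t : ℝ) = t + 2 * ((-⌊(t + 1) / 2⌋ : ℤ) : ℝ) := by
  simp only [wrapCoord, Int.fract]
  push_cast
  ring

theorem wrapCoord_wrapCoord_add (t s : ℝ) : wrapCoord (wrapCoord t + s) = wrapCoord (t + s) := by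
  rw [coe_wrapCoord, add_right_comm, wrapCoord_add_int]

theorem wrap_wrap_add (x t : ι → ℝ) : wrap (toVec (wrap x) + t) = wrap (x + t) := by
  funext i
  exact wrapCoord_wrapCoord_add (x i) (t i)

theorem wrap_toVec_wrap (x : ι → ℝ) : wrap (toVec (wrap x)) = wrap x := by
  simpa using wrap_wrap_add x 0

/-- Periodicity with period `2` in every coordinate, in terms of the reduction to the cube. -/
def IsPer (F : (ι → ℝ) → ℝ) : Prop := ∀ x, F (toVec (wrap x)) = F x

theorem isPer_periodize (f : Cube ι → ℝ) : IsPer (periodize f) := fun x => by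
  simp only [periodize, wrap_toVec_wrap]

theorem IsPer.add_right {F : (ι → ℝ) → ℝ} (hF : IsPer F) (t : ι → ℝ) : IsPer fun x => F (x + t) := by
  intro x
  change F (toVec (wrap x) + t) = F (x + t)
  rw [← hF, wrap_wrap_add, hF]

theorem soc_wrapCoord (n : ℤ) (t : ℝ) : soc n (wrapCoord t) = soc n t := by
  rw [coe_wrapCoord]
  set l := -⌊(t + 1) / 2⌋
  have e : n * Real.pi * (t + 2 * l) = n * Real.pi * t + (n * l : ℤ) * (2 * Real.pi) := by
    push_cast; ring
  rcases lt_or_ge 0 n with h | h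
  · rw [soc_of_pos h, soc_of_pos h, e, Real.sin_add_int_mul_two_pi]
  · rw [soc_of_nonpos h, soc_of_nonpos h, e, Real.cos_add_int_mul_two_pi]

theorem isPer_trigFn (n : ι → ℤ) : IsPer (trigFn n) := fun x =>
  Finset.prod_congr rfl fun i _ => soc_wrapCoord (n i) (x i)

theorem continuous_trigFn (n : ι → ℤ) : Continuous (trigFn n) :=
  continuous_finsetProd _ fun i _ => (continuous_soc (n i)).comp (continuous_apply i)

theorem measurable_toVec : Measurable (toVec : Cube ι → ι → ℝ) :=
  measurable_pi_lambda _ fun i => measurable_subtype_coe.comp (measurable_pi_apply i)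

/-- Lebesgue measure on the cube `[-1,1]^ι`. -/
noncomputable def cubeMeasure (ι : Type) [Fintype ι] : Measure (ι → ℝ) :=
  volume.restrict (Set.Icc (-1) 1)

theorem cubeMeasure_eq_pi : cubeMeasure ι
    = Measure.pi fun _ : ι => (volume : Measure ℝ).restrict (Set.Icc (-1) 1) :=
  volume_restrict_cube

instance : IsFiniteMeasure (cubeMeasure ι) := by
  rw [cubeMeasure_eq_pi]; infer_instance

theorem map_wrapCoord_add (a : ℝ) :
    ((volume : Measure ℝ).restrict (Set.Icc (-1) 1)).map (fun t => wrapCoord (a + t))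
      = ((volume : Measure ℝ).restrict (Set.Icc (-1) 1)).map wrapCoord := by
  have hm : Measurable fun t => wrapCoord (a + t) :=
    measurable_wrapCoord.comp (measurable_const.add measurable_id)
  ext S hS
  rw [Measure.map_apply hm hS, Measure.map_apply measurable_wrapCoord hS]
  refine (ENNReal.toReal_eq_toReal_iff' (measure_ne_top _ _) (measure_ne_top _ _)).1 ?_
  set f : ℝ → ℝ := (wrapCoord ⁻¹' S).indicator 1 with hf
  have hper : Function.Periodic f 2 := by
    intro t
    have := wrapCoord_add_int t 1
    rw [Int.cast_one, mul_one] at this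
    have h2 : t + 2 ∈ wrapCoord ⁻¹' S ↔ t ∈ wrapCoord ⁻¹' S := by
      rw [Set.mem_preimage, Set.mem_preimage, this]
    by_cases ht : t ∈ wrapCoord ⁻¹' S
    · rw [hf, Set.indicator_of_mem (h2.2 ht), Set.indicator_of_mem ht]; rfl
    · rw [hf, Set.indicator_of_notMem (mt h2.1 ht), Set.indicator_of_notMem ht]
  have h1 : ∫ t in (-1 : ℝ)..1, f (a + t) = ∫ t in (-1 : ℝ)..1, f t := by
    rw [intervalIntegral.integral_comp_add_left f a]
    have := hper.intervalIntegral_add_eq (a + -1) (-1)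
    rwa [show a + -1 + 2 = a + 1 by ring, show (-1 : ℝ) + 2 = 1 by norm_num] at this
  rw [intervalIntegral.integral_of_le (by norm_num), intervalIntegral.integral_of_le (by norm_num),
    ← integral_Icc_eq_integral_Ioc, ← integral_Icc_eq_integral_Ioc] at h1
  have e1 : (fun t => f (a + t)) = ((fun t => wrapCoord (a + t)) ⁻¹' S).indicator 1 := rfl
  rw [e1, hf, integral_indicator_one (hm hS), integral_indicator_one (measurable_wrapCoord hS)] at h1
  exact h1

theorem map_wrap_add (x : ι → ℝ) :
    (cubeMeasure ι).map (fun t => wrap (x + t)) = (cubeMeasure ι).map wrap := by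
  rw [cubeMeasure_eq_pi]
  have h1 := Measure.pi_map_pi (μ := fun _ : ι => (volume : Measure ℝ).restrict (Set.Icc (-1) 1))
    (f := fun i t => wrapCoord (x i + t)) fun i =>
      (measurable_wrapCoord.comp (measurable_const.add measurable_id)).aemeasurable
  have h2 := Measure.pi_map_pi (μ := fun _ : ι => (volume : Measure ℝ).restrict (Set.Icc (-1) 1))
    (f := fun _ t => wrapCoord t) fun i => measurable_wrapCoord.aemeasurable
  simp only [map_wrapCoord_add] at h1
  exact h1.trans h2.symm

theorem integral_add_of_isPer {F : (ι → ℝ) → ℝ} (hF : IsPer F) (hm : Measurable F) (x : ι → ℝ) :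
    ∫ t, F (x + t) ∂cubeMeasure ι = ∫ t, F t ∂cubeMeasure ι := by
  have hs : ∀ μ : Measure (Cube ι), AEStronglyMeasurable (F ∘ toVec) μ := fun μ =>
    (hm.comp measurable_toVec).aestronglyMeasurable
  calc ∫ t, F (x + t) ∂cubeMeasure ι = ∫ t, (F ∘ toVec) (wrap (x + t)) ∂cubeMeasure ι := by
        simp only [Function.comp, hF (x + _)]
    _ = ∫ t, (F ∘ toVec) (wrap t) ∂cubeMeasure ι := by
        have hx : Measurable fun t : ι → ℝ => wrap (x + t) :=
          measurable_wrap.comp (measurable_const.add measurable_id)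
        rw [← integral_map (f := F ∘ toVec) hx.aemeasurable (hs _),
          ← integral_map (f := F ∘ toVec) measurable_wrap.aemeasurable (hs _), ← map_wrap_add x]
    _ = ∫ t, F t ∂cubeMeasure ι := by simp only [Function.comp, hF _]

/-- Circular convolution (in the correlation form) with the kernel `K`. -/
noncomputable def conv (K F : (ι → ℝ) → ℝ) (x : ι → ℝ) : ℝ := ∫ t, K t * F (x + t) ∂cubeMeasure ι

theorem integrable_of_continuous {F : (ι → ℝ) → ℝ} (hF : Continuous F) :
    Integrable F (cubeMeasure ι) :=
  hF.continuousOn.integrableOn_compact isCompact_Icc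

theorem continuous_conv {K F : (ι → ℝ) → ℝ} (hK : Continuous K) (hF : Continuous F) :
    Continuous (conv K F) := by
  unfold conv cubeMeasure
  exact continuous_parametric_integral_of_continuous (f := fun x t => K t * F (x + t))
    (by fun_prop) isCompact_Icc

theorem isPer_conv {K F : (ι → ℝ) → ℝ} (hF : IsPer F) : IsPer (conv K F) := fun x => by
  unfold conv
  congr 1
  funext t
  exact congrArg _ (hF.add_right t x)

/-- The trigonometric polynomials of total degree at most `N`. -/
noncomputable def trigSpace (ι : Type) [Fintype ι] [DecidableEq ι] (N : ℕ) :
    Submodule ℝ ((ι → ℝ) → ℝ) :=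
  Submodule.span ℝ (Set.range fun n : freq ι N => trigFn n.1)

theorem trigFn_mem_trigSpace {N : ℕ} {n : ι → ℤ} (hn : n ∈ freq ι N) : trigFn n ∈ trigSpace ι N :=
  Submodule.subset_span ⟨⟨n, hn⟩, rfl⟩

theorem exists_coeff_of_mem_trigSpace {N : ℕ} {P : (ι → ℝ) → ℝ} (hP : P ∈ trigSpace ι N) :
    ∃ θ : freq ι N → ℝ, ∀ x, P x = ∑ n, θ n * trigFn n.1 x := by
  obtain ⟨θ, hθ⟩ := (Submodule.mem_span_range_iff_exists_fun ℝ).1 hP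
  exact ⟨θ, fun x => by rw [← hθ]; simp⟩

/-- The tensor product cosine `t ↦ ∏ i, cos (π (m i) (t i))`. -/
noncomputable def cosProd (m : ι → ℤ) (t : ι → ℝ) : ℝ := ∏ i, Real.cos (Real.pi * m i * t i)

theorem continuous_cosProd (m : ι → ℤ) : Continuous (cosProd m) := by
  unfold cosProd; fun_prop

theorem abs_cosProd_le (m : ι → ℤ) (t : ι → ℝ) : |cosProd m t| ≤ 1 := by
  rw [cosProd, Finset.abs_prod]
  exact Finset.prod_le_one (fun i _ => abs_nonneg _) fun i _ => Real.abs_cos_le_one _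

theorem abs_trigFn_le (m : ι → ℤ) (t : ι → ℝ) : |trigFn m t| ≤ 1 := by
  rw [trigFn, Finset.abs_prod]
  exact Finset.prod_le_one (fun i _ => abs_nonneg _) fun i _ => abs_soc_le _ _

theorem cosProd_sub (m : ι → ℤ) (x u : ι → ℝ) :
    cosProd m (u - x) = ∑ σ : ι → Bool, (trigWeight (fun i => if σ i then m i else -m i)
        / 2 ^ Fintype.card ι) * (trigFn (fun i => if σ i then m i else -m i) x *
          trigFn (fun i => if σ i then m i else -m i) u) := by
  have h := Finset.prod_univ_sum (fun _ : ι => (Finset.univ : Finset Bool))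
    (fun i b => (if (if b then m i else -m i) = 0 then 1 else 2) / 2 *
      (soc (if b then m i else -m i) (x i) * soc (if b then m i else -m i) (u i)))
  simp only [Fintype.piFinset_univ] at h
  have h2 : cosProd m (u - x) = ∏ i, ∑ b : Bool,
      (if (if b then m i else -m i) = 0 then (1 : ℝ) else 2) / 2 *
      (soc (if b then m i else -m i) (x i) * soc (if b then m i else -m i) (u i)) := by
    refine Finset.prod_congr rfl fun i _ => ?_
    rw [Pi.sub_apply, ← soc_mul_soc_symm]
    simp only [Fintype.sum_bool, if_true, Bool.false_eq_true, if_false]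
    ring
  rw [h2, h]
  refine Finset.sum_congr rfl fun σ _ => ?_
  rw [Finset.prod_mul_distrib, Finset.prod_div_distrib, Finset.prod_mul_distrib]
  simp [trigWeight, trigFn]

theorem isPer_cosProd_sub (m : ι → ℤ) (x : ι → ℝ) : IsPer fun u => cosProd m (u - x) := by
  intro u
  simp only [cosProd_sub]
  refine Finset.sum_congr rfl fun σ _ => ?_
  rw [isPer_trigFn]

/-- By the addition theorem, `cosProd m (u - x)` is a combination of products
`trigFn n x * trigFn n u`, where `n` runs through the vectors obtained from `m` by sign changes. -/
theorem conv_cosProd_mem {N : ℕ} {m : ι → ℤ} (hm : m ∈ freq ι N) {F : (ι → ℝ) → ℝ} (hF : IsPer F)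
    (hFm : Measurable F) {B : ℝ} (hB : ∀ x, |F x| ≤ B) : conv (cosProd m) F ∈ trigSpace ι N := by
  have e : conv (cosProd m) F = ∑ σ : ι → Bool,
      ((trigWeight (fun i => if σ i then m i else -m i) / 2 ^ Fintype.card ι) *
        ∫ u, trigFn (fun i => if σ i then m i else -m i) u * F u ∂cubeMeasure ι) •
        trigFn (fun i => if σ i then m i else -m i) := by
    funext x
    have h1 := integral_add_of_isPer (F := fun u => cosProd m (u - x) * F u)
      (fun u => by
        have h1 := isPer_cosProd_sub m x u
        simp only at h1 ⊢
        rw [h1, hF])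
      (((continuous_cosProd m).comp (by fun_prop : Continuous fun u : ι → ℝ => u - x)).measurable.mul
        hFm) x
    simp only [add_sub_cancel_left] at h1
    rw [conv, h1]
    have hint : ∀ n : ι → ℤ, Integrable (fun u => trigFn n u * F u) (cubeMeasure ι) := fun n =>
      Integrable.of_bound (C := 1 * B) ((continuous_trigFn n).measurable.mul hFm).aestronglyMeasurable
        (Eventually.of_forall fun u => by
          rw [Real.norm_eq_abs, abs_mul]
          exact mul_le_mul (abs_trigFn_le n u) (hB u) (abs_nonneg _) zero_le_one)
    simp only [cosProd_sub, Finset.sum_mul]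
    rw [integral_finsetSum]
    · rw [Finset.sum_apply]
      refine Finset.sum_congr rfl fun σ _ => ?_
      rw [Pi.smul_apply, smul_eq_mul, mul_right_comm, ← integral_const_mul]
      congr 1
      funext u
      ring
    · intro σ _
      have := (hint (fun i => if σ i then m i else -m i)).const_mul
        (trigWeight (fun i => if σ i then m i else -m i) / 2 ^ Fintype.card ι *
          trigFn (fun i => if σ i then m i else -m i) x)
      refine this.congr (Eventually.of_forall fun u => ?_)
      simp only
      ring
  rw [e]
  refine Submodule.sum_mem _ fun σ _ => Submodule.smul_mem _ _ (trigFn_mem_trigSpace ?_)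
  rw [mem_freq] at hm ⊢
  refine le_of_eq_of_le (Finset.sum_congr rfl fun i _ => ?_) hm
  split_ifs <;> simp

/-- Convolution of a bounded periodic function with a cosine polynomial of degree at most `N` is a
trigonometric polynomial of degree at most `N`. -/
theorem conv_mem_trigSpace {N : ℕ} {κ : Type*} (s : Finset κ) (w : κ → ℝ) (m : κ → ι → ℤ)
    (hm : ∀ a ∈ s, m a ∈ freq ι N) {F : (ι → ℝ) → ℝ} (hF : IsPer F)
    (hFm : Measurable F) {B : ℝ} (hB : ∀ x, |F x| ≤ B) :
    conv (fun t => ∑ a ∈ s, w a * cosProd (m a) t) F ∈ trigSpace ι N := by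
  have e : conv (fun t => ∑ a ∈ s, w a * cosProd (m a) t) F
      = ∑ a ∈ s, w a • conv (cosProd (m a)) F := by
    funext x
    rw [conv, Finset.sum_apply]
    simp only [Finset.sum_mul]
    rw [integral_finsetSum]
    · refine Finset.sum_congr rfl fun a _ => ?_
      rw [Pi.smul_apply, conv, smul_eq_mul, ← integral_const_mul]
      simp only [mul_assoc]
    · intro a _
      refine Integrable.of_bound (C := |w a| * B) ?_ (Eventually.of_forall fun u => ?_)
      · exact ((measurable_const.mul (continuous_cosProd (m a)).measurable).mul
          (hFm.comp (measurable_const.add measurable_id))).aestronglyMeasurable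
      · rw [Real.norm_eq_abs, abs_mul, abs_mul]
        refine mul_le_mul ?_ (hB _) (abs_nonneg _) (abs_nonneg _)
        exact mul_le_of_le_one_right (abs_nonneg _) (abs_cosProd_le _ _)
  rw [e]
  exact Submodule.sum_mem _ fun a ha => Submodule.smul_mem _ _ (conv_cosProd_mem (hm a ha) hF hFm hB)

theorem vpKernel_eq_sum (N : ℕ) (x : ι → ℝ) : vpKernel N x
    = ∑ p ∈ (Finset.Icc (N / 2) N).sigma (fun n => freq ι n),
      (((N : ℝ) / 2 + 1)⁻¹ * ((2 : ℝ) ^ Fintype.card ι)⁻¹) * cosProd p.2 x := by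
  rw [vpKernel, Finset.sum_sigma]
  rw [Finset.mul_sum]
  refine Finset.sum_congr rfl fun n _ => ?_
  rw [dirichletKernel, sum_freq_cos, ← mul_assoc, Finset.mul_sum]
  rfl

theorem freq_mono {n N : ℕ} (h : n ≤ N) : freq ι n ⊆ freq ι N := fun k hk => by
  rw [mem_freq] at hk ⊢
  omega

theorem conv_vpKernel_mem (N : ℕ) {F : (ι → ℝ) → ℝ} (hF : IsPer F)
    (hFm : Measurable F) {B : ℝ} (hB : ∀ x, |F x| ≤ B) : conv (vpKernel N) F ∈ trigSpace ι N := by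
  rw [show vpKernel (ι := ι) N = _ from funext (vpKernel_eq_sum N)]
  refine conv_mem_trigSpace _ _ (fun p : (_ : ℕ) × (ι → ℤ) => p.2) (fun p hp => ?_) hF hFm hB
  rw [Finset.mem_sigma, Finset.mem_Icc] at hp
  exact freq_mono hp.1.2 hp.2

theorem setIntegral_Icc_eq (f : ℝ → ℝ) : ∫ y in Set.Icc (-1 : ℝ) 1, f y = 2 * ∫ y, f y ∂unifIcc := by
  rw [integral_unifIcc]; ring

theorem conv_cosProd_trigFn (m n : ι → ℤ) (x : ι → ℝ) :
    conv (cosProd m) (trigFn n) x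
      = (∏ i, 2 * (if |m i| = |n i| then (if n i = 0 then 1 else 2)⁻¹ else 0)) * trigFn n x := by
  have e : ∀ t : ι → ℝ, cosProd m t * trigFn n (x + t)
      = ∏ i, Real.cos (Real.pi * m i * t i) * soc (n i) (x i + t i) := fun t => by
    rw [Finset.prod_mul_distrib]; rfl
  simp only [conv, e]
  rw [cubeMeasure_eq_pi, integral_fintype_prod_eq_prod
    (fun i t => Real.cos (Real.pi * m i * t) * soc (n i) (x i + t)), trigFn, ← Finset.prod_mul_distrib]
  refine Finset.prod_congr rfl fun i _ => ?_
  rw [setIntegral_Icc_eq, (isExact_unifIcc (|m i| + |n i|).toNat).cos_soc_add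
    (by rw [Int.toNat_of_nonneg (by positivity)]), mul_assoc]

/-- The partial sums reproduce their frequencies. Of the tensor cosines of the kernel only those with
frequency `n` up to signs survive. -/
theorem conv_dirichletKernel_trigFn {l : ℕ} {n : ι → ℤ} (hn : n ∈ freq ι l) (x : ι → ℝ) :
    conv (dirichletKernel l) (trigFn n) x = trigFn n x := by
  have e : dirichletKernel (ι := ι) l
      = fun t => ((2 : ℝ) ^ Fintype.card ι)⁻¹ * ∑ k ∈ freq ι l, cosProd k t := by
    funext t
    rw [dirichletKernel, sum_freq_cos]
    rfl
  have h1 : conv (dirichletKernel l) (trigFn n) x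
      = ((2 : ℝ) ^ Fintype.card ι)⁻¹ * ∑ k ∈ freq ι l, conv (cosProd k) (trigFn n) x := by
    simp only [conv, e, mul_assoc, integral_const_mul, Finset.sum_mul]
    rw [integral_finsetSum]
    intro k _
    exact integrable_of_continuous ((continuous_cosProd k).mul
      ((continuous_trigFn n).comp (by fun_prop)))
  rw [h1]
  simp only [conv_cosProd_trigFn]
  rw [← Finset.sum_mul, ← mul_assoc]
  have hsub : freq ι l ⊆ Fintype.piFinset fun _ : ι => Finset.Icc (-(l : ℤ)) l :=
    Finset.filter_subset _ _
  have h2 : ∑ k ∈ freq ι l, ∏ i, (2 : ℝ) * (if |k i| = |n i| then (if n i = 0 then 1 else 2)⁻¹ else 0)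
      = 2 ^ Fintype.card ι := by
    rw [Finset.sum_subset hsub]
    · rw [← Finset.prod_univ_sum (fun _ : ι => Finset.Icc (-(l : ℤ)) l)
        (fun i a => (2 : ℝ) * (if |a| = |n i| then (if n i = 0 then 1 else 2)⁻¹ else 0))]
      rw [← Finset.card_univ, ← Finset.prod_const]
      refine Finset.prod_congr rfl fun i _ => ?_
      rw [← Finset.mul_sum, ← Finset.sum_filter, Finset.sum_const, nsmul_eq_mul]
      have hi := abs_le.1 (abs_le_of_mem_freq hn i)
      have hf : (Finset.Icc (-(l : ℤ)) l).filter (fun a => |a| = |n i|) = {n i, -n i} := by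
        ext a
        rw [Finset.mem_filter, Finset.mem_Icc, Finset.mem_insert, Finset.mem_singleton, abs_eq_abs]
        constructor
        · exact fun h => h.2
        · rintro (rfl | rfl)
          · exact ⟨hi, Or.inl rfl⟩
          · exact ⟨by omega, Or.inr rfl⟩
      rw [hf]
      by_cases h0 : n i = 0
      · simp [h0]
      · rw [Finset.card_pair (by omega)]
        simp [h0]
    · intro k _ hk
      obtain ⟨i, hi⟩ : ∃ i, |k i| ≠ |n i| := by
        by_contra hcon
        push Not at hcon
        apply hk
        rw [mem_freq] at hn ⊢
        rwa [Finset.sum_congr rfl fun i _ => hcon i]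
      exact Finset.prod_eq_zero (Finset.mem_univ i) (by simp [hi])
  rw [h2, inv_mul_cancel₀ (by positivity), one_mul]

/-- The de la Vallée-Poussin means reproduce trigonometric polynomials of half their degree. -/
theorem conv_vpKernel_trigFn {q : ℕ} {n : ι → ℤ} (hn : n ∈ freq ι q) (x : ι → ℝ) :
    conv (vpKernel (2 * q)) (trigFn n) x = trigFn n x := by
  have e1 : (2 * q) / 2 = q := by omega
  have h1 : conv (vpKernel (2 * q)) (trigFn n) x
      = (((2 * q : ℕ) : ℝ) / 2 + 1)⁻¹ *
        ∑ l ∈ Finset.Icc q (2 * q), conv (dirichletKernel l) (trigFn n) x := by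
    simp only [conv, vpKernel, e1, mul_assoc, integral_const_mul, Finset.sum_mul]
    rw [integral_finsetSum]
    intro k _
    refine integrable_of_continuous (Continuous.mul ?_ ((continuous_trigFn n).comp (by fun_prop)))
    unfold dirichletKernel
    fun_prop
  rw [h1, Finset.sum_congr rfl fun l hl =>
    conv_dirichletKernel_trigFn (freq_mono (Finset.mem_Icc.1 hl).1 hn) x]
  rw [Finset.sum_const, Nat.card_Icc, nsmul_eq_mul, ← mul_assoc]
  have : (((2 * q : ℕ) : ℝ) / 2 + 1)⁻¹ * ((2 * q + 1 - q : ℕ) : ℝ) = 1 := by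
    rw [show 2 * q + 1 - q = q + 1 by omega]
    push_cast
    rw [show (2 * (q : ℝ)) / 2 + 1 = q + 1 by ring]
    exact inv_mul_cancel₀ (by positivity)
  rw [this, one_mul]

theorem conv_vpKernel_of_mem {q : ℕ} {P : (ι → ℝ) → ℝ} (hP : P ∈ trigSpace ι q) (x : ι → ℝ) :
    conv (vpKernel (2 * q)) P x = P x := by
  obtain ⟨θ, hθ⟩ := exists_coeff_of_mem_trigSpace hP
  have h1 : conv (vpKernel (2 * q)) P x
      = ∑ n, θ n * conv (vpKernel (2 * q)) (trigFn n.1) x := by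
    simp only [conv, hθ, Finset.mul_sum]
    rw [integral_finsetSum]
    · refine Finset.sum_congr rfl fun n _ => ?_
      rw [← integral_const_mul]
      congr 1
      funext t
      ring
    · intro n _
      exact integrable_of_continuous ((continuous_vpKernel _).mul
        (continuous_const.mul ((continuous_trigFn n.1).comp (by fun_prop))))
  rw [h1, hθ]
  exact Finset.sum_congr rfl fun n _ => by rw [conv_vpKernel_trigFn n.2]

theorem conv_sub {K F G : (ι → ℝ) → ℝ} (hK : Continuous K) (hF : Continuous F) (hG : Continuous G)
    (x : ι → ℝ) : conv K (fun y => F y - G y) x = conv K F x - conv K G x := by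
  unfold conv
  rw [← integral_sub]
  · congr 1; funext t; ring
  · exact integrable_of_continuous (by fun_prop)
  · exact integrable_of_continuous (by fun_prop)

theorem abs_conv_le {K F : (ι → ℝ) → ℝ} (hK : Continuous K) {A B : ℝ}
    (hA : ∫ t, |K t| ∂cubeMeasure ι ≤ A) (hB : ∀ x, |F x| ≤ B) (x : ι → ℝ) :
    |conv K F x| ≤ A * B := by
  have hB0 : 0 ≤ B := (abs_nonneg _).trans (hB x)
  unfold conv
  refine (abs_integral_le_integral_abs).trans ?_
  calc ∫ t, |K t * F (x + t)| ∂cubeMeasure ι ≤ ∫ t, |K t| * B ∂cubeMeasure ι := by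
        refine integral_mono_of_nonneg (Eventually.of_forall fun t => abs_nonneg _)
          ((integrable_of_continuous hK.abs).mul_const B) (Eventually.of_forall fun t => ?_)
        simp only [abs_mul]
        exact mul_le_mul_of_nonneg_left (hB _) (abs_nonneg _)
    _ ≤ A * B := by
        rw [integral_mul_const]
        exact mul_le_mul_of_nonneg_right hA hB0

end Conv

/-! ### A direct approximation theorem -/

section Jackson

open Filter Topology

variable {ι : Type} [Fintype ι] [DecidableEq ι]

/-- The coefficients `sin (π k / M)` of the Fejér-Korovkin kernel. -/
noncomputable def korovkinCoeff (M k : ℕ) : ℝ := Real.sin (Real.pi * k / M)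

/-- The sum of the squares of the coefficients. -/
noncomputable def korovkinMass (M : ℕ) : ℝ := ∑ k ∈ Finset.range (M + 1), korovkinCoeff M k ^ 2

/-- The Fejér-Korovkin kernel `|∑_k a_k e^{iπkt}|² / (2 ∑_k a_k²)`, a nonnegative cosine polynomial of
degree less than `M`. -/
noncomputable def korovkin (M : ℕ) (t : ℝ) : ℝ :=
  (2 * korovkinMass M)⁻¹ * ∑ p ∈ Finset.range (M + 1) ×ˢ Finset.range (M + 1),
    korovkinCoeff M p.1 * korovkinCoeff M p.2 * Real.cos (Real.pi * ((p.1 : ℤ) - p.2 : ℤ) * t)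

theorem korovkinMass_pos {M : ℕ} (hM : 2 ≤ M) : 0 < korovkinMass M := by
  have hM' : (2 : ℝ) ≤ M := by exact_mod_cast hM
  refine Finset.sum_pos' (fun k _ => sq_nonneg _) ⟨1, Finset.mem_range.2 (by omega), ?_⟩
  have : 0 < korovkinCoeff M 1 := by
    refine Real.sin_pos_of_pos_of_lt_pi ?_ ?_
    · have := Real.pi_pos
      positivity
    · rw [div_lt_iff₀ (by linarith)]
      have := Real.pi_pos
      push_cast
      nlinarith
  positivity

theorem korovkin_eq_sq (M : ℕ) (t : ℝ) : korovkin M t = (2 * korovkinMass M)⁻¹ *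
    ((∑ k ∈ Finset.range (M + 1), korovkinCoeff M k * Real.cos (Real.pi * k * t)) ^ 2
      + (∑ k ∈ Finset.range (M + 1), korovkinCoeff M k * Real.sin (Real.pi * k * t)) ^ 2) := by
  rw [korovkin]
  congr 1
  rw [Finset.sum_product, sq, sq, Finset.sum_mul_sum, Finset.sum_mul_sum, ← Finset.sum_add_distrib]
  refine Finset.sum_congr rfl fun k _ => ?_
  rw [← Finset.sum_add_distrib]
  refine Finset.sum_congr rfl fun l _ => ?_
  push_cast
  rw [mul_sub, sub_mul, Real.cos_sub]
  ring

theorem korovkin_nonneg (M : ℕ) (t : ℝ) : 0 ≤ korovkin M t := by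
  rw [korovkin_eq_sq]
  have : 0 ≤ korovkinMass M := Finset.sum_nonneg fun k _ => sq_nonneg _
  positivity

theorem continuous_korovkin (M : ℕ) : Continuous (korovkin M) := by
  unfold korovkin; fun_prop

theorem integral_korovkin {M : ℕ} (hM : 2 ≤ M) : ∫ t in Set.Icc (-1 : ℝ) 1, korovkin M t = 1 := by
  have hA := korovkinMass_pos hM
  rw [setIntegral_Icc_eq]
  have := (isExact_unifIcc (2 * M)).finite
  simp only [korovkin]
  rw [integral_const_mul, integral_finsetSum]
  · have e : ∀ p ∈ Finset.range (M + 1) ×ˢ Finset.range (M + 1),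
        (∫ t, korovkinCoeff M p.1 * korovkinCoeff M p.2 *
          Real.cos (Real.pi * ((p.1 : ℤ) - p.2 : ℤ) * t) ∂unifIcc)
        = if p.1 = p.2 then korovkinCoeff M p.1 * korovkinCoeff M p.2 else 0 := by
      intro p hp
      rw [Finset.mem_product, Finset.mem_range, Finset.mem_range] at hp
      rw [integral_const_mul]
      simp only [mul_comm Real.pi]
      rw [(isExact_unifIcc (2 * M)).cos _ (by rw [abs_le]; constructor <;> push_cast <;> omega)]
      by_cases h : p.1 = p.2
      · simp [h]
      · rw [if_neg (by omega), if_neg h, mul_zero]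
    rw [Finset.sum_congr rfl e, Finset.sum_product]
    simp only [Finset.sum_ite_eq]
    have : ∑ k ∈ Finset.range (M + 1), (if k ∈ Finset.range (M + 1) then
        korovkinCoeff M k * korovkinCoeff M k else 0) = korovkinMass M := by
      refine Finset.sum_congr rfl fun k hk => ?_
      rw [if_pos hk, sq]
    rw [this]
    field_simp
  · intro p _
    exact (integrable_cos_mul _ _).const_mul _

/-- The first Fourier coefficient of the Fejér-Korovkin kernel; the sequence of coefficients is an
eigenvector of the discrete Laplacian. -/
theorem integral_korovkin_mul_cos {M : ℕ} (hM : 2 ≤ M) :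
    ∫ t in Set.Icc (-1 : ℝ) 1, korovkin M t * Real.cos (Real.pi * t) = Real.cos (Real.pi / M) := by
  have hA := korovkinMass_pos hM
  have hM0 : (M : ℝ) ≠ 0 := by exact_mod_cast (by omega : M ≠ 0)
  rw [setIntegral_Icc_eq]
  have hfin := (isExact_unifIcc (2 * M)).finite
  simp only [korovkin, mul_assoc, Finset.sum_mul]
  rw [integral_const_mul, integral_finsetSum]
  · have e : ∀ p ∈ Finset.range (M + 1) ×ˢ Finset.range (M + 1),
        (∫ t, korovkinCoeff M p.1 * (korovkinCoeff M p.2 *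
          (Real.cos (Real.pi * ((((p.1 : ℤ) - p.2 : ℤ) : ℝ) * t)) * Real.cos (Real.pi * t))) ∂unifIcc)
        = korovkinCoeff M p.1 * (korovkinCoeff M p.2 *
          (((if p.1 = p.2 + 1 then 1 else 0) + (if p.2 = p.1 + 1 then 1 else 0)) / 2)) := by
      intro p hp
      rw [Finset.mem_product, Finset.mem_range, Finset.mem_range] at hp
      rw [integral_const_mul, integral_const_mul]
      have h := (isExact_unifIcc (2 * M)).cos_cos (k := (p.1 : ℤ) - p.2) (n := 1) (by
        have : |(p.1 : ℤ) - p.2| ≤ M := by rw [abs_le]; constructor <;> omega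
        simp only [abs_one]
        push_cast
        omega)
      have e1 : ∀ t : ℝ, Real.cos (Real.pi * ((((p.1 : ℤ) - p.2 : ℤ) : ℝ) * t)) * Real.cos (Real.pi * t)
          = Real.cos ((((p.1 : ℤ) - p.2 : ℤ) : ℝ) * Real.pi * t)
            * Real.cos (((1 : ℤ) : ℝ) * Real.pi * t) := by
        intro t
        congr 2
        · ring
        · push_cast; ring
      simp only [e1]
      have i1 : (p.1 : ℤ) - p.2 = 1 ↔ p.1 = p.2 + 1 := by omega
      have i2 : (p.1 : ℤ) - p.2 = -1 ↔ p.2 = p.1 + 1 := by omega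
      rw [h]
      simp only [i1, i2]
    rw [Finset.sum_congr rfl e, Finset.sum_product]
    have e2 : ∀ k ∈ Finset.range (M + 1), ∑ l ∈ Finset.range (M + 1), korovkinCoeff M k *
        (korovkinCoeff M l * (((if k = l + 1 then 1 else 0) + (if l = k + 1 then 1 else 0)) / 2))
        = Real.cos (Real.pi / M) * korovkinCoeff M k ^ 2 := by
      intro k hk
      rw [Finset.mem_range] at hk
      rcases Nat.eq_zero_or_pos k with h0 | h0
      · subst h0
        simp [korovkinCoeff]
      · rcases Nat.lt_succ_iff_lt_or_eq.1 hk with h1 | h1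
        · obtain ⟨j, rfl⟩ : ∃ j, k = j + 1 := ⟨k - 1, by omega⟩
          rw [← Finset.mul_sum]
          have e3 : ∑ l ∈ Finset.range (M + 1), korovkinCoeff M l *
              (((if j + 1 = l + 1 then 1 else 0) + (if l = j + 1 + 1 then 1 else 0)) / 2)
              = (korovkinCoeff M j + korovkinCoeff M (j + 2)) / 2 := by
            have e4 : ∀ l, korovkinCoeff M l *
              (((if j + 1 = l + 1 then (1 : ℝ) else 0) + (if l = j + 1 + 1 then 1 else 0)) / 2)
              = (if j = l then korovkinCoeff M l / 2 else 0)
                + (if j + 2 = l then korovkinCoeff M l / 2 else 0) := by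
              intro l
              by_cases h5 : j = l
              · subst h5
                rw [if_pos rfl, if_neg (by omega), if_pos rfl, if_neg (by omega)]
                ring
              · by_cases h6 : j + 2 = l
                · have : j ≠ l := by omega
                  subst h6
                  simp; ring
                · have : l ≠ j + 1 + 1 := by omega
                  simp [h5, h6, this]
            simp only [e4, Finset.sum_add_distrib, Finset.sum_ite_eq, Finset.mem_range]
            rw [if_pos (by omega), if_pos (by omega)]
            ring
          rw [e3]
          have h7 : korovkinCoeff M j + korovkinCoeff M (j + 2)
              = 2 * Real.cos (Real.pi / M) * korovkinCoeff M (j + 1) := by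
            unfold korovkinCoeff
            have a1 : Real.pi * (j : ℝ) / M = Real.pi * ((j + 1 : ℕ) : ℝ) / M - Real.pi / M := by
              push_cast; ring
            have a2 : Real.pi * ((j + 2 : ℕ) : ℝ) / M
                = Real.pi * ((j + 1 : ℕ) : ℝ) / M + Real.pi / M := by push_cast; ring
            rw [a1, a2, Real.sin_sub, Real.sin_add]
            ring
          rw [h7]
          ring
        · have : korovkinCoeff M k = 0 := by
            rw [korovkinCoeff, h1, mul_div_cancel_right₀ _ hM0, Real.sin_pi]
          simp [this]
    rw [Finset.sum_congr rfl e2, ← Finset.mul_sum]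
    change 2 * ((2 * korovkinMass M)⁻¹ * (_ * korovkinMass M)) = _
    field_simp
  · intro p _
    refine Integrable.const_mul (Integrable.const_mul ?_ _) _
    refine Integrable.of_bound (C := 1) (by fun_prop) (Eventually.of_forall fun y => ?_)
    rw [norm_mul]
    exact mul_le_one₀ (Real.abs_cos_le_one _) (norm_nonneg _) (Real.abs_cos_le_one _)

/-- The first absolute moment of the Fejér-Korovkin kernel is `O(1 / M)`, since `∫ K (1 - cos π t)` is
`1 - cos (π / M) = O(1 / M²)`. -/
theorem integral_korovkin_mul_abs_le {M : ℕ} (hM : 2 ≤ M) :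
    ∫ t in Set.Icc (-1 : ℝ) 1, korovkin M t * |t| ≤ 2 / M := by
  have hM' : (0 : ℝ) < M := by exact_mod_cast (by omega : 0 < M)
  have hc := continuous_korovkin M
  have hpt : ∀ t ∈ Set.Icc (-1 : ℝ) 1, korovkin M t * |t|
      ≤ korovkin M t * (M / 4 * (1 - Real.cos (Real.pi * t)) + 1 / (2 * M)) := by
    intro t ht
    refine mul_le_mul_of_nonneg_left ?_ (korovkin_nonneg M t)
    have ht1 : |t| ≤ 1 := abs_le.2 ht
    have h1 : 2 * t ^ 2 ≤ 1 - Real.cos (Real.pi * t) := by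
      have h2 := Real.mul_abs_le_abs_sin (x := Real.pi * t / 2) (by
        rw [abs_div, abs_mul, abs_of_pos Real.pi_pos]
        norm_num
        nlinarith [Real.pi_pos])
      have h3 : 2 / Real.pi * |Real.pi * t / 2| = |t| := by
        rw [abs_div, abs_mul, abs_of_pos Real.pi_pos]
        norm_num
      rw [h3] at h2
      have h4 := pow_le_pow_left₀ (abs_nonneg t) h2 2
      rw [sq_abs, sq_abs] at h4
      have h5 := Real.cos_two_mul (Real.pi * t / 2)
      rw [show 2 * (Real.pi * t / 2) = Real.pi * t by ring] at h5
      nlinarith [Real.sin_sq_add_cos_sq (Real.pi * t / 2)]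
    have h6 : |t| ≤ M / 2 * t ^ 2 + 1 / (2 * M) := by
      have : 0 ≤ (M * |t| - 1) ^ 2 / (2 * M) := by positivity
      have e : (M * |t| - 1) ^ 2 / (2 * M) = M / 2 * t ^ 2 + 1 / (2 * M) - |t| := by
        field_simp
        rw [← sq_abs t]
        ring
      linarith
    nlinarith
  have hi : ∀ f : ℝ → ℝ, Continuous f → IntegrableOn f (Set.Icc (-1) 1) := fun f hf =>
    hf.continuousOn.integrableOn_compact isCompact_Icc
  refine (setIntegral_mono_on (hi _ (by fun_prop)) (hi _ (by fun_prop)) measurableSet_Icc hpt).trans ?_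
  have e : ∀ t, korovkin M t * (M / 4 * (1 - Real.cos (Real.pi * t)) + 1 / (2 * M))
      = (M / 4 + 1 / (2 * M)) * korovkin M t - M / 4 * (korovkin M t * Real.cos (Real.pi * t)) := by
    intro t; ring
  simp only [e]
  rw [integral_sub (hi _ (by fun_prop)) (hi _ (by fun_prop)), integral_const_mul, integral_const_mul,
    integral_korovkin hM, integral_korovkin_mul_cos hM]
  have h1 := Real.one_sub_sq_div_two_le_cos (x := Real.pi / M)
  have h2 : M / 4 * ((Real.pi / M) ^ 2 / 2) = Real.pi ^ 2 / (8 * M) := by field_simp; norm_num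
  have h3 : (M : ℝ) / 4 * (1 - Real.cos (Real.pi / M)) ≤ Real.pi ^ 2 / (8 * M) := by
    rw [← h2]
    exact mul_le_mul_of_nonneg_left (by linarith) (by positivity)
  have h4 : Real.pi ^ 2 / (8 * M) ≤ 12 / (8 * M) := by
    refine div_le_div_of_nonneg_right ?_ (by positivity)
    nlinarith [Real.pi_lt_d2, Real.pi_pos]
  have h5 : (12 : ℝ) / (8 * M) + 1 / (2 * M) = 2 / M := by field_simp; norm_num
  linarith

/-- The tensor product of one-dimensional Fejér-Korovkin kernels. -/
noncomputable def korovkinProd (M : ℕ) (t : ι → ℝ) : ℝ := ∏ i, korovkin M (t i)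

theorem korovkinProd_nonneg (M : ℕ) (t : ι → ℝ) : 0 ≤ korovkinProd M t :=
  Finset.prod_nonneg fun i _ => korovkin_nonneg M (t i)

theorem continuous_korovkinProd (M : ℕ) : Continuous (korovkinProd (ι := ι) M) :=
  continuous_finsetProd _ fun i _ => (continuous_korovkin M).comp (continuous_apply i)

theorem integral_korovkinProd {M : ℕ} (hM : 2 ≤ M) :
    ∫ t, korovkinProd M t ∂cubeMeasure ι = 1 := by
  unfold korovkinProd
  rw [cubeMeasure_eq_pi, integral_fintype_prod_eq_prod (fun _ t => korovkin M t)]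
  simp [integral_korovkin hM]

theorem integral_korovkinProd_mul_norm_le {M : ℕ} (hM : 2 ≤ M) :
    ∫ t, korovkinProd M t * ‖t‖ ∂cubeMeasure ι ≤ 2 * Fintype.card ι / M := by
  have hc := continuous_korovkinProd (ι := ι) M
  have hpt : ∀ t : ι → ℝ, korovkinProd M t * ‖t‖ ≤ ∑ i, korovkinProd M t * |t i| := by
    intro t
    rw [← Finset.mul_sum]
    refine mul_le_mul_of_nonneg_left ?_ (korovkinProd_nonneg M t)
    refine (pi_norm_le_iff_of_nonneg (Finset.sum_nonneg fun i _ => abs_nonneg _)).2 fun i => ?_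
    exact Finset.single_le_sum (f := fun i => |t i|) (fun i _ => abs_nonneg _) (Finset.mem_univ i)
  have hi : ∀ i : ι, Integrable (fun t => korovkinProd M t * |t i|) (cubeMeasure ι) := fun i =>
    integrable_of_continuous (by fun_prop)
  refine (integral_mono (integrable_of_continuous (by fun_prop))
    (integrable_finsetSum _ fun i _ => hi i) hpt).trans ?_
  rw [integral_finsetSum _ fun i _ => hi i]
  have h1 : ∀ i : ι, ∫ t, korovkinProd M t * |t i| ∂cubeMeasure ι ≤ 2 / M := by
    intro i
    have e : ∀ t : ι → ℝ, korovkinProd M t * |t i|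
        = ∏ j, (korovkin M (t j) * if j = i then |t j| else 1) := by
      intro t
      rw [Finset.prod_mul_distrib, Finset.prod_ite_eq' Finset.univ i (fun j => |t j|)]
      simp [korovkinProd]
    simp only [e]
    rw [cubeMeasure_eq_pi, integral_fintype_prod_eq_prod
      (fun j t => korovkin M t * if j = i then |t| else 1), Finset.prod_eq_single i]
    · simpa using integral_korovkin_mul_abs_le hM
    · intro j _ hj
      simp [hj, integral_korovkin hM]
    · simp
  refine (Finset.sum_le_sum fun i _ => h1 i).trans (le_of_eq ?_)
  simp
  ring

theorem conv_korovkinProd_mem {M q : ℕ} (hq : Fintype.card ι * M ≤ q)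
    {F : (ι → ℝ) → ℝ} (hF : IsPer F)
    (hFm : Measurable F) {B : ℝ} (hB : ∀ x, |F x| ≤ B) : conv (korovkinProd M) F ∈ trigSpace ι q := by
  have e : korovkinProd (ι := ι) M = fun t => ∑ p ∈ Fintype.piFinset fun _ : ι =>
      Finset.range (M + 1) ×ˢ Finset.range (M + 1), (∏ i, (2 * korovkinMass M)⁻¹ *
        (korovkinCoeff M (p i).1 * korovkinCoeff M (p i).2)) *
        cosProd (fun i => ((p i).1 : ℤ) - (p i).2) t := by
    funext t
    simp only [korovkinProd, korovkin, Finset.mul_sum]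
    rw [Finset.prod_univ_sum]
    refine Finset.sum_congr rfl fun p _ => ?_
    rw [cosProd, ← Finset.prod_mul_distrib]
    refine Finset.prod_congr rfl fun i _ => ?_
    ring
  rw [e]
  refine conv_mem_trigSpace _ _ (fun (p : ι → ℕ × ℕ) i => ((p i).1 : ℤ) - (p i).2)
    (fun p hp => ?_) hF hFm hB
  rw [Fintype.mem_piFinset] at hp
  rw [mem_freq]
  calc ∑ i, |((p i).1 : ℤ) - (p i).2| ≤ ∑ _i : ι, (M : ℤ) := Finset.sum_le_sum fun i _ => by
        have := hp i
        rw [Finset.mem_product, Finset.mem_range, Finset.mem_range] at this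
        rw [abs_le]
        constructor <;> omega
    _ = (Fintype.card ι * M : ℕ) := by simp
    _ ≤ q := by exact_mod_cast hq

/-- The `r`-fold mixed differences of `f` in directions `t₁, …, t_r` are bounded by
`L ‖t₁‖ ⋯ ‖t_r‖`. -/
def DiffBound {V : Type*} [NormedAddCommGroup V] : ℕ → ℝ → (V → ℝ) → Prop
  | 0, L, f => ∀ x, |f x| ≤ L
  | r + 1, L, f => ∀ t, DiffBound r (L * ‖t‖) fun x => f (x + t) - f x

/-- Subtracting the Fejér-Korovkin means trades one difference for a factor `2 d / M`. -/
theorem DiffBound.sub_conv {M : ℕ} (hM : 2 ≤ M) {r : ℕ} : ∀ {L : ℝ} {f : (ι → ℝ) → ℝ},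
    Continuous f → DiffBound (r + 1) L f → 0 ≤ L →
    DiffBound r (L * (2 * Fintype.card ι / M)) fun x => f x - conv (korovkinProd M) f x := by
  have hJ := continuous_korovkinProd (ι := ι) M
  induction r with
  | zero =>
    intro L f hf hfd hL x
    have e : f x - conv (korovkinProd M) f x
        = ∫ t, korovkinProd M t * (f x - f (x + t)) ∂cubeMeasure ι := by
      simp only [mul_sub]
      rw [integral_sub (integrable_of_continuous (by fun_prop))
        (integrable_of_continuous (by fun_prop)), integral_mul_const, integral_korovkinProd hM, one_mul]
      rfl
    simp only [e]
    refine abs_integral_le_integral_abs.trans ?_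
    calc ∫ t, |korovkinProd M t * (f x - f (x + t))| ∂cubeMeasure ι
        ≤ ∫ t, L * (korovkinProd M t * ‖t‖) ∂cubeMeasure ι := by
          refine integral_mono (integrable_of_continuous (by fun_prop))
            (integrable_of_continuous (by fun_prop)) fun t => ?_
          simp only
          rw [abs_mul, abs_of_nonneg (korovkinProd_nonneg M t), abs_sub_comm]
          have := mul_le_mul_of_nonneg_left (hfd t x) (korovkinProd_nonneg M t)
          linarith
      _ ≤ _ := by
          rw [integral_const_mul]
          exact mul_le_mul_of_nonneg_left (integral_korovkinProd_mul_norm_le hM) hL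
  | succ r ih =>
    intro L f hf hfd hL s
    have h := ih (L := L * ‖s‖) (f := fun x => f (x + s) - f x) (by fun_prop) (hfd s) (by positivity)
    have e : (fun x => f (x + s) - f x - conv (korovkinProd M) (fun x => f (x + s) - f x) x)
        = fun x => (f (x + s) - conv (korovkinProd M) f (x + s)) - (f x - conv (korovkinProd M) f x) := by
      funext x
      rw [conv_sub hJ (by fun_prop) hf]
      have : conv (korovkinProd M) (fun y => f (y + s)) x = conv (korovkinProd M) f (x + s) := by
        unfold conv
        congr 1
        funext t
        rw [add_right_comm]
      rw [this]
      ring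
    rw [e] at h
    rwa [mul_right_comm] at h

theorem exists_bound_of_isPer {F : (ι → ℝ) → ℝ} (hF : IsPer F) (hc : Continuous F) :
    ∃ B, ∀ x, |F x| ≤ B := by
  obtain ⟨B, hB⟩ := (isCompact_Icc (a := (-1 : ι → ℝ)) (b := 1)).exists_bound_of_continuousOn
    hc.continuousOn
  refine ⟨B, fun x => ?_⟩
  rw [← hF]
  exact hB _ ⟨fun i => (wrap x i).2.1, fun i => (wrap x i).2.2⟩

/-- Direct theorem for the de la Vallée-Poussin means `V`. With `J` the Fejér-Korovkin means, `V J = J`,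
hence `(1 - V) f = (1 - V) (1 - J)^r f`, and each factor `1 - J` turns one difference into a factor
`O(1 / M)`. -/
theorem abs_sub_conv_vpKernel_le {M q r : ℕ} (hM : 2 ≤ M) (hq : Fintype.card ι * M ≤ q)
    (hd : 0 < Fintype.card ι) : ∀ {L : ℝ} {f : (ι → ℝ) → ℝ}, Continuous f → IsPer f →
    DiffBound r L f → 0 ≤ L → ∀ x, |f x - conv (vpKernel (2 * q)) f x|
      ≤ (1 + lebesgueConst (Fintype.card ι)) * (L * (2 * Fintype.card ι / M) ^ r) := by
  have hq0 : 0 < q := lt_of_lt_of_le (Nat.mul_pos hd (by omega)) hq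
  induction r with
  | zero =>
    intro L f hf hper hfd hL x
    rw [pow_zero, mul_one]
    have h := abs_conv_le (continuous_vpKernel (2 * q)) (integral_abs_vpKernel_le hd hq0) hfd x
    have h2 := hfd x
    calc _ ≤ |f x| + |conv (vpKernel (2 * q)) f x| := abs_sub _ _
      _ ≤ _ := by linarith
  | succ r ih =>
    intro L f hf hper hfd hL x
    have hJ := continuous_korovkinProd (ι := ι) M
    have hJf := continuous_conv hJ hf
    have hJp : IsPer (conv (korovkinProd M) f) := isPer_conv hper
    obtain ⟨B, hB⟩ := exists_bound_of_isPer hper hf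
    have hmem := conv_korovkinProd_mem hq hper hf.measurable hB
    have h := ih (L := L * (2 * Fintype.card ι / M))
      (f := fun x => f x - conv (korovkinProd M) f x) (hf.sub hJf)
      (fun y => by
        have h1 := hper y
        have h2 := hJp y
        simp only [h1, h2]) (hfd.sub_conv hM hf hL) (by positivity) x
    rw [conv_sub (continuous_vpKernel _) hf hJf, conv_vpKernel_of_mem hmem] at h
    rw [sub_sub_sub_cancel_right] at h
    refine h.trans (le_of_eq ?_)
    ring

end Jackson

/-! ### Difference bounds for functions with bounded weak derivatives -/

section Smooth

open Filter Topology

variable {ι : Type} [Fintype ι] [DecidableEq ι]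

/-- A real Lipschitz function with derivative almost everywhere bounded by `B`: along almost every line
in a given direction it is absolutely continuous with derivative bounded by `B` almost everywhere. -/
theorem abs_add_sub_le_of_ae_fderiv_le {C : ℝ≥0} {g : (ι → ℝ) → ℝ} (hg : LipschitzWith C g) {B : ℝ}
    (hB : ∀ᵐ x, DifferentiableAt ℝ g x ∧ ‖fderiv ℝ g x‖ ≤ B) (x v : ι → ℝ) :
    |g (x + v) - g x| ≤ B * ‖v‖ := by
  set s : Set (ι → ℝ) := {x | DifferentiableAt ℝ g x ∧ ‖fderiv ℝ g x‖ ≤ B} with hs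
  have hsm : MeasurableSet s := (measurableSet_of_differentiableAt ℝ g).inter
    (measurableSet_le (measurable_fderiv ℝ g).norm measurable_const)
  let L : ℝ →ₗ[ℝ] (ι → ℝ) := LinearMap.toSpanSingleton ℝ (ι → ℝ) v
  have h1 : ∀ᵐ y : ι → ℝ, ∀ᵐ t : ℝ, y + L t ∈ s :=
    (ae_ae_add_linearMap_mem_iff L volume volume hsm).2 hB
  have h2 : ∀ᵐ y : ι → ℝ, |g (y + v) - g y| ≤ B * ‖v‖ := by
    filter_upwards [h1] with y hy
    have hlip : LipschitzWith (C * ‖v‖₊) fun t : ℝ => g (y + t • v) := by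
      refine hg.comp (LipschitzWith.of_dist_le_mul fun t t' => ?_)
      rw [dist_add_left, dist_eq_norm, ← sub_smul, norm_smul, mul_comm, dist_eq_norm]
      rfl
    have hac := (hlip.lipschitzOnWith (s := Set.uIcc 0 1)).absolutelyContinuousOnInterval
    have hint := hac.integral_deriv_eq_sub
    simp only [one_smul, zero_smul, add_zero] at hint
    rw [← hint]
    have hae : ∀ᵐ t : ℝ, t ∈ Set.uIoc (0 : ℝ) 1 → ‖deriv (fun t : ℝ => g (y + t • v)) t‖ ≤ B * ‖v‖ := by
      filter_upwards [hy] with t ht _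
      have ht' : y + t • v ∈ s := ht
      have hd : HasDerivAt (fun t : ℝ => y + t • v) v t := by
        simpa using ((hasDerivAt_id t).smul_const v).const_add y
      have := (ht'.1.hasFDerivAt.comp_hasDerivAt t hd).deriv
      change deriv (g ∘ fun t : ℝ => y + t • v) t = _ at this
      change ‖deriv (g ∘ fun t : ℝ => y + t • v) t‖ ≤ _
      rw [this]
      exact ((fderiv ℝ g _).le_opNorm v).trans (mul_le_mul_of_nonneg_right ht'.2 (norm_nonneg _))
    have := intervalIntegral.norm_integral_le_of_norm_le_const_ae hae
    simpa using this
  -- The bound holds for almost every base point, hence for all of them by continuity.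
  have hcl : IsClosed {y : ι → ℝ | |g (y + v) - g y| ≤ B * ‖v‖} := by
    have := hg.continuous
    exact isClosed_le (by fun_prop) continuous_const
  have hd : Dense {y : ι → ℝ | |g (y + v) - g y| ≤ B * ‖v‖} := Measure.dense_of_ae h2
  have : {y : ι → ℝ | |g (y + v) - g y| ≤ B * ‖v‖} = Set.univ := by
    rw [← hcl.closure_eq]; exact hd.closure_eq
  exact (this ▸ Set.mem_univ x : x ∈ {y : ι → ℝ | |g (y + v) - g y| ≤ B * ‖v‖})

/-- The vector-valued version, by duality. -/
theorem norm_add_sub_le_of_ae_fderiv_le {F : Type*} [NormedAddCommGroup F] [NormedSpace ℝ F]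
    [FiniteDimensional ℝ F] {C : ℝ≥0} {f : (ι → ℝ) → F} (hf : LipschitzWith C f) {B : ℝ}
    (hB : ∀ᵐ x, ‖fderiv ℝ f x‖ ≤ B) (x v : ι → ℝ) : ‖f (x + v) - f x‖ ≤ B * ‖v‖ := by
  obtain ⟨φ, hφ, hφv⟩ := exists_dual_vector'' ℝ (f (x + v) - f x)
  have hl : LipschitzWith (‖φ‖₊ * C) fun y => φ (f y) := φ.lipschitz.comp hf
  have hae : ∀ᵐ y, DifferentiableAt ℝ (fun y => φ (f y)) y ∧ ‖fderiv ℝ (fun y => φ (f y)) y‖ ≤ B := by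
    filter_upwards [hf.ae_differentiableAt, hB] with y hy hyB
    refine ⟨φ.differentiableAt.comp y hy, ?_⟩
    have : fderiv ℝ (fun y => φ (f y)) y = φ.comp (fderiv ℝ f y) :=
      (φ.hasFDerivAt.comp y hy.hasFDerivAt).fderiv
    rw [this]
    refine (φ.opNorm_comp_le _).trans ?_
    calc ‖φ‖ * ‖fderiv ℝ f y‖ ≤ 1 * B :=
          mul_le_mul hφ hyB (norm_nonneg _) zero_le_one
      _ = B := one_mul B
  have := abs_add_sub_le_of_ae_fderiv_le hl hae x v
  rw [← map_sub, hφv] at this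
  simpa using this

/-- A function whose derivative of order `ν` is Lipschitz has bounded differences of order `ν + 1`: each
first difference lowers the order by one. -/
theorem diffBound_of_iteratedFDeriv {V : Type*} [NormedAddCommGroup V] [NormedSpace ℝ V] (ν : ℕ) :
    ∀ {L : ℝ} {f : V → ℝ}, ContDiff ℝ ν f →
    (∀ x v, ‖iteratedFDeriv ℝ ν f (x + v) - iteratedFDeriv ℝ ν f x‖ ≤ L * ‖v‖) →
    DiffBound (ν + 1) L f := by
  induction ν with
  | zero =>
    intro L f _ h t x
    have := h x t
    rwa [iteratedFDeriv_zero_eq_comp, Function.comp, Function.comp, ← map_sub,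
      LinearIsometryEquiv.norm_map] at this
  | succ ν ih =>
    intro L f hf h t
    have hf1 : ContDiff ℝ ν f := hf.of_le (by exact_mod_cast Nat.le_succ ν)
    have hshift : ContDiff ℝ (ν + 1 : ℕ) fun x => f (x + t) := hf.comp (contDiff_id.add contDiff_const)
    have hshift1 : ContDiff ℝ ν fun x => f (x + t) := hshift.of_le (by exact_mod_cast Nat.le_succ ν)
    refine ih (hshift1.sub hf1) fun x v => ?_
    have hg : ContDiff ℝ (ν + 1 : ℕ) fun x => f (x + t) - f x := hshift.sub hf
    have hdiff : Differentiable ℝ (iteratedFDeriv ℝ ν fun x => f (x + t) - f x) :=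
      hg.differentiable_iteratedFDeriv (by exact_mod_cast Nat.lt_succ_self ν)
    -- The derivative of order `ν + 1` of the difference is a difference of derivatives.
    have hb : ∀ y, ‖fderiv ℝ (iteratedFDeriv ℝ ν fun x => f (x + t) - f x) y‖ ≤ L * ‖t‖ := by
      intro y
      rw [norm_fderiv_iteratedFDeriv]
      have e : iteratedFDeriv ℝ (ν + 1) (fun x => f (x + t) - f x) y
          = iteratedFDeriv ℝ (ν + 1) f (y + t) - iteratedFDeriv ℝ (ν + 1) f y := by
        have h2 := iteratedFDeriv_sub_apply (𝕜 := ℝ) (i := ν + 1) (x := y)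
          hshift.contDiffAt hf.contDiffAt
        rw [iteratedFDeriv_comp_add_right] at h2
        exact h2
      rw [e]
      exact h y t
    have := Convex.norm_image_sub_le_of_norm_fderiv_le (𝕜 := ℝ) (s := Set.univ)
      (fun y _ => hdiff y) (fun y _ => hb y) convex_univ (Set.mem_univ x) (Set.mem_univ (x + v))
    simpa using this

/-- The operator norm for the sup norm on `ℝ^ι` in terms of the values on basis vectors, that is, of the
partial derivatives when `T` is an iterated derivative. -/
theorem norm_multilinear_le {k : ℕ}
    (T : ContinuousMultilinearMap ℝ (fun _ : Fin k => ι → ℝ) ℝ) {B : ℝ}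
    (hB : ∀ i : Fin k → ι, |T fun j => Pi.single (i j) 1| ≤ B) (hB0 : 0 ≤ B) :
    ‖T‖ ≤ (Fintype.card ι : ℝ) ^ k * B := by
  refine T.opNorm_le_bound (by positivity) fun m => ?_
  have e : T m = ∑ i : Fin k → ι, (∏ j, m j (i j)) * T fun j => Pi.single (i j) 1 := by
    have h1 : m = fun j => ∑ i : ι, m j i • (Pi.single i 1 : ι → ℝ) := by
      funext j
      refine (pi_eq_sum_univ' (m j)).trans (Finset.sum_congr rfl fun i _ => ?_)
      congr 1
    conv_lhs => rw [h1]
    have h2 := T.toMultilinearMap.map_sum (fun (j : Fin k) (i : ι) => m j i • (Pi.single i 1 : ι → ℝ))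
    have h3 : ∀ i : Fin k → ι, T (fun j => m j (i j) • (Pi.single (i j) 1 : ι → ℝ))
        = (∏ j, m j (i j)) * T fun j => Pi.single (i j) 1 := fun i =>
      T.toMultilinearMap.map_smul_univ (fun j => m j (i j)) fun j => Pi.single (i j) 1
    refine Eq.trans h2 (Finset.sum_congr rfl fun i _ => h3 i)
  rw [e]
  refine (norm_sum_le _ _).trans ?_
  calc ∑ i : Fin k → ι, ‖(∏ j, m j (i j)) * T fun j => Pi.single (i j) 1‖
      ≤ ∑ _i : Fin k → ι, (∏ j, ‖m j‖) * B := by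
        refine Finset.sum_le_sum fun i _ => ?_
        rw [norm_mul, norm_prod]
        exact mul_le_mul (Finset.prod_le_prod (fun j _ => norm_nonneg _) fun j _ => norm_le_pi_norm _ _)
          (hB i) (norm_nonneg _) (Finset.prod_nonneg fun j _ => norm_nonneg _)
    _ = _ := by
        simp
        ring

theorem finiteDimensional_multilinear (k : ℕ) :
    FiniteDimensional ℝ (ContinuousMultilinearMap ℝ (fun _ : Fin k => ι → ℝ) ℝ) :=
  FiniteDimensional.of_injective
    (ContinuousMultilinearMap.toMultilinearMapLinear :
      ContinuousMultilinearMap ℝ (fun _ : Fin k => ι → ℝ) ℝ →ₗ[ℝ] _)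
    ContinuousMultilinearMap.toMultilinearMap_injective

theorem periodize_add_int (f : Cube ι → ℝ) (x : ι → ℝ) (n : ι → ℤ) :
    periodize f (x + fun i => 2 * (n i : ℝ)) = periodize f x := by
  unfold periodize
  congr 1
  funext i
  exact wrapCoord_add_int (x i) (n i)

/-- A periodic property that holds almost everywhere on the cube holds almost everywhere. -/
theorem ae_of_ae_cube {P : (ι → ℝ) → Prop} (hP : ∀ᵐ x ∂cubeMeasure ι, P x)
    (hper : ∀ x (n : ι → ℤ), P (x + fun i => 2 * (n i : ℝ)) → P x) : ∀ᵐ x, P x := by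
  have h1 : ∀ᵐ x : ι → ℝ, x ∈ Set.Icc (-1 : ι → ℝ) 1 → P x := by
    rwa [cubeMeasure, ae_restrict_iff' measurableSet_Icc] at hP
  have h2 : ∀ n : ι → ℤ, ∀ᵐ x : ι → ℝ, (x + fun i => 2 * (n i : ℝ)) ∈ Set.Icc (-1 : ι → ℝ) 1 →
      P (x + fun i => 2 * (n i : ℝ)) := fun n =>
    (measurePreserving_add_right volume (fun i => 2 * (n i : ℝ))).quasiMeasurePreserving.ae h1
  filter_upwards [ae_all_iff.2 h2] with x hx
  have e : x + (fun i => 2 * ((-⌊(x i + 1) / 2⌋ : ℤ) : ℝ)) = toVec (wrap x) := by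
    funext i
    exact (coe_wrapCoord (x i)).symm
  refine hper x (fun i => -⌊(x i + 1) / 2⌋) (hx _ ?_)
  rw [e]
  exact ⟨fun i => (wrap x i).2.1, fun i => (wrap x i).2.2⟩

/-- A function of `C_p^{ν,1}` satisfies a difference bound of order `ν + 1`. -/
theorem diffBound_periodize {ν : ℕ} {f : Cube ι → ℝ} (hf : MemCp ν f) {B : ℝ≥0}
    (hB : cpNorm ν f ≤ B) :
    DiffBound (ν + 1) ((Fintype.card ι : ℝ) ^ (ν + 1) * B) (periodize f) := by
  obtain ⟨C, hC⟩ := hf.lipschitz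
  have := finiteDimensional_multilinear (ι := ι) ν
  refine diffBound_of_iteratedFDeriv ν hf.contDiff
    (norm_add_sub_le_of_ae_fderiv_le hC ?_)
  refine ae_of_ae_cube ?_ ?_
  · have h1 : ∀ i : Fin (ν + 1) → ι, ∀ᵐ x ∂cubeMeasure ι,
        |iteratedFDeriv ℝ (ν + 1) (periodize f) x fun j => Pi.single (i j) 1| ≤ B := by
      intro i
      have h2 : eLpNorm (fun x => iteratedFDeriv ℝ (ν + 1) (periodize f) x
          (fun j => Pi.single (i j) 1)) ∞ (cubeMeasure ι) ≤ B := by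
        refine le_trans ?_ hB
        unfold cpNorm
        refine le_iSup₂_of_le (ν + 1) le_rfl (le_iSup_of_le i ?_)
        exact le_rfl
      rw [eLpNorm_exponent_top] at h2
      filter_upwards [enorm_ae_le_eLpNormEssSup (fun x => iteratedFDeriv ℝ (ν + 1) (periodize f) x
          (fun j => Pi.single (i j) 1)) (cubeMeasure ι)] with x hx
      have h3 := hx.trans h2
      rw [enorm_le_coe] at h3
      exact_mod_cast h3
    filter_upwards [ae_all_iff.2 h1] with x hx
    rw [norm_fderiv_iteratedFDeriv]
    exact norm_multilinear_le _ hx B.2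
  · intro x n h
    rw [norm_fderiv_iteratedFDeriv] at h ⊢
    rw [← iteratedFDeriv_comp_add_right] at h
    simpa only [periodize_add_int] using h

end Smooth

/-! ### Value functions -/

section Values

open Filter Topology

variable {dS dA : ℕ}

instance (M : MDP dS dA) (h : ℕ) : IsMarkovKernel (M.p h) := M.markov h

theorem measurable_pair :
    Measurable fun x : Cube (Fin dS) × Cube (Fin dA) => pair x.1 x.2 := by
  refine measurable_pi_lambda _ fun i => ?_
  rcases i with i | i
  · exact (measurable_pi_apply i).comp measurable_fst
  · exact (measurable_pi_apply i).comp measurable_snd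

theorem continuous_pair :
    Continuous fun x : Cube (Fin dS) × Cube (Fin dA) => pair x.1 x.2 := by
  refine continuous_pi fun i => ?_
  rcases i with i | i
  · exact (continuous_apply i).comp continuous_fst
  · exact (continuous_apply i).comp continuous_snd

theorem integrable_of_abs_le {α : Type*} [MeasurableSpace α] {μ : Measure α} [IsFiniteMeasure μ]
    {f : α → ℝ} (hf : Measurable f) {B : ℝ} (hB : ∀ x, |f x| ≤ B) : Integrable f μ :=
  Integrable.of_bound hf.aestronglyMeasurable B (Eventually.of_forall hB)

theorem abs_integral_le_of_abs_le {α : Type*} [MeasurableSpace α] {μ : Measure α}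
    [IsProbabilityMeasure μ] {f : α → ℝ} {B : ℝ} (hB : ∀ x, |f x| ≤ B) : |∫ x, f x ∂μ| ≤ B := by
  have := norm_integral_le_of_norm_le_const (μ := μ) (f := f) (Eventually.of_forall hB)
  simpa using this

theorem bddAbove_range_pair {f : Cube (Idx dS dA) → ℝ} {B : ℝ} (hB : ∀ z, |f z| ≤ B)
    (s : Cube (Fin dS)) : BddAbove (Set.range fun a : Cube (Fin dA) => f (pair s a)) :=
  ⟨B, by rintro _ ⟨a, rfl⟩; exact (abs_le.1 (hB _)).2⟩

instance : Nonempty (Cube (Fin dA)) := ⟨fun _ => ⟨0, by norm_num⟩⟩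

theorem continuous_iSup_pair {f : Cube (Idx dS dA) → ℝ} (hf : Continuous f) :
    Continuous fun s : Cube (Fin dS) => ⨆ a : Cube (Fin dA), f (pair s a) := by
  have := (isCompact_univ : IsCompact (Set.univ : Set (Cube (Fin dA)))).continuous_sSup
    (f := fun (s : Cube (Fin dS)) a => f (pair s a)) (hf.comp continuous_pair)
  simp only [Set.image_univ] at this
  exact this

theorem abs_iSup_pair_sub_le {f g : Cube (Idx dS dA) → ℝ} {B η : ℝ} (hf : ∀ z, |f z| ≤ B)
    (hg : ∀ z, |g z| ≤ B) (h : ∀ z, |f z - g z| ≤ η) (s : Cube (Fin dS)) :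
    |(⨆ a : Cube (Fin dA), f (pair s a)) - ⨆ a : Cube (Fin dA), g (pair s a)| ≤ η := by
  rw [abs_sub_le_iff]
  constructor
  · rw [sub_le_iff_le_add]
    refine ciSup_le fun a => ?_
    have h1 := le_ciSup (bddAbove_range_pair hg s) a
    have h2 := (abs_le.1 (h (pair s a))).2
    linarith
  · rw [sub_le_iff_le_add]
    refine ciSup_le fun a => ?_
    have h1 := le_ciSup (bddAbove_range_pair hf s) a
    have h2 := (abs_le.1 (h (pair s a))).1
    linarith

theorem abs_iSup_pair_le {f : Cube (Idx dS dA) → ℝ} {B : ℝ} (hf : ∀ z, |f z| ≤ B)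
    (s : Cube (Fin dS)) : |⨆ a : Cube (Fin dA), f (pair s a)| ≤ B := by
  obtain ⟨a⟩ := (inferInstance : Nonempty (Cube (Fin dA)))
  refine abs_le.2 ⟨?_, ciSup_le fun a => (abs_le.1 (hf _)).2⟩
  exact (abs_le.1 (hf (pair s a))).1.trans (le_ciSup (bddAbove_range_pair hf s) a)

theorem MemCp.continuous {ι : Type} [Fintype ι] {ν : ℕ} {f : Cube ι → ℝ} (hf : MemCp ν f) :
    Continuous f := by
  have h : f = fun z => periodize f (toVec z) := funext fun z => (hf.boundary z).symm
  rw [h]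
  exact hf.contDiff.continuous.comp
    (continuous_pi fun i => continuous_subtype_val.comp (continuous_apply i))

theorem exists_bound_cube {ι : Type} [Fintype ι] {f : Cube ι → ℝ} (hf : Continuous f) :
    ∃ B, ∀ z, |f z| ≤ B := by
  obtain ⟨B, hB⟩ := (isCompact_univ (X := Cube ι)).exists_bound_of_continuousOn hf.continuousOn
  exact ⟨B, fun z => hB z trivial⟩

theorem MDP.optQ_of_le (M : MDP dS dA) {H h : ℕ} (hh : h ≤ H) :
    M.optQ H h = M.bellman h (M.optQ H (h + 1)) := by
  rw [MDP.optQ, if_pos hh]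

theorem MDP.optQ_of_gt (M : MDP dS dA) {H h : ℕ} (hh : H < h) : M.optQ H h = fun _ => 0 := by
  rw [MDP.optQ, if_neg (by omega)]

theorem memCp_zero {ι : Type} [Fintype ι] (ν : ℕ) : MemCp ν (fun _ : Cube ι => (0 : ℝ)) := by
  have h : periodize (fun _ : Cube ι => (0 : ℝ)) = fun _ => 0 := rfl
  refine ⟨fun _ => rfl, ?_, 0, ?_⟩
  · rw [h]; exact contDiff_const
  · rw [h, iteratedFDeriv_fun_zero]
    exact LipschitzWith.const 0

theorem cpNorm_zero {ι : Type} [Fintype ι] [DecidableEq ι] (ν : ℕ) :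
    cpNorm ν (fun _ : Cube ι => (0 : ℝ)) = 0 := by
  have h : periodize (fun _ : Cube ι => (0 : ℝ)) = fun _ => 0 := rfl
  simp only [cpNorm, h, iteratedFDeriv_fun_zero]
  refine le_antisymm (iSup₂_le fun k _ => iSup_le fun i => le_of_eq ?_) bot_le
  exact eLpNorm_zero

/-- The optimal state-action value functions are smooth, with a norm bound depending only on the
horizon and the smoothness constant. -/
theorem MDP.IsSmooth.optQ {M : MDP dS dA} {H ν : ℕ} {C : ℝ≥0} (hM : M.IsSmooth H ν C) (k : ℕ) :
    ∀ h, 1 ≤ h → h + k = H + 1 →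
      MemCp ν (M.optQ H h) ∧ cpNorm ν (M.optQ H h) + 1 ≤ ((C + 1) ^ k : ℝ≥0) := by
  induction k with
  | zero =>
    intro h _ hk
    rw [M.optQ_of_gt (by omega)]
    exact ⟨memCp_zero ν, by rw [cpNorm_zero]; simp⟩
  | succ k ih =>
    intro h h1 hk
    obtain ⟨i1, i2⟩ := ih (h + 1) (by omega) (by omega)
    rw [M.optQ_of_le (by omega)]
    obtain ⟨j1, j2⟩ := hM h (Finset.mem_Icc.2 ⟨h1, by omega⟩) _ i1
    refine ⟨j1, (add_le_add_left j2 1).trans ?_⟩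
    calc (C : ℝ≥0∞) * (cpNorm ν (M.optQ H (h + 1)) + 1) + 1
        ≤ C * ((C + 1) ^ k : ℝ≥0) + ((C + 1) ^ k : ℝ≥0) := by
          refine add_le_add (mul_le_mul_right i2 _) ?_
          exact_mod_cast one_le_pow₀ (le_add_self : (1 : ℝ≥0) ≤ C + 1)
      _ = ((C + 1) ^ (k + 1) : ℝ≥0) := by push_cast; ring

theorem MDP.IsSmooth.memCp_optQ {M : MDP dS dA} {H ν : ℕ} {C : ℝ≥0} (hM : M.IsSmooth H ν C)
    {h : ℕ} (h1 : 1 ≤ h) : MemCp ν (M.optQ H h) := by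
  by_cases hh : h ≤ H + 1
  · exact (hM.optQ (H + 1 - h) h h1 (by omega)).1
  · rw [M.optQ_of_gt (by omega)]; exact memCp_zero ν

theorem MDP.IsSmooth.cpNorm_optQ_le {M : MDP dS dA} {H ν : ℕ} {C : ℝ≥0} (hM : M.IsSmooth H ν C)
    {h : ℕ} (h1 : 1 ≤ h) : cpNorm ν (M.optQ H h) ≤ ((C + 1) ^ H : ℝ≥0) := by
  by_cases hh : h ≤ H + 1
  · refine le_trans (le_trans le_self_add (hM.optQ (H + 1 - h) h h1 (by omega)).2) ?_
    exact_mod_cast pow_le_pow_right₀ (le_add_self : (1 : ℝ≥0) ≤ C + 1) (by omega)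
  · rw [M.optQ_of_gt (by omega), cpNorm_zero]; exact bot_le

theorem MDP.bellman_mem (M : MDP dS dA) (h : ℕ) {f : Cube (Idx dS dA) → ℝ} {B : ℝ}
    (hf0 : ∀ z, 0 ≤ f z) (hfB : ∀ z, f z ≤ B) (z : Cube (Idx dS dA)) :
    M.bellman h f z ∈ Set.Icc 0 (1 + B) := by
  have hB : ∀ z, |f z| ≤ B := fun z => abs_le.2 ⟨by linarith [hf0 z, hfB z], hfB z⟩
  have h1 := M.R_mem h z
  have hs0 : ∀ s : Cube (Fin dS), 0 ≤ ⨆ a : Cube (Fin dA), f (pair s a) := fun s =>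
    Real.iSup_nonneg fun a => hf0 _
  constructor
  · exact add_nonneg h1.1 (integral_nonneg hs0)
  · exact add_le_add h1.2 (le_of_abs_le (abs_integral_le_of_abs_le fun s => abs_iSup_pair_le hB s))

/-- The optimal values lie between `0` and the horizon. -/
theorem MDP.optQ_bounds (M : MDP dS dA) {H : ℕ} (k : ℕ) :
    ∀ h, h + k = H + 1 → ∀ z, M.optQ H h z ∈ Set.Icc (0 : ℝ) k := by
  induction k with
  | zero => intro h hk z; rw [M.optQ_of_gt (by omega)]; simp
  | succ k ih =>
    intro h hk z
    rw [M.optQ_of_le (by omega)]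
    have i := ih (h + 1) (by omega)
    have := M.bellman_mem h (fun z => (i z).1) (fun z => (i z).2) z
    push_cast
    rwa [add_comm]

theorem MDP.abs_optQ_le (M : MDP dS dA) {H h : ℕ} (h1 : 1 ≤ h) (z : Cube (Idx dS dA)) :
    |M.optQ H h z| ≤ H := by
  by_cases hh : h ≤ H + 1
  · have := M.optQ_bounds (H := H) (H + 1 - h) h (by omega) z
    rw [abs_of_nonneg this.1]
    refine this.2.trans ?_
    have h2 : H + 1 - h ≤ H := by omega
    exact_mod_cast h2
  · rw [M.optQ_of_gt (by omega)]; simp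

section Policy

variable (M : MDP dS dA) (π : ℕ → Kernel (Cube (Fin dS)) (Cube (Fin dA)))

/-- The one-step transition kernel on state-action pairs under the policy `π`. -/
noncomputable def MDP.stepKernel (h : ℕ) : Kernel (Cube (Idx dS dA)) (Cube (Idx dS dA)) :=
  ((M.p h) ⊗ₖ (Kernel.prodMkLeft (Cube (Idx dS dA)) (π (h + 1)))).map fun x => pair x.1 x.2

/-- The `j`-step transition kernel from stage `h`. -/
noncomputable def MDP.lawKernel (h : ℕ) : ℕ → Kernel (Cube (Idx dS dA)) (Cube (Idx dS dA))
  | 0 => Kernel.id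
  | j + 1 => M.stepKernel π (h + j) ∘ₖ MDP.lawKernel h j

variable [hπ : ∀ h, IsMarkovKernel (π h)]

instance (h : ℕ) : IsMarkovKernel (M.stepKernel π h) := by
  unfold MDP.stepKernel
  exact Kernel.IsMarkovKernel.map _ measurable_pair

instance (h j : ℕ) : IsMarkovKernel (M.lawKernel π h j) := by
  induction j with
  | zero => unfold MDP.lawKernel; infer_instance
  | succ j ih => unfold MDP.lawKernel; infer_instance

theorem MDP.stepKernel_apply (h : ℕ) (z : Cube (Idx dS dA)) :
    M.stepKernel π h z = ((M.p h z) ⊗ₘ (π (h + 1))).map fun x => pair x.1 x.2 := by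
  rw [MDP.stepKernel, Kernel.map_apply _ measurable_pair]
  congr 1
  ext s hs
  rw [Kernel.compProd_apply hs, Measure.compProd_apply hs]
  rfl

theorem MDP.pairLaw_eq (h j : ℕ) (z : Cube (Idx dS dA)) :
    M.pairLaw π h z j = M.lawKernel π h j z := by
  induction j with
  | zero => rw [MDP.pairLaw, MDP.lawKernel, Kernel.id_apply]
  | succ j ih =>
    rw [MDP.pairLaw, MDP.lawKernel, Kernel.comp_apply, ih]
    congr 1
    funext z'
    rw [MDP.stepKernel_apply]

theorem MDP.lawKernel_succ (j : ℕ) : ∀ h,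
    M.lawKernel π h (j + 1) = M.lawKernel π (h + 1) j ∘ₖ M.stepKernel π h := by
  induction j with
  | zero =>
    intro h
    simp only [MDP.lawKernel, add_zero, Kernel.comp_id, Kernel.id_comp]
  | succ j ih =>
    intro h
    rw [MDP.lawKernel, ih h, MDP.lawKernel, Kernel.comp_assoc, add_right_comm, ← add_assoc]

theorem MDP.abs_R_le (h : ℕ) (z : Cube (Idx dS dA)) : |M.R h z| ≤ 1 :=
  abs_le.2 ⟨by linarith [(M.R_mem h z).1], (M.R_mem h z).2⟩

theorem MDP.measurable_polQ (H h : ℕ) : Measurable (M.polQ H π h) := by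
  unfold MDP.polQ
  simp only [M.pairLaw_eq π]
  refine Finset.measurable_sum _ fun l _ => ?_
  exact ((M.measurable_R l).stronglyMeasurable.integral_kernel).measurable

theorem MDP.abs_polQ_le (H h : ℕ) (z : Cube (Idx dS dA)) : |M.polQ H π h z| ≤ H + 1 := by
  unfold MDP.polQ
  simp only [M.pairLaw_eq π]
  refine (Finset.abs_sum_le_sum_abs _ _).trans ?_
  refine (Finset.sum_le_sum fun l _ => abs_integral_le_of_abs_le (M.abs_R_le l)).trans ?_
  simp only [Finset.sum_const, Nat.card_Icc, nsmul_eq_mul, mul_one]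
  exact_mod_cast Nat.sub_le _ _

theorem MDP.measurable_polV (H h : ℕ) : Measurable (M.polV H π h) := by
  unfold MDP.polV
  have : StronglyMeasurable fun x : Cube (Fin dS) × Cube (Fin dA) => M.polQ H π h (pair x.1 x.2) :=
    ((M.measurable_polQ π H h).comp measurable_pair).stronglyMeasurable
  exact (this.integral_kernel_prod_right').measurable

theorem MDP.abs_polV_le (H h : ℕ) (s : Cube (Fin dS)) : |M.polV H π h s| ≤ H + 1 :=
  abs_integral_le_of_abs_le fun _ => M.abs_polQ_le π H h _

theorem MDP.polQ_of_gt {H h : ℕ} (hh : H < h) (z : Cube (Idx dS dA)) : M.polQ H π h z = 0 := by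
  rw [MDP.polQ, Finset.Icc_eq_empty (by omega), Finset.sum_empty]

/-- The Bellman equation for the value of a policy. -/
theorem MDP.polQ_eq {H h : ℕ} (hh : h ≤ H) (z : Cube (Idx dS dA)) :
    M.polQ H π h z = M.R h z + ∫ s', M.polV H π (h + 1) s' ∂(M.p h z) := by
  have hIcc : Finset.Icc h H = insert h (Finset.Icc (h + 1) H) := by
    ext l; simp only [Finset.mem_Icc, Finset.mem_insert]; omega
  have h1 : M.polQ H π h z = M.R h z + ∫ z', M.polQ H π (h + 1) z' ∂(M.stepKernel π h z) := by
    rw [MDP.polQ, hIcc, Finset.sum_insert (by simp)]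
    congr 1
    · rw [Nat.sub_self, MDP.pairLaw, integral_dirac' _ _ (M.measurable_R h).stronglyMeasurable]
    · simp only [MDP.polQ]
      rw [integral_finsetSum]
      · refine Finset.sum_congr rfl fun l hl => ?_
        rw [Finset.mem_Icc] at hl
        simp only [M.pairLaw_eq π]
        rw [show l - h = (l - (h + 1)) + 1 by omega, M.lawKernel_succ π, Kernel.integral_comp]
        exact integrable_of_abs_le (M.measurable_R l) (M.abs_R_le l)
      · intro l _
        simp only [M.pairLaw_eq π]
        exact integrable_of_abs_le ((M.measurable_R l).stronglyMeasurable.integral_kernel).measurable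
          fun z => abs_integral_le_of_abs_le (M.abs_R_le l)
  rw [h1, M.stepKernel_apply π, integral_map measurable_pair.aemeasurable
    (M.measurable_polQ π H (h + 1)).aestronglyMeasurable, Measure.integral_compProd]
  · rfl
  · exact integrable_of_abs_le ((M.measurable_polQ π H (h + 1)).comp measurable_pair)
      fun x => M.abs_polQ_le π H (h + 1) _

theorem MDP.abs_optV_le {H h : ℕ} (h1 : 1 ≤ h) (s : Cube (Fin dS)) : |M.optV H h s| ≤ H :=
  abs_iSup_pair_le (M.abs_optQ_le h1) s

theorem MDP.optQ_le_optV {H h : ℕ} (h1 : 1 ≤ h) (s : Cube (Fin dS)) (a : Cube (Fin dA)) :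
    M.optQ H h (pair s a) ≤ M.optV H h s :=
  le_ciSup (bddAbove_range_pair (M.abs_optQ_le h1) s) a

theorem MDP.optQ_eq {H h : ℕ} (hh : h ≤ H)
    (z : Cube (Idx dS dA)) : M.optQ H h z = M.R h z + ∫ s', M.optV H (h + 1) s' ∂(M.p h z) := by
  rw [M.optQ_of_le hh]; rfl

variable {M}

theorem MDP.IsSmooth.continuous_optV {H ν : ℕ} {C : ℝ≥0} (hM : M.IsSmooth H ν C)
    {h : ℕ} (h1 : 1 ≤ h) : Continuous (M.optV H h) :=
  continuous_iSup_pair (hM.memCp_optQ h1).continuous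

/-- No policy exceeds the optimal value. -/
theorem MDP.IsSmooth.polQ_le_optQ {H ν : ℕ} {C : ℝ≥0} (hM : M.IsSmooth H ν C) (k : ℕ) :
    ∀ h, 1 ≤ h → h + k = H + 1 →
      (∀ z, M.polQ H π h z ≤ M.optQ H h z) ∧ ∀ s, M.polV H π h s ≤ M.optV H h s := by
  have hV : ∀ h, 1 ≤ h → (∀ z, M.polQ H π h z ≤ M.optQ H h z) → ∀ s, M.polV H π h s ≤ M.optV H h s := by
    intro h h1 hQ s
    have hi : Integrable (fun a => M.polQ H π h (pair s a)) (π h s) :=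
      integrable_of_abs_le ((M.measurable_polQ π H h).comp
        (measurable_pair.comp (measurable_const.prodMk measurable_id))) fun a => M.abs_polQ_le π H h _
    calc M.polV H π h s ≤ ∫ _a, M.optV H h s ∂(π h s) :=
          integral_mono hi (integrable_const _) fun a => (hQ _).trans (M.optQ_le_optV h1 s a)
      _ = M.optV H h s := by simp
  induction k with
  | zero =>
    intro h h1 hk
    have hQ : ∀ z, M.polQ H π h z ≤ M.optQ H h z := fun z => by
      rw [M.polQ_of_gt π (by omega), M.optQ_of_gt (by omega)]
    exact ⟨hQ, hV h h1 hQ⟩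
  | succ k ih =>
    intro h h1 hk
    have hQ : ∀ z, M.polQ H π h z ≤ M.optQ H h z := fun z => by
      rw [M.polQ_eq π (by omega), M.optQ_eq (by omega)]
      refine add_le_add le_rfl (integral_mono ?_ ?_ (ih (h + 1) (by omega) (by omega)).2)
      · exact integrable_of_abs_le (M.measurable_polV π H (h + 1)) (M.abs_polV_le π H (h + 1))
      · exact integrable_of_abs_le (hM.continuous_optV (by omega)).measurable
          (M.abs_optV_le (by omega))
    exact ⟨hQ, hV h h1 hQ⟩

/-- The loss of a policy that is greedy with respect to uniform approximations of the optimal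
state-action values. -/
theorem MDP.IsSmooth.optV_sub_polV_le {H ν : ℕ} {C : ℝ≥0} (hM : M.IsSmooth H ν C) {η : ℝ}
    (Q : ℕ → Cube (Idx dS dA) → ℝ)
    (hQ : ∀ h ∈ Finset.Icc 1 H, ∀ z, |Q h z - M.optQ H h z| ≤ η)
    (hg : ∀ h ∈ Finset.Icc 1 H, ∃ (g : Cube (Fin dS) → Cube (Fin dA)) (hgm : Measurable g),
      (∀ s a, Q h (pair s a) ≤ Q h (pair s (g s))) ∧ π h = Kernel.deterministic g hgm) (k : ℕ) :
    ∀ h, 1 ≤ h → h + k = H + 1 → ∀ s, M.optV H h s - M.polV H π h s ≤ 2 * k * η := by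
  induction k with
  | zero =>
    intro h h1 hk s
    have e1 : M.optV H h s = 0 := by
      simp only [MDP.optV, M.optQ_of_gt (show H < h by omega)]
      simp
    have e2 : M.polV H π h s = 0 := by
      simp only [MDP.polV, M.polQ_of_gt π (show H < h by omega)]
      simp
    rw [e1, e2]
    simp
  | succ k ih =>
    intro h h1 hk s
    have hmem : h ∈ Finset.Icc 1 H := Finset.mem_Icc.2 ⟨h1, by omega⟩
    obtain ⟨g, hgm, hgreedy, hdet⟩ := hg h hmem
    have e1 : M.polV H π h s = M.polQ H π h (pair s (g s)) := by
      rw [MDP.polV, hdet, Kernel.deterministic_apply, integral_dirac']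
      exact ((M.measurable_polQ π H h).comp
        (measurable_pair.comp (measurable_const.prodMk measurable_id))).stronglyMeasurable
    -- Passing to the estimates and back costs `η` twice.
    have e2 : M.optV H h s ≤ M.optQ H h (pair s (g s)) + 2 * η := by
      refine ciSup_le fun a => ?_
      have q1 := (abs_le.1 (hQ h hmem (pair s a))).1
      have q2 := (abs_le.1 (hQ h hmem (pair s (g s)))).2
      have := hgreedy s a
      linarith
    have i1 : Integrable (M.optV H (h + 1)) (M.p h (pair s (g s))) :=
      integrable_of_abs_le (hM.continuous_optV (by omega)).measurable (M.abs_optV_le (by omega))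
    have i2 : Integrable (M.polV H π (h + 1)) (M.p h (pair s (g s))) :=
      integrable_of_abs_le (M.measurable_polV π H (h + 1)) (M.abs_polV_le π H (h + 1))
    have e3 : M.optQ H h (pair s (g s)) - M.polQ H π h (pair s (g s)) ≤ 2 * k * η := by
      rw [M.polQ_eq π (by omega), M.optQ_eq (by omega), add_sub_add_left_eq_sub, ← integral_sub i1 i2]
      calc _ ≤ ∫ _s', 2 * k * η ∂(M.p h (pair s (g s))) :=
            integral_mono (i1.sub i2) (integrable_const _) (ih (h + 1) (by omega) (by omega))
        _ = 2 * k * η := by simp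
    rw [e1]
    push_cast
    linarith

/-- Greedy policies for estimates with error `η` are `2 H η`-optimal. -/
theorem MDP.IsSmooth.isEpsOptimal_of_greedy {H ν : ℕ} {C : ℝ≥0} (hM : M.IsSmooth H ν C) {η ε : ℝ}
    (Q : ℕ → Cube (Idx dS dA) → ℝ) (hε : 2 * H * η ≤ ε)
    (hQ : ∀ h ∈ Finset.Icc 1 H, ∀ z, |Q h z - M.optQ H h z| ≤ η)
    (hg : ∀ h ∈ Finset.Icc 1 H, ∃ (g : Cube (Fin dS) → Cube (Fin dA)) (hgm : Measurable g),
      (∀ s a, Q h (pair s a) ≤ Q h (pair s (g s))) ∧ π h = Kernel.deterministic g hgm) :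
    M.IsEpsOptimal H ε π := by
  have h1 := hM.optV_sub_polV_le π Q hQ hg H 1 le_rfl (by omega)
  refine ⟨fun s => ?_, fun π' hπ' s => ?_⟩
  · have h2 := (hM.polQ_le_optQ π H 1 le_rfl (by omega)).2 s
    rw [abs_of_nonneg (by linarith)]
    exact (h1 s).trans hε
  · have h2 := (hM.polQ_le_optQ π' H 1 le_rfl (by omega)).2 s
    linarith [h1 s]

end Policy

end Values

/-! ### Measurable selection of maximizing actions -/

section Argmax

open Filter Topology

/-- The least maximizer of a continuous function of one variable depends measurably on a
parameter: the parameters whose least maximizer is at most `c` are the projection of a closed set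
along a compact factor. -/
theorem exists_measurable_argmax_Icc {S : Type} [TopologicalSpace S] [MeasurableSpace S]
    [OpensMeasurableSpace S] {F : S → Set.Icc (-1 : ℝ) 1 → ℝ}
    (hF : Continuous (Function.uncurry F)) :
    ∃ g : S → Set.Icc (-1 : ℝ) 1, Measurable g ∧ ∀ s t, F s t ≤ F s (g s) := by
  have hA : IsClosed {x : S × Set.Icc (-1 : ℝ) 1 | ∀ t, F x.1 t ≤ F x.1 x.2} := by
    simp only [Set.ofPred_forall]
    refine isClosed_iInter fun t => isClosed_le ?_ ?_
    · exact hF.comp (continuous_fst.prodMk continuous_const)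
    · exact hF.comp (continuous_fst.prodMk continuous_snd)
  have hex : ∀ s, ∃ t, IsLeast {t | ∀ t', F s t' ≤ F s t} t := by
    intro s
    have hc : Continuous (F s) := hF.comp (continuous_const.prodMk continuous_id)
    have hcl : IsClosed {t | ∀ t', F s t' ≤ F s t} :=
      hA.preimage (continuous_const.prodMk continuous_id : Continuous fun t => (s, t))
    refine hcl.isCompact.exists_isLeast ?_
    obtain ⟨t, -, ht⟩ := isCompact_univ.exists_isMaxOn
      (⟨⟨0, by norm_num⟩, trivial⟩ : (Set.univ : Set (Set.Icc (-1 : ℝ) 1)).Nonempty) hc.continuousOn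
    exact ⟨t, fun t' => ht (Set.mem_univ t')⟩
  choose g hg using hex
  refine ⟨g, measurable_of_Iic fun c => ?_, fun s t => (hg s).1 t⟩
  -- Minimality of `g s` is what makes the inclusion from right to left hold.
  have : g ⁻¹' Set.Iic c = Prod.fst '' ({x : S × Set.Icc (-1 : ℝ) 1 | ∀ t, F x.1 t ≤ F x.1 x.2} ∩
      {x | x.2 ≤ c}) := by
    ext s
    constructor
    · intro h
      exact ⟨(s, g s), ⟨(hg s).1, h⟩, rfl⟩
    · rintro ⟨⟨s', t⟩, ⟨h1, h2⟩, rfl⟩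
      exact ((hg s').2 h1).trans h2
  rw [this]
  exact (isClosedMap_fst_of_compactSpace _
    (hA.inter (isClosed_le continuous_snd continuous_const))).measurableSet

theorem continuous_cons {n : ℕ} :
    Continuous fun x : Set.Icc (-1 : ℝ) 1 × Cube (Fin n) => (Fin.cons x.1 x.2 : Cube (Fin (n + 1))) := by
  refine continuous_pi fun i => ?_
  refine Fin.cases ?_ (fun j => ?_) i
  · exact continuous_fst
  · simp only [Fin.cons_succ]
    exact (continuous_apply j).comp continuous_snd

theorem measurable_cons {n : ℕ} :
    Measurable fun x : Set.Icc (-1 : ℝ) 1 × Cube (Fin n) => (Fin.cons x.1 x.2 : Cube (Fin (n + 1))) := by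
  refine measurable_pi_lambda _ fun i => ?_
  refine Fin.cases ?_ (fun j => ?_) i
  · exact measurable_fst
  · simp only [Fin.cons_succ]
    exact (measurable_pi_apply j).comp measurable_snd

/-- A maximizer of a continuous function on a cube can be chosen measurably in a parameter: the
coordinates are selected one after the other. -/
theorem exists_measurable_argmax (n : ℕ) : ∀ {S : Type} [TopologicalSpace S]
    [SecondCountableTopology S] [MeasurableSpace S] [OpensMeasurableSpace S]
    {F : S → Cube (Fin n) → ℝ} (_ : Continuous (Function.uncurry F)),
    ∃ g : S → Cube (Fin n), Measurable g ∧ ∀ s a, F s a ≤ F s (g s) := by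
  induction n with
  | zero =>
    intro S _ _ _ _ F _
    exact ⟨fun _ => Fin.elim0, measurable_const, fun s a => le_of_eq (congrArg _ (Subsingleton.elim _ _))⟩
  | succ n ih =>
    intro S _ _ _ _ F hF
    have hG : Continuous (Function.uncurry fun (x : S × Set.Icc (-1 : ℝ) 1) (a : Cube (Fin n)) =>
        F x.1 (Fin.cons x.2 a)) := by
      refine hF.comp ((continuous_fst.comp continuous_fst).prodMk ?_)
      exact continuous_cons.comp ((continuous_snd.comp continuous_fst).prodMk continuous_snd)
    have hsup := (isCompact_univ : IsCompact (Set.univ : Set (Cube (Fin n)))).continuous_sSup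
      (f := fun (x : S × Set.Icc (-1 : ℝ) 1) (a : Cube (Fin n)) => F x.1 (Fin.cons x.2 a)) hG
    simp only [Set.image_univ] at hsup
    obtain ⟨g₁, hg₁m, hg₁⟩ := exists_measurable_argmax_Icc
      (F := fun s t => sSup (Set.range fun a => F s (Fin.cons t a))) hsup
    obtain ⟨g₂, hg₂m, hg₂⟩ := ih hG
    refine ⟨fun s => Fin.cons (g₁ s) (g₂ (s, g₁ s)),
      measurable_cons.comp (hg₁m.prodMk (hg₂m.comp (measurable_id.prodMk hg₁m))), fun s a => ?_⟩
    have hbdd : BddAbove (Set.range fun a' => F s (Fin.cons (a 0) a')) := by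
      have hc : Continuous fun a' : Cube (Fin n) => F s (Fin.cons (a 0) a') :=
        hF.comp (continuous_const.prodMk (continuous_cons.comp (continuous_const.prodMk continuous_id)))
      exact (isCompact_range hc).bddAbove
    calc F s a = F s (Fin.cons (a 0) (Fin.tail a)) := by rw [Fin.cons_self_tail]
      _ ≤ sSup (Set.range fun a' => F s (Fin.cons (a 0) a')) := le_csSup hbdd ⟨_, rfl⟩
      _ ≤ sSup (Set.range fun a' => F s (Fin.cons (g₁ s) a')) := hg₁ s (a 0)
      _ ≤ _ := by
        refine csSup_le (Set.range_nonempty _) ?_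
        rintro _ ⟨a', rfl⟩
        exact hg₂ (s, g₁ s) a'

end Argmax

/-! ### The noise distributions and the mean of the regression targets -/

section Noise

open Filter Topology

variable {ι : Type} [Fintype ι] [DecidableEq ι]

theorem integrable_vpKernel (N : ℕ) : Integrable (vpKernel (ι := ι) N) (cubeMeasure ι) :=
  integrable_of_continuous (continuous_vpKernel N)

theorem integral_vpKernel {q : ℕ} : ∫ t, vpKernel (2 * q) t ∂cubeMeasure ι = 1 := by
  have h := conv_vpKernel_trigFn (ι := ι) (q := q) (n := 0) (by rw [mem_freq]; simp) 0
  simpa [conv, trigFn, soc] using h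

theorem integral_vpKernel_mul_cos {q : ℕ} (hq : 0 < q) (i : ι) :
    ∫ t, vpKernel (2 * q) t * Real.cos (Real.pi * t i) ∂cubeMeasure ι = 1 := by
  have h0 : ∀ x : ι → ℝ, trigFn (Pi.single i (-1) : ι → ℤ) x = Real.cos (Real.pi * x i) := by
    intro x
    rw [trigFn, Finset.prod_eq_single i]
    · simp [soc]
    · intro j _ hj; simp [soc, Pi.single_eq_of_ne hj]
    · simp
  have h := conv_vpKernel_trigFn (ι := ι) (q := q) (n := Pi.single i (-1)) (by
    rw [mem_freq, Finset.sum_eq_single i]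
    · simp; omega
    · intro j _ hj; simp [Pi.single_eq_of_ne hj]
    · simp) 0
  simpa [conv, h0] using h

/-- The density of the signed part `b` of the kernel, as a real function. -/
noncomputable def vpSigned (ι : Type) [Fintype ι] [DecidableEq ι] (N : ℕ) (b : Bool) (x : ι → ℝ) : ℝ :=
  if b then vpKernel N x else -vpKernel N x

theorem continuous_vpSigned (N : ℕ) (b : Bool) : Continuous (vpSigned ι N b) := by
  cases b
  · exact (continuous_vpKernel N).neg
  · exact continuous_vpKernel N

theorem vpPart_univ (N : ℕ) (b : Bool) :
    vpPart ι N b Set.univ = ∫⁻ x, ENNReal.ofReal (vpSigned ι N b x) ∂cubeMeasure ι := by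
  rw [vpPart, withDensity_apply _ MeasurableSet.univ, Measure.restrict_univ]
  rfl

theorem vpPart_univ_lt_top (N : ℕ) (b : Bool) : vpPart ι N b Set.univ < ∞ := by
  rw [vpPart_univ]
  exact (integrable_of_continuous (continuous_vpSigned N b)).lintegral_lt_top

/-- Neither part of the kernel vanishes. For the negative part: a nonnegative kernel with
`∫ D (1 - cos π x_i) = 0` would be zero almost everywhere, against `∫ D = 1`. -/
theorem vpPart_univ_ne_zero [Nonempty ι] {q : ℕ} (hq : 0 < q) (b : Bool) :
    vpPart ι (2 * q) b Set.univ ≠ 0 := by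
  intro h
  rw [vpPart_univ, lintegral_eq_zero_iff
    (continuous_vpSigned (2 * q) b).measurable.ennreal_ofReal] at h
  have hle : ∀ᵐ x ∂cubeMeasure ι, vpSigned ι (2 * q) b x ≤ 0 := by
    filter_upwards [h] with x hx
    exact ENNReal.ofReal_eq_zero.1 hx
  have h1 := integral_vpKernel (ι := ι) (q := q)
  cases b
  · obtain ⟨i⟩ := (inferInstance : Nonempty ι)
    have hcos := integral_vpKernel_mul_cos (ι := ι) hq i
    have hint : Integrable (fun t : ι → ℝ => vpKernel (2 * q) t * (1 - Real.cos (Real.pi * t i)))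
        (cubeMeasure ι) := by
      refine integrable_of_continuous ((continuous_vpKernel _).mul ?_)
      fun_prop
    have h0 : ∫ t, vpKernel (2 * q) t * (1 - Real.cos (Real.pi * t i)) ∂cubeMeasure ι = 0 := by
      have : ∀ t : ι → ℝ, vpKernel (2 * q) t * (1 - Real.cos (Real.pi * t i)) =
          vpKernel (2 * q) t - vpKernel (2 * q) t * Real.cos (Real.pi * t i) := fun t => by ring
      simp only [this]
      rw [integral_sub (integrable_vpKernel _), h1, hcos, sub_self]
      refine integrable_of_continuous ((continuous_vpKernel _).mul ?_)
      fun_prop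
    have hnn : 0 ≤ᵐ[cubeMeasure ι] fun t : ι → ℝ =>
        vpKernel (2 * q) t * (1 - Real.cos (Real.pi * t i)) := by
      filter_upwards [hle] with x hx
      have hx' : 0 ≤ vpKernel (2 * q) x := by
        simp only [vpSigned] at hx
        simpa using hx
      exact mul_nonneg hx' (sub_nonneg.2 (Real.cos_le_one _))
    have hz := (integral_eq_zero_iff_of_nonneg_ae hnn hint).1 h0
    have hne : ∀ᵐ t ∂cubeMeasure ι, t i ≠ 0 := by
      refine ae_restrict_of_ae ?_
      have := Measure.pi_hyperplane (fun _ : ι => (volume : Measure ℝ)) i 0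
      exact measure_eq_zero_iff_ae_notMem.1 this
    have hmem : ∀ᵐ t ∂cubeMeasure ι, t ∈ Set.Icc (-1 : ι → ℝ) 1 :=
      ae_restrict_mem measurableSet_Icc
    have hK : (vpKernel (ι := ι) (2 * q)) =ᵐ[cubeMeasure ι] 0 := by
      filter_upwards [hz, hne, hmem] with t ht ht0 htm
      have hcos1 : Real.cos (Real.pi * t i) ≠ 1 := by
        intro hc
        obtain ⟨k, hk⟩ := (Real.cos_eq_one_iff _).1 hc
        have hk' : t i = 2 * k := by
          have := Real.pi_pos
          field_simp at hk
          linarith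
        have b1 := htm.1 i
        have b2 := htm.2 i
        simp only [Pi.neg_apply, Pi.one_apply] at b1 b2
        rw [hk'] at b1 b2
        have c1 : (-1 : ℤ) < k := by
          have : (-1 : ℝ) < k := by linarith
          exact_mod_cast this
        have c2 : k < (1 : ℤ) := by
          have : (k : ℝ) < 1 := by linarith
          exact_mod_cast this
        have : k = 0 := by omega
        exact ht0 (by rw [hk', this]; simp)
      exact (mul_eq_zero.1 ht).resolve_right (sub_ne_zero.2 (Ne.symm hcos1))
    rw [integral_congr_ae hK] at h1
    simp at h1
  · have : ∫ t, vpKernel (2 * q) t ∂cubeMeasure ι ≤ 0 := integral_nonpos_of_ae hle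
    linarith

theorem isProbabilityMeasure_noiseLaw [Nonempty ι] {q : ℕ} (hq : 0 < q) (b : Bool) :
    IsProbabilityMeasure (noiseLaw ι (2 * q) b) := by
  refine ⟨?_⟩
  rw [noiseLaw, Measure.smul_apply, smul_eq_mul]
  exact ENNReal.inv_mul_cancel (vpPart_univ_ne_zero hq b) (vpPart_univ_lt_top _ b).ne

theorem beta_nonneg (N : ℕ) (b : Bool) : 0 ≤ beta ι N b := ENNReal.toReal_nonneg

theorem beta_le (hd : 0 < Fintype.card ι) {q : ℕ} (hq : 0 < q) (b : Bool) :
    beta ι (2 * q) b ≤ lebesgueConst (Fintype.card ι) := by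
  refine le_trans ?_ (integral_abs_vpKernel_le hd hq)
  change _ ≤ ∫ x, |vpKernel (2 * q) x| ∂cubeMeasure ι
  have hi : Integrable (fun x : ι → ℝ => |vpKernel (2 * q) x|) (cubeMeasure ι) :=
    (integrable_vpKernel _).abs
  rw [beta, vpPart_univ, integral_eq_lintegral_of_nonneg_ae (Eventually.of_forall fun _ => abs_nonneg _)
    hi.aestronglyMeasurable]
  refine ENNReal.toReal_mono hi.lintegral_lt_top.ne (lintegral_mono fun x => ?_)
  refine ENNReal.ofReal_le_ofReal ?_
  cases b
  · exact neg_le_abs _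
  · exact le_abs_self _

theorem beta_mul_integral_noiseLaw [Nonempty ι] {q : ℕ} (hq : 0 < q) (b : Bool) (g : (ι → ℝ) → ℝ) :
    beta ι (2 * q) b * ∫ x, g x ∂noiseLaw ι (2 * q) b =
      ∫ x, max (vpSigned ι (2 * q) b x) 0 * g x ∂cubeMeasure ι := by
  have hb : beta ι (2 * q) b ≠ 0 :=
    ENNReal.toReal_ne_zero.2 ⟨vpPart_univ_ne_zero hq b, (vpPart_univ_lt_top _ b).ne⟩
  rw [noiseLaw, integral_smul_measure, ENNReal.toReal_inv, smul_eq_mul, ← beta, ← mul_assoc,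
    mul_inv_cancel₀ hb, one_mul, vpPart, integral_withDensity_eq_integral_toReal_smul]
  · rfl
  · exact (continuous_vpSigned (2 * q) b).measurable.ennreal_ofReal
  · exact Eventually.of_forall fun x => ENNReal.ofReal_lt_top

/-- Sampling from the two parts with the signs `±β_±` reproduces integration against the kernel. -/
theorem beta_integral_sub [Nonempty ι] {q : ℕ} (hq : 0 < q) {g : (ι → ℝ) → ℝ} (hg : Measurable g)
    {B : ℝ} (hB : ∀ x, |g x| ≤ B) :
    beta ι (2 * q) true * ∫ x, g x ∂noiseLaw ι (2 * q) true -
      beta ι (2 * q) false * ∫ x, g x ∂noiseLaw ι (2 * q) false =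
      ∫ x, vpKernel (2 * q) x * g x ∂cubeMeasure ι := by
  have hint : ∀ b, Integrable (fun x => max (vpSigned ι (2 * q) b x) 0 * g x) (cubeMeasure ι) := by
    intro b
    refine Integrable.mul_bdd (c := B) (integrable_of_continuous ((continuous_vpSigned _ b).max
      continuous_const)) hg.aestronglyMeasurable (Eventually.of_forall hB)
  rw [beta_mul_integral_noiseLaw hq, beta_mul_integral_noiseLaw hq, ← integral_sub (hint _) (hint _)]
  refine integral_congr_ae (Eventually.of_forall fun x => ?_)
  simp only [vpSigned, if_true, Bool.false_eq_true, if_false]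
  rw [← sub_mul]
  congr 1
  rcases le_total 0 (vpKernel (2 * q) x) with h | h
  · rw [max_eq_left h, max_eq_right (by linarith), sub_zero]
  · rw [max_eq_right h, max_eq_left (by linarith)]; ring

end Noise

section Targets

open Filter Topology

variable {dS dA : ℕ}

theorem continuous_trigFn_toVec {ι : Type} [Fintype ι] (n : ι → ℤ) :
    Continuous fun z : Cube ι => trigFn n (toVec z) := by
  refine continuous_finsetProd _ fun i _ => ?_
  have : Continuous fun z : Cube ι => toVec z i :=
    continuous_subtype_val.comp (continuous_apply i)
  unfold soc
  split_ifs
  · exact continuous_const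
  · exact Real.continuous_sin.comp (continuous_const.mul this)
  · exact Real.continuous_cos.comp (continuous_const.mul this)

theorem _root_.Continuous.qHat {Y ι : Type} [TopologicalSpace Y] [Fintype ι] [DecidableEq ι] {N : ℕ}
    {θ : Y → freq ι N → ℝ} {z : Y → Cube ι} (hθ : Continuous θ) (hz : Continuous z) :
    Continuous fun y => qHat N (θ y) (z y) := by
  refine continuous_finsetSum _ fun n _ => ?_
  exact ((continuous_trigFn_toVec n.1).comp hz).mul ((continuous_apply n).comp hθ)

theorem continuous_vHat (N : ℕ) :
    Continuous fun x : (freq (Idx dS dA) N → ℝ) × Cube (Fin dS) => vHat N x.1 x.2 := by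
  have hp : Continuous fun y : ((freq (Idx dS dA) N → ℝ) × Cube (Fin dS)) × Cube (Fin dA) =>
      pair y.1.2 y.2 :=
    continuous_pair.comp ((continuous_snd.comp continuous_fst).prodMk continuous_snd)
  have h : Continuous fun y : ((freq (Idx dS dA) N → ℝ) × Cube (Fin dS)) × Cube (Fin dA) =>
      qHat N y.1.1 (pair y.1.2 y.2) :=
    (continuous_fst.comp continuous_fst).qHat hp
  have := (isCompact_univ : IsCompact (Set.univ : Set (Cube (Fin dA)))).continuous_sSup
    (f := fun (x : (freq (Idx dS dA) N → ℝ) × Cube (Fin dS)) (a : Cube (Fin dA)) =>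
      qHat N x.1 (pair x.2 a)) h
  simp only [Set.image_univ] at this
  exact this

variable (M : MDP dS dA)

theorem isProbabilityMeasure_queryLaw [Nonempty (Idx dS dA)] {q : ℕ} (hq : 0 < q) (h : ℕ)
    (z : Cube (Idx dS dA)) (b : Bool) : IsProbabilityMeasure (M.queryLaw (2 * q) h z b) := by
  have := isProbabilityMeasure_noiseLaw (ι := Idx dS dA) hq b
  unfold MDP.queryLaw
  infer_instance

/-- The one-step return `R_h(z + η) + V(s')` observed at a query. -/
noncomputable def MDP.sampleReturn (h : ℕ) (z : Cube (Idx dS dA)) (V : Cube (Fin dS) → ℝ)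
    (x : (Idx dS dA → ℝ) × Cube (Fin dS)) : ℝ :=
  M.R h (wrap (toVec z + x.1)) + V x.2

theorem MDP.measurable_R_wrap (h : ℕ) (z : Cube (Idx dS dA)) :
    Measurable fun η : Idx dS dA → ℝ => M.R h (wrap (toVec z + η)) :=
  (M.measurable_R h).comp (measurable_wrap.comp (measurable_const.add measurable_id))

theorem MDP.integral_sampleReturn [Nonempty (Idx dS dA)] {q : ℕ} (hq : 0 < q) (h : ℕ)
    (z : Cube (Idx dS dA)) (b : Bool) {V : Cube (Fin dS) → ℝ} (hV : Measurable V) {B : ℝ}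
    (hB : ∀ s, |V s| ≤ B) :
    ∫ x, M.sampleReturn h z V x ∂(M.queryLaw (2 * q) h z b) =
      ∫ η, (M.R h (wrap (toVec z + η)) + ∫ s', V s' ∂(M.p h (wrap (toVec z + η))))
        ∂(noiseLaw (Idx dS dA) (2 * q) b) := by
  have := isProbabilityMeasure_noiseLaw (ι := Idx dS dA) hq b
  unfold MDP.queryLaw
  rw [Measure.integral_compProd]
  · refine integral_congr_ae (Eventually.of_forall fun η => ?_)
    simp only [MDP.sampleReturn]
    rw [Kernel.comap_apply, integral_add (integrable_const _) (integrable_of_abs_le hV hB)]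
    simp
  · refine integrable_of_abs_le (B := 1 + B) ?_ fun x => ?_
    · exact ((M.measurable_R_wrap h z).comp measurable_fst).add (hV.comp measurable_snd)
    · exact (abs_add_le _ _).trans (add_le_add (M.abs_R_le h _) (hB _))

theorem MDP.measurable_bellman (h : ℕ) {f : Cube (Idx dS dA) → ℝ} (hf : Continuous f) :
    Measurable (M.bellman h f) :=
  (M.measurable_R h).add
    ((continuous_iSup_pair hf).measurable.stronglyMeasurable.integral_kernel).measurable

theorem MDP.abs_bellman_le (h : ℕ) {f : Cube (Idx dS dA) → ℝ} {B : ℝ} (hB : ∀ z, |f z| ≤ B)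
    (z : Cube (Idx dS dA)) : |M.bellman h f z| ≤ 1 + B :=
  (abs_add_le _ _).trans
    (add_le_add (M.abs_R_le h z) (abs_integral_le_of_abs_le fun s => abs_iSup_pair_le hB s))

/-- The mean of a regression target is the convolution of the kernel with the Bellman update of the
next-stage estimate. -/
theorem MDP.beta_integral_sampleReturn [Nonempty (Idx dS dA)] {q : ℕ} (hq : 0 < q) (h : ℕ)
    (z : Cube (Idx dS dA)) {f : Cube (Idx dS dA) → ℝ} (hf : Continuous f) :
    beta (Idx dS dA) (2 * q) true * ∫ x, M.sampleReturn h z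
        (fun s => ⨆ a : Cube (Fin dA), f (pair s a)) x ∂(M.queryLaw (2 * q) h z true) -
      beta (Idx dS dA) (2 * q) false * ∫ x, M.sampleReturn h z
        (fun s => ⨆ a : Cube (Fin dA), f (pair s a)) x ∂(M.queryLaw (2 * q) h z false) =
      conv (vpKernel (2 * q)) (periodize (M.bellman h f)) (toVec z) := by
  obtain ⟨B, hB⟩ := exists_bound_cube hf
  have hV := (continuous_iSup_pair hf).measurable
  rw [M.integral_sampleReturn hq h z true hV (abs_iSup_pair_le hB),
    M.integral_sampleReturn hq h z false hV (abs_iSup_pair_le hB)]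
  exact beta_integral_sub hq (g := fun η => M.bellman h f (wrap (toVec z + η)))
    ((M.measurable_bellman h hf).comp (measurable_wrap.comp (measurable_const.add measurable_id)))
    fun η => M.abs_bellman_le h hB _

end Targets

/-! ### Least squares on the rounded design -/

section Regression

variable {ι : Type} [Fintype ι] [DecidableEq ι] {N ntot : ℕ} {ρ : Cube ι →₀ ℝ}

/-- The Gram matrix `∑ φ(z) φ(z)ᵀ` of the dataset. -/
noncomputable def gram (N ntot : ℕ) (ρ : Cube ι →₀ ℝ) : Matrix (freq ι N) (freq ι N) ℝ :=
  ∑ i : Item ntot ρ, Matrix.vecMulVec (feature N i.1.1) (feature N i.1.1)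

theorem gram_mulVec (w : freq ι N → ℝ) :
    gram N ntot ρ *ᵥ w = ∑ i : Item ntot ρ, (feature N i.1.1 ⬝ᵥ w) • feature N i.1.1 := by
  rw [gram, Matrix.sum_mulVec]
  refine Finset.sum_congr rfl fun i _ => ?_
  rw [Matrix.vecMulVec_mulVec]
  ext n
  simp [mul_comm]

theorem dotProduct_gram_mulVec (v w : freq ι N → ℝ) :
    v ⬝ᵥ (gram N ntot ρ *ᵥ w) =
      ∑ i : Item ntot ρ, (feature N i.1.1 ⬝ᵥ v) * (feature N i.1.1 ⬝ᵥ w) := by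
  rw [gram_mulVec, dotProduct_sum]
  refine Finset.sum_congr rfl fun i _ => ?_
  rw [dotProduct_smul, smul_eq_mul, mul_comm, dotProduct_comm]

theorem dotProduct_designMatrix_mulVec (v w : freq ι N → ℝ) :
    v ⬝ᵥ (designMatrix N ρ *ᵥ w) =
      ∑ z ∈ ρ.support, ρ z * ((feature N z ⬝ᵥ v) * (feature N z ⬝ᵥ w)) := by
  rw [designMatrix, Matrix.sum_mulVec, dotProduct_sum]
  refine Finset.sum_congr rfl fun z _ => ?_
  rw [Matrix.smul_mulVec, Matrix.vecMulVec_mulVec, dotProduct_smul, smul_eq_mul]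
  congr 1
  rw [dotProduct_comm (feature N z) v]
  simp only [dotProduct, Pi.smul_apply, MulOpposite.smul_eq_mul_unop, MulOpposite.unop_op]
  rw [Finset.sum_mul]
  exact Finset.sum_congr rfl fun n _ => by ring

/-- Rounding up the number of copies only increases the Gram matrix. -/
theorem mul_designMatrix_le_gram (v : freq ι N → ℝ) :
    (ntot : ℝ) * (v ⬝ᵥ (designMatrix N ρ *ᵥ v)) ≤ v ⬝ᵥ (gram N ntot ρ *ᵥ v) := by
  rw [dotProduct_designMatrix_mulVec, dotProduct_gram_mulVec, Fintype.sum_sigma, Finset.mul_sum,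
    ← Finset.sum_coe_sort ρ.support]
  refine Finset.sum_le_sum fun z _ => ?_
  simp only [Finset.sum_const, Finset.card_univ, Fintype.card_fin, nsmul_eq_mul]
  rw [← mul_assoc]
  exact mul_le_mul_of_nonneg_right (Nat.le_ceil _) (mul_self_nonneg _)

theorem IsQuasiOptimalDesign.eq_zero_of_gram (hρ : IsQuasiOptimalDesign N ρ) (hn : 0 < ntot)
    {v : freq ι N → ℝ} (hv : v ⬝ᵥ (gram N ntot ρ *ᵥ v) = 0) : v = 0 := by
  have h1 := mul_designMatrix_le_gram (ntot := ntot) (ρ := ρ) v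
  rw [hv] at h1
  have hn' : (0 : ℝ) < ntot := by exact_mod_cast hn
  have h2 : v ⬝ᵥ (designMatrix N ρ *ᵥ v) ≤ 0 := nonpos_of_mul_nonpos_right h1 hn'
  rw [dotProduct_designMatrix_mulVec] at h2
  have hnn : ∀ z ∈ ρ.support, 0 ≤ ρ z * ((feature N z ⬝ᵥ v) * (feature N z ⬝ᵥ v)) :=
    fun z _ => mul_nonneg (hρ.nonneg z) (mul_self_nonneg _)
  have h3 := (Finset.sum_eq_zero_iff_of_nonneg hnn).1 (le_antisymm h2 (Finset.sum_nonneg hnn))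
  have h4 : designMatrix N ρ *ᵥ v = 0 := by
    rw [designMatrix, Matrix.sum_mulVec]
    refine Finset.sum_eq_zero fun z hz => ?_
    have := (mul_eq_zero.1 (h3 z hz)).resolve_left (Finsupp.mem_support_iff.1 hz)
    rw [Matrix.smul_mulVec, Matrix.vecMulVec_mulVec, mul_self_eq_zero.1 this]
    simp
  refine (Matrix.mulVec_injective_iff_isUnit.2 hρ.isUnit) ?_
  rw [h4, Matrix.mulVec_zero]

theorem IsQuasiOptimalDesign.isUnit_gram (hρ : IsQuasiOptimalDesign N ρ) (hn : 0 < ntot) :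
    IsUnit (gram N ntot ρ) := by
  refine Matrix.mulVec_injective_iff_isUnit.1 fun v w h => ?_
  refine sub_eq_zero.1 (hρ.eq_zero_of_gram hn ?_)
  have h' : gram N ntot ρ *ᵥ v = gram N ntot ρ *ᵥ w := h
  rw [Matrix.mulVec_sub, h', sub_self, dotProduct_zero]

theorem IsQuasiOptimalDesign.gram_mulVec_inv (hρ : IsQuasiOptimalDesign N ρ) (hn : 0 < ntot)
    (v : freq ι N → ℝ) : gram N ntot ρ *ᵥ ((gram N ntot ρ)⁻¹ *ᵥ v) = v := by
  rw [Matrix.mulVec_mulVec, Matrix.mul_nonsing_inv _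
    ((Matrix.isUnit_iff_isUnit_det _).1 (hρ.isUnit_gram hn)), Matrix.one_mulVec]

theorem gram_transpose : (gram N ntot ρ)ᵀ = gram N ntot ρ := by
  rw [gram, Matrix.transpose_sum]
  exact Finset.sum_congr rfl fun i _ => by rw [Matrix.transpose_vecMulVec]

/-- The weight with which the target of the dataset element `i` enters the fitted value at `z`. -/
noncomputable def lsWeight (N ntot : ℕ) (ρ : Cube ι →₀ ℝ) (z : Cube ι) (i : Item ntot ρ) : ℝ :=
  feature N i.1.1 ⬝ᵥ ((gram N ntot ρ)⁻¹ *ᵥ feature N z)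

/-- The solution `Λ⁻¹ ∑ y_i φ_i` of the normal equations. -/
noncomputable def lsSol (N : ℕ) {ntot : ℕ} {ρ : Cube ι →₀ ℝ} (y : Item ntot ρ → ℝ) : freq ι N → ℝ :=
  (gram N ntot ρ)⁻¹ *ᵥ ∑ i, y i • feature N i.1.1

theorem qHat_lsSol (y : Item ntot ρ → ℝ) (z : Cube ι) :
    qHat N (lsSol N y) z = ∑ i, lsWeight N ntot ρ z i * y i := by
  have hT : ((gram N ntot ρ)⁻¹)ᵀ = (gram N ntot ρ)⁻¹ := by
    rw [Matrix.transpose_nonsing_inv, gram_transpose]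
  rw [qHat, lsSol, Matrix.dotProduct_mulVec, ← Matrix.mulVec_transpose, hT, dotProduct_sum]
  refine Finset.sum_congr rfl fun i _ => ?_
  rw [dotProduct_smul, smul_eq_mul, lsWeight, dotProduct_comm, mul_comm]

theorem IsQuasiOptimalDesign.lsSol_feature (hρ : IsQuasiOptimalDesign N ρ) (hn : 0 < ntot)
    (θ : freq ι N → ℝ) : lsSol N (fun i : Item ntot ρ => feature N i.1.1 ⬝ᵥ θ) = θ := by
  rw [lsSol, ← gram_mulVec, Matrix.mulVec_mulVec, Matrix.nonsing_inv_mul _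
    ((Matrix.isUnit_iff_isUnit_det _).1 (hρ.isUnit_gram hn)), Matrix.one_mulVec]

/-- The regression reproduces the functions in the span of the features. -/
theorem IsQuasiOptimalDesign.sum_lsWeight_mul_qHat (hρ : IsQuasiOptimalDesign N ρ) (hn : 0 < ntot)
    (θ : freq ι N → ℝ) (z : Cube ι) :
    ∑ i, lsWeight N ntot ρ z i * qHat N θ i.1.1 = qHat N θ z := by
  have := qHat_lsSol (N := N) (fun i : Item ntot ρ => feature N i.1.1 ⬝ᵥ θ) z
  rw [hρ.lsSol_feature hn] at this
  exact this.symm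

/-- The variance factor of the fitted values: `∑ a_i² = φᵀ Λ⁻¹ φ ≤ 2 Ñ / n_tot`. -/
theorem IsQuasiOptimalDesign.sum_lsWeight_sq_le (hρ : IsQuasiOptimalDesign N ρ) (hn : 0 < ntot)
    (z : Cube ι) : ∑ i, lsWeight N ntot ρ z i ^ 2 ≤ 2 * (freq ι N).card / ntot := by
  have hn' : (0 : ℝ) < ntot := by exact_mod_cast hn
  set y := (gram N ntot ρ)⁻¹ *ᵥ feature N z with hy
  set w := (designMatrix N ρ)⁻¹ *ᵥ feature N z with hw
  set s := ∑ i, lsWeight N ntot ρ z i ^ 2 with hs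
  have hs0 : 0 ≤ s := Finset.sum_nonneg fun i _ => sq_nonneg _
  have hs1 : s = y ⬝ᵥ (gram N ntot ρ *ᵥ y) := by
    rw [dotProduct_gram_mulVec]
    exact Finset.sum_congr rfl fun i _ => by rw [lsWeight, sq]
  have hs2 : s = y ⬝ᵥ feature N z := by rw [hs1, hy, hρ.gram_mulVec_inv hn]
  have hw1 : designMatrix N ρ *ᵥ w = feature N z := by
    rw [hw, Matrix.mulVec_mulVec, Matrix.mul_nonsing_inv _
      ((Matrix.isUnit_iff_isUnit_det _).1 hρ.isUnit), Matrix.one_mulVec]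
  -- Cauchy–Schwarz for the positive semidefinite form of the design.
  have hcs : s ^ 2 ≤ (w ⬝ᵥ (designMatrix N ρ *ᵥ w)) * (y ⬝ᵥ (designMatrix N ρ *ᵥ y)) := by
    rw [hs2, ← hw1, dotProduct_designMatrix_mulVec, dotProduct_designMatrix_mulVec,
      dotProduct_designMatrix_mulVec]
    refine Finset.sum_sq_le_sum_mul_sum_of_sq_le_mul _
      (fun x _ => mul_nonneg (hρ.nonneg x) (mul_self_nonneg _))
      (fun x _ => mul_nonneg (hρ.nonneg x) (mul_self_nonneg _)) fun x _ => ?_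
    generalize feature N x ⬝ᵥ w = a
    generalize feature N x ⬝ᵥ y = b
    exact le_of_eq (by ring)
  have hA : w ⬝ᵥ (designMatrix N ρ *ᵥ w) ≤ 2 * (freq ι N).card := by
    rw [hw1, dotProduct_comm]; exact hρ.bound z
  have hB : (ntot : ℝ) * (y ⬝ᵥ (designMatrix N ρ *ᵥ y)) ≤ s := by
    rw [hs1]; exact mul_designMatrix_le_gram y
  have hY0 : 0 ≤ y ⬝ᵥ (designMatrix N ρ *ᵥ y) := by
    rw [dotProduct_designMatrix_mulVec]
    exact Finset.sum_nonneg fun x _ => mul_nonneg (hρ.nonneg x) (mul_self_nonneg _)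
  rw [le_div_iff₀ hn']
  rcases hs0.eq_or_lt with h0 | h0
  · rw [← h0, zero_mul]; positivity
  · have h1 : s * (s * ntot) ≤ s * (2 * (freq ι N).card) := by
      calc s * (s * ntot) = s ^ 2 * ntot := by ring
        _ ≤ ((w ⬝ᵥ (designMatrix N ρ *ᵥ w)) * (y ⬝ᵥ (designMatrix N ρ *ᵥ y))) * ntot :=
          mul_le_mul_of_nonneg_right hcs hn'.le
        _ = (w ⬝ᵥ (designMatrix N ρ *ᵥ w)) * (ntot * (y ⬝ᵥ (designMatrix N ρ *ᵥ y))) := by ring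
        _ ≤ (2 * (freq ι N).card) * s := mul_le_mul hA hB (by positivity) (by positivity)
        _ = _ := by ring
    exact le_of_mul_le_mul_left h1 h0

/-- Pythagoras: the residual of `lsSol` is orthogonal to the span of the features. -/
theorem IsQuasiOptimalDesign.sum_sq_lsSol (hρ : IsQuasiOptimalDesign N ρ) (hn : 0 < ntot)
    (y : Item ntot ρ → ℝ) (θ : freq ι N → ℝ) :
    ∑ i : Item ntot ρ, (feature N i.1.1 ⬝ᵥ θ - y i) ^ 2 =
      ∑ i : Item ntot ρ, (feature N i.1.1 ⬝ᵥ lsSol N y - y i) ^ 2 +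
        (θ - lsSol N y) ⬝ᵥ (gram N ntot ρ *ᵥ (θ - lsSol N y)) := by
  have hnormal : ∑ i : Item ntot ρ, (feature N i.1.1 ⬝ᵥ (θ - lsSol N y)) *
      (feature N i.1.1 ⬝ᵥ lsSol N y - y i) = 0 := by
    have h1 := dotProduct_gram_mulVec (ntot := ntot) (ρ := ρ) (θ - lsSol N y) (lsSol N y)
    have h2 : gram N ntot ρ *ᵥ lsSol N y = ∑ i, y i • feature N i.1.1 := by
      rw [lsSol, hρ.gram_mulVec_inv hn]
    rw [h2, dotProduct_sum] at h1
    simp only [mul_sub, Finset.sum_sub_distrib]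
    rw [← h1, sub_eq_zero]
    refine Finset.sum_congr rfl fun i _ => ?_
    rw [dotProduct_smul, smul_eq_mul, dotProduct_comm, mul_comm]
  rw [dotProduct_gram_mulVec, ← Finset.sum_add_distrib]
  have : ∀ i : Item ntot ρ, (feature N i.1.1 ⬝ᵥ θ - y i) ^ 2 =
      ((feature N i.1.1 ⬝ᵥ lsSol N y - y i) ^ 2 +
        (feature N i.1.1 ⬝ᵥ (θ - lsSol N y)) * (feature N i.1.1 ⬝ᵥ (θ - lsSol N y))) +
      2 * ((feature N i.1.1 ⬝ᵥ (θ - lsSol N y)) * (feature N i.1.1 ⬝ᵥ lsSol N y - y i)) := by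
    intro i
    rw [dotProduct_sub]
    ring
  rw [Finset.sum_congr rfl fun i _ => this i, Finset.sum_add_distrib, ← Finset.mul_sum, hnormal]
  ring

/-- The solution of the normal equations is the unique least-squares solution. -/
theorem IsQuasiOptimalDesign.eq_lsSol_iff (hρ : IsQuasiOptimalDesign N ρ) (hn : 0 < ntot)
    (y : Item ntot ρ → ℝ) (θ : freq ι N → ℝ) :
    (∀ θ' : freq ι N → ℝ, ∑ i : Item ntot ρ, (feature N i.1.1 ⬝ᵥ θ - y i) ^ 2 ≤
      ∑ i : Item ntot ρ, (feature N i.1.1 ⬝ᵥ θ' - y i) ^ 2) ↔ θ = lsSol N y := by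
  have hnn : ∀ v : freq ι N → ℝ, 0 ≤ v ⬝ᵥ (gram N ntot ρ *ᵥ v) := fun v => by
    rw [dotProduct_gram_mulVec]; exact Finset.sum_nonneg fun i _ => mul_self_nonneg _
  constructor
  · intro h
    have h1 := h (lsSol N y)
    rw [hρ.sum_sq_lsSol hn y θ] at h1
    exact sub_eq_zero.1 (hρ.eq_zero_of_gram hn (le_antisymm (by linarith) (hnn _)))
  · rintro rfl θ'
    rw [hρ.sum_sq_lsSol hn y θ']
    linarith [hnn (θ' - lsSol N y)]

end Regression

/-! ### Concentration for one stage of the algorithm -/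

section Concentration

open Filter Topology

variable {Q X : Type} [Fintype Q] [MeasurableSpace X] {μ : Q → Measure X}
  [∀ q, IsProbabilityMeasure (μ q)]

/-- Hoeffding's inequality for functions of the coordinates of a product measure. -/
theorem measure_pi_abs_sum_ge_le {f : Q → X → ℝ} (hf : ∀ q, Measurable (f q)) {c : Q → ℝ}
    (hc : ∀ q x, |f q x| ≤ c q) {v : ℝ} (hv : ∑ q, c q ^ 2 ≤ v) {t : ℝ} (ht : 0 ≤ t) :
    Measure.pi μ {ω | t ≤ |∑ q, (f q (ω q) - ∫ x, f q x ∂μ q)|} ≤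
      ENNReal.ofReal (2 * Real.exp (-t ^ 2 / (2 * v))) := by
  have hv0 : 0 ≤ v := (Finset.sum_nonneg fun q _ => sq_nonneg (c q)).trans hv
  have hind : iIndepFun (fun q (ω : Q → X) => f q (ω q) - ∫ x, f q x ∂μ q) (Measure.pi μ) :=
    iIndepFun_pi (X := fun q x => f q x - ∫ x, f q x ∂μ q)
      fun q => ((hf q).sub_const _).aemeasurable
  have hsub : ∀ q ∈ Finset.univ, HasSubgaussianMGF
      (fun ω : Q → X => f q (ω q) - ∫ x, f q x ∂μ q) ((‖c q - -c q‖₊ / 2) ^ 2) (Measure.pi μ) := by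
    intro q _
    have h := hasSubgaussianMGF_of_mem_Icc (μ := μ q) (hf q).aemeasurable
      (Eventually.of_forall fun x => abs_le.1 (hc q x))
    exact HasSubgaussianMGF.of_map (Y := Function.eval q) (μ := Measure.pi μ)
      (measurable_pi_apply q).aemeasurable (by rw [(measurePreserving_eval μ q).map_eq]; exact h)
  have hsum := HasSubgaussianMGF.sum_of_iIndepFun hind hsub
  have hpar : ((∑ q, (‖c q - -c q‖₊ / 2) ^ 2 : ℝ≥0) : ℝ) ≤ v := by
    push_cast
    refine le_trans (le_of_eq (Finset.sum_congr rfl fun q _ => ?_)) hv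
    rw [show c q - -c q = 2 * c q by ring, norm_mul, Real.norm_eq_abs, Real.norm_eq_abs, abs_two,
      mul_div_cancel_left₀ _ (two_ne_zero), sq_abs]
  have hsum' : HasSubgaussianMGF (fun ω : Q → X => ∑ q, (f q (ω q) - ∫ x, f q x ∂μ q)) v.toNNReal
      (Measure.pi μ) := by
    refine ⟨hsum.integrable_exp_mul, fun s => (hsum.mgf_le s).trans (Real.exp_le_exp.2 ?_)⟩
    rw [Real.coe_toNNReal _ hv0]
    have := mul_le_mul_of_nonneg_right hpar (sq_nonneg s)
    linarith
  have h1 := hsum'.measure_ge_le ht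
  have h2 := hsum'.neg.measure_ge_le ht
  rw [Real.coe_toNNReal _ hv0] at h1 h2
  have hset : {ω : Q → X | t ≤ |∑ q, (f q (ω q) - ∫ x, f q x ∂μ q)|} ⊆
      {ω | t ≤ ∑ q, (f q (ω q) - ∫ x, f q x ∂μ q)} ∪
      {ω | t ≤ (-fun ω : Q → X => ∑ q, (f q (ω q) - ∫ x, f q x ∂μ q)) ω} := by
    intro ω hω
    have hω' : t ≤ |∑ q, (f q (ω q) - ∫ x, f q x ∂μ q)| := hω
    exact le_abs.1 hω'
  refine (measure_mono hset).trans ((measure_union_le _ _).trans ?_)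
  rw [two_mul, ENNReal.ofReal_add (Real.exp_pos _).le (Real.exp_pos _).le]
  refine add_le_add ?_ ?_
  · rw [← ofReal_measureReal]; exact ENNReal.ofReal_le_ofReal h1
  · rw [← ofReal_measureReal]; exact ENNReal.ofReal_le_ofReal h2

/-- Replacing the coordinates in `p` by those of an independent copy. -/
def mix (p : Q → Prop) [DecidablePred p] (x : (Q → X) × (Q → X)) : Q → X :=
  fun q => if p q then x.2 q else x.1 q

theorem measurable_mix (p : Q → Prop) [DecidablePred p] :
    Measurable (mix p : (Q → X) × (Q → X) → Q → X) := by
  refine measurable_pi_lambda _ fun q => ?_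
  unfold mix
  split_ifs
  · exact (measurable_pi_apply q).comp measurable_snd
  · exact (measurable_pi_apply q).comp measurable_fst

/-- Resampling some of the independent coordinates does not change the joint distribution. -/
theorem map_mix (p : Q → Prop) [DecidablePred p] :
    ((Measure.pi μ).prod (Measure.pi μ)).map (mix p) = Measure.pi μ := by
  refine (Measure.pi_eq fun s hs => ?_).symm
  rw [Measure.map_apply (measurable_mix p) (MeasurableSet.univ_pi hs)]
  have : mix p ⁻¹' (Set.univ.pi s) = (Set.univ.pi fun q => if p q then Set.univ else s q) ×ˢ
      (Set.univ.pi fun q => if p q then s q else Set.univ) := by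
    ext x
    simp only [Set.mem_preimage, Set.mem_pi, Set.mem_univ, true_imp_iff, Set.mem_prod, mix,
      ← forall_and]
    refine forall_congr' fun q => ?_
    split_ifs <;> simp
  rw [this, Measure.prod_prod, Measure.pi_pi, Measure.pi_pi, ← Finset.prod_mul_distrib]
  refine Finset.prod_congr rfl fun q _ => ?_
  split_ifs <;> simp

/-- A conditional form of Hoeffding's inequality: the summands are functions of the coordinates in
`p`, and may depend in addition on the other coordinates. -/
theorem measure_pi_abs_sum_ge_le_of_local (p : Q → Prop) [DecidablePred p]
    {F : (Q → X) → Q → X → ℝ} (hF : ∀ q, Measurable fun x : (Q → X) × X => F x.1 q x.2) {c : Q → ℝ}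
    (hc : ∀ ω q x, |F ω q x| ≤ c q) (hloc : ∀ ω ω', (∀ q, ¬p q → ω q = ω' q) → F ω = F ω')
    (hp : ∀ ω q x, ¬p q → F ω q x = 0) {v : ℝ} (hv : ∑ q, c q ^ 2 ≤ v) {t : ℝ} (ht : 0 ≤ t) :
    MeasurableSet {ω | t ≤ |∑ q, (F ω q (ω q) - ∫ x, F ω q x ∂μ q)|} ∧
    Measure.pi μ {ω | t ≤ |∑ q, (F ω q (ω q) - ∫ x, F ω q x ∂μ q)|} ≤
      ENNReal.ofReal (2 * Real.exp (-t ^ 2 / (2 * v))) := by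
  have hm : Measurable fun ω : Q → X => ∑ q, (F ω q (ω q) - ∫ x, F ω q x ∂μ q) := by
    refine Finset.measurable_sum _ fun q _ => Measurable.sub ?_ ?_
    · exact (hF q).comp (measurable_id.prodMk (measurable_pi_apply q))
    · exact ((hF q).stronglyMeasurable.integral_prod_right' (ν := μ q)).measurable
  have hE : MeasurableSet {ω | t ≤ |∑ q, (F ω q (ω q) - ∫ x, F ω q x ∂μ q)|} :=
    measurableSet_le measurable_const hm.abs
  refine ⟨hE, ?_⟩
  -- With the coordinates outside `p` fixed and those in `p` resampled, the summands become fixed functions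
  -- of independent coordinates.
  conv_lhs => rw [← map_mix (μ := μ) p]
  rw [Measure.map_apply (measurable_mix p) hE, Measure.prod_apply (measurable_mix p hE)]
  calc _ ≤ ∫⁻ _ω, ENNReal.ofReal (2 * Real.exp (-t ^ 2 / (2 * v))) ∂Measure.pi μ := by
        refine lintegral_mono fun ω => ?_
        refine le_trans (measure_mono ?_) (measure_pi_abs_sum_ge_le (f := F ω)
          (fun q => (hF q).comp (measurable_const.prodMk measurable_id)) (hc ω) hv ht)
        intro ω' hω'
        have h1 : F (mix p (ω, ω')) = F ω := hloc _ _ fun q hq => by simp [mix, hq]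
        have h2 : t ≤ |∑ q, (F (mix p (ω, ω')) q (mix p (ω, ω') q) -
          ∫ x, F (mix p (ω, ω')) q x ∂μ q)| := hω'
        rw [h1] at h2
        refine h2.trans (le_of_eq (congrArg _ (Finset.sum_congr rfl fun q _ => ?_)))
        by_cases hq : p q
        · simp [mix, hq]
        · rw [hp _ _ _ hq, hp _ _ _ hq]
    _ = _ := by simp

end Concentration

/-! ### The estimates computed by the algorithm -/

section Estimates

variable {dS dA : ℕ} (M : MDP dS dA) {H ntot : ℕ} (N : ℕ) {ρ : Cube (Idx dS dA) →₀ ℝ}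

/-- The parameter `θ̂_h` computed by the algorithm from the data, with `θ̂_{H+1} = 0`. -/
noncomputable def MDP.thetaHat (ω : Data H ntot ρ) (h : ℕ) : freq (Idx dS dA) N → ℝ :=
  if hh : h ∈ Finset.Icc 1 H then
    lsSol N (M.target ω ⟨h, hh⟩ (MDP.thetaHat ω (h + 1)))
  else 0
termination_by H + 1 - h
decreasing_by have := Finset.mem_Icc.1 hh; omega

theorem MDP.thetaHat_of_mem (ω : Data H ntot ρ) {h : ℕ} (hh : h ∈ Finset.Icc 1 H) :
    M.thetaHat N ω h = lsSol N (M.target ω ⟨h, hh⟩ (M.thetaHat N ω (h + 1))) := by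
  rw [MDP.thetaHat, dif_pos hh]

theorem MDP.thetaHat_of_not_mem (ω : Data H ntot ρ) {h : ℕ} (hh : h ∉ Finset.Icc 1 H) :
    M.thetaHat N ω h = 0 := by
  rw [MDP.thetaHat, dif_neg hh]

variable {N}

/-- The least-squares problems have unique solutions, so an output of the algorithm is greedy for
the computed estimates. -/
theorem MDP.isOutput_theta_eq (hρ : IsQuasiOptimalDesign N ρ) (hn : 0 < ntot) {ω : Data H ntot ρ}
    {θ : ℕ → freq (Idx dS dA) N → ℝ} (hlast : θ (H + 1) = 0)
    (hθ : ∀ h : Finset.Icc 1 H, ∀ θ' : freq (Idx dS dA) N → ℝ,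
      M.lsLoss ω h (θ (h + 1)) (θ h) ≤ M.lsLoss ω h (θ (h + 1)) θ') (k : ℕ) :
    ∀ h, 1 ≤ h → h + k = H + 1 → θ h = M.thetaHat N ω h := by
  induction k with
  | zero =>
    intro h _ hk
    have : h = H + 1 := by omega
    rw [this, hlast, M.thetaHat_of_not_mem N ω (by simp)]
  | succ k ih =>
    intro h h1 hk
    have hh : h ∈ Finset.Icc 1 H := Finset.mem_Icc.2 ⟨h1, by omega⟩
    rw [M.thetaHat_of_mem N ω hh, ← ih (h + 1) (by omega) (by omega)]
    exact (hρ.eq_lsSol_iff hn _ _).1 (hθ ⟨h, hh⟩)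

/-- The algorithm always returns a policy: its greedy actions can be chosen measurably. -/
theorem MDP.exists_isOutput (hρ : IsQuasiOptimalDesign N ρ) (hn : 0 < ntot) (ω : Data H ntot ρ) :
    ∃ π, M.IsOutput N ω π := by
  have hg : ∀ h, ∃ g : Cube (Fin dS) → Cube (Fin dA), Measurable g ∧
      ∀ s a, qHat N (M.thetaHat N ω h) (pair s a) ≤ qHat N (M.thetaHat N ω h) (pair s (g s)) :=
    fun h => exists_measurable_argmax dA
      (F := fun s a => qHat N (M.thetaHat N ω h) (pair s a)) (continuous_const.qHat continuous_pair)
  choose g hgm hg using hg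
  refine ⟨fun h => Kernel.deterministic (g h) (hgm h), fun h => inferInstance, M.thetaHat N ω,
    M.thetaHat_of_not_mem N ω (by simp), fun h => ⟨?_, g h, hgm h, hg h, rfl⟩⟩
  exact (hρ.eq_lsSol_iff hn _ _).2 (M.thetaHat_of_mem N ω h.2)

/-- The estimate of stage `h` depends only on the data of the stages from `h` on. -/
theorem MDP.thetaHat_congr (ω ω' : Data H ntot ρ) (k : ℕ) : ∀ h, h + k = H + 1 →
    (∀ q : Query H ntot ρ, h ≤ (q.1 : ℕ) → ω q = ω' q) →
      M.thetaHat N ω h = M.thetaHat N ω' h := by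
  induction k with
  | zero =>
    intro h hk _
    have hh : h ∉ Finset.Icc 1 H := by rw [Finset.mem_Icc]; omega
    rw [M.thetaHat_of_not_mem N ω hh, M.thetaHat_of_not_mem N ω' hh]
  | succ k ih =>
    intro h hk hω
    by_cases hh : h ∈ Finset.Icc 1 H
    · rw [M.thetaHat_of_mem N ω hh, M.thetaHat_of_mem N ω' hh,
        ih (h + 1) (by omega) fun q hq => hω q (by omega)]
      congr 1
      funext i
      simp only [MDP.target]
      rw [hω (⟨h, hh⟩, i, true) le_rfl, hω (⟨h, hh⟩, i, false) le_rfl]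
    · rw [M.thetaHat_of_not_mem N ω hh, M.thetaHat_of_not_mem N ω' hh]

theorem MDP.target_eq (ω : Data H ntot ρ) (h : Finset.Icc 1 H) (θ : freq (Idx dS dA) N → ℝ)
    (i : Item ntot ρ) : M.target ω h θ i =
      beta (Idx dS dA) N true * M.sampleReturn h i.1.1 (vHat N θ) (ω (h, i, true)) -
      beta (Idx dS dA) N false * M.sampleReturn h i.1.1 (vHat N θ) (ω (h, i, false)) := by
  simp only [MDP.target, MDP.sampleReturn]
  ring

theorem MDP.measurable_sampleReturn {Y : Type} [MeasurableSpace Y] (h : ℕ) (z : Cube (Idx dS dA))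
    {V : Y → Cube (Fin dS) → ℝ} {x : Y → (Idx dS dA → ℝ) × Cube (Fin dS)} (hx : Measurable x)
    (hV : Measurable fun y => V y (x y).2) : Measurable fun y => M.sampleReturn h z (V y) (x y) :=
  ((M.measurable_R_wrap h z).comp hx.fst).add hV

theorem measurable_vHat {Y : Type} [MeasurableSpace Y] {θ : Y → freq (Idx dS dA) N → ℝ}
    {s : Y → Cube (Fin dS)} (hθ : Measurable θ) (hs : Measurable s) :
    Measurable fun y => vHat N (θ y) (s y) := by
  have h1 : Measurable fun x : (freq (Idx dS dA) N → ℝ) × Cube (Fin dS) => vHat N x.1 x.2 :=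
    (continuous_vHat N).measurable
  have h2 := h1.comp (hθ.prodMk hs)
  simpa only [Function.comp_def] using h2

theorem measurable_lsSol {Y : Type} [MeasurableSpace Y] {ι : Type} [Fintype ι] [DecidableEq ι]
    {N ntot : ℕ} {ρ : Cube ι →₀ ℝ} {y : Y → Item ntot ρ → ℝ} (hy : ∀ i, Measurable fun x => y x i) :
    Measurable fun x => lsSol N (y x) := by
  refine measurable_pi_lambda _ fun n => ?_
  simp only [lsSol, Matrix.mulVec, dotProduct]
  refine Finset.measurable_sum _ fun m _ => Measurable.const_mul ?_ _
  simp only [Finset.sum_apply, Pi.smul_apply, smul_eq_mul]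
  exact Finset.measurable_sum _ fun i _ => (hy i).mul_const _

theorem MDP.measurable_thetaHat (k : ℕ) : ∀ h, h + k = H + 1 →
    Measurable fun ω : Data H ntot ρ => M.thetaHat N ω h := by
  induction k with
  | zero =>
    intro h hk
    have hh : h ∉ Finset.Icc 1 H := by rw [Finset.mem_Icc]; omega
    simp only [M.thetaHat_of_not_mem N _ hh]
    exact measurable_const
  | succ k ih =>
    intro h hk
    by_cases hh : h ∈ Finset.Icc 1 H
    · simp only [M.thetaHat_of_mem N _ hh]
      refine measurable_lsSol fun i => ?_
      simp only [M.target_eq]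
      have hb : ∀ b, Measurable fun ω : Data H ntot ρ => M.sampleReturn h i.1.1
          (vHat N (M.thetaHat N ω (h + 1))) (ω (⟨h, hh⟩, i, b)) := fun b =>
        M.measurable_sampleReturn h i.1.1 (measurable_pi_apply _)
          (measurable_vHat (ih (h + 1) (by omega)) (measurable_pi_apply _).snd)
      exact ((hb true).const_mul _).sub ((hb false).const_mul _)
    · simp only [M.thetaHat_of_not_mem N _ hh]
      exact measurable_const

end Estimates

/-! ### The deviation of the fitted values from their conditional means -/

section Deviation

open Filter Topology

variable {dS dA : ℕ} (M : MDP dS dA) {H ntot : ℕ} (N : ℕ) {ρ : Cube (Idx dS dA) →₀ ℝ}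

/-- Truncation of a real number to `[-B, B]`. -/
noncomputable def clip (B x : ℝ) : ℝ := max (-B) (min x B)

theorem abs_clip_le {B : ℝ} (hB : 0 ≤ B) (x : ℝ) : |clip B x| ≤ B :=
  abs_le.2 ⟨le_max_left _ _, max_le (by linarith) (min_le_right _ _)⟩

theorem clip_of_abs_le {B x : ℝ} (hx : |x| ≤ B) : clip B x = x := by
  rw [clip, min_eq_left (abs_le.1 hx).2, max_eq_right (abs_le.1 hx).1]

theorem measurable_clip (B : ℝ) : Measurable (clip B) :=
  measurable_const.max (measurable_id.min measurable_const)

/-- The contribution of the query `q` to the fitted value `Q̂_h(z)`, with the next-stage value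
estimate truncated to `[-B, B]`. The truncation makes the contribution bounded for all data, so that
Hoeffding's inequality applies without conditioning on the event that the estimate is bounded. -/
noncomputable def MDP.fitTerm (B : ℝ) (h : ℕ) (z : Cube (Idx dS dA)) (ω : Data H ntot ρ)
    (q : Query H ntot ρ) (x : (Idx dS dA → ℝ) × Cube (Fin dS)) : ℝ :=
  if (q.1 : ℕ) = h then
    lsWeight N ntot ρ z q.2.1 * ((if q.2.2 then 1 else -1) * beta (Idx dS dA) N q.2.2) *
      M.sampleReturn h q.2.1.1.1 (fun s => clip B (vHat N (M.thetaHat N ω (h + 1)) s)) x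
  else 0

/-- The deviation of the fitted value `Q̂_h(z)`, with truncated next-stage value estimate, from its
mean conditionally on the data of the later stages. -/
noncomputable def MDP.deviation (B : ℝ) (h : ℕ) (z : Cube (Idx dS dA)) (ω : Data H ntot ρ) : ℝ :=
  ∑ q : Query H ntot ρ, (M.fitTerm N B h z ω q (ω q) -
    ∫ x, M.fitTerm N B h z ω q x ∂(M.queryLaw N q.1 q.2.1.1.1 q.2.2))

theorem sum_query_ite {β : Type*} [AddCommMonoid β] (h : Finset.Icc 1 H) (f : Item ntot ρ → Bool → β) :
    ∑ q : Query H ntot ρ, (if (q.1 : ℕ) = h then f q.2.1 q.2.2 else 0) =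
      ∑ i, (f i true + f i false) := by
  rw [Fintype.sum_prod_type, Finset.sum_eq_single h]
  · simp only [if_true]
    rw [Fintype.sum_prod_type]
    simp only [Fintype.sum_bool]
  · intro h' _ hne
    have : (h' : ℕ) ≠ h := fun e => hne (Subtype.ext e)
    simp [this]
  · simp

variable {N}

/-- The deviation at a point is sub-Gaussian: the two signed observations at an item each contribute a
summand bounded by the weight of the item times `Λ (1 + B)`, with `Λ` the Lebesgue constant. -/
theorem MDP.measure_deviation_ge_le {q : ℕ} (hq : 0 < q) (hd : 0 < Fintype.card (Idx dS dA))
    (hρ : IsQuasiOptimalDesign (2 * q) ρ) (hn : 0 < ntot) {B : ℝ} (hB : 0 ≤ B) {h : ℕ}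
    (hh : h ∈ Finset.Icc 1 H) (z : Cube (Idx dS dA)) {t : ℝ} (ht : 0 ≤ t) :
    MeasurableSet {ω : Data H ntot ρ | t ≤ |M.deviation (2 * q) B h z ω|} ∧
    M.dataLaw H (2 * q) ntot ρ {ω | t ≤ |M.deviation (2 * q) B h z ω|} ≤
      ENNReal.ofReal (2 * Real.exp (-t ^ 2 / (2 * (4 * (freq (Idx dS dA) (2 * q)).card / ntot *
        (lebesgueConst (Fintype.card (Idx dS dA)) * (1 + B)) ^ 2)))) := by
  have : Nonempty (Idx dS dA) := Fintype.card_pos_iff.1 hd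
  have hprob : ∀ q' : Query H ntot ρ,
      IsProbabilityMeasure (M.queryLaw (2 * q) q'.1 q'.2.1.1.1 q'.2.2) :=
    fun q' => isProbabilityMeasure_queryLaw M hq _ _ _
  set Λ := lebesgueConst (Fintype.card (Idx dS dA)) with hΛ
  have hΛ0 : 0 ≤ Λ := (beta_nonneg _ true).trans (beta_le hd hq true)
  refine measure_pi_abs_sum_ge_le_of_local
    (μ := fun q' : Query H ntot ρ => M.queryLaw (2 * q) q'.1 q'.2.1.1.1 q'.2.2)
    (fun q' : Query H ntot ρ => (q'.1 : ℕ) = h)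
    (F := fun ω => M.fitTerm (2 * q) B h z ω)
    (c := fun q' => if (q'.1 : ℕ) = h then |lsWeight (2 * q) ntot ρ z q'.2.1| * (Λ * (1 + B)) else 0)
    (fun q' => ?_) (fun ω q' x => ?_) (fun ω ω' hω => ?_) (fun ω q' x hq' => ?_) ?_ ht
  · unfold MDP.fitTerm
    by_cases e : (q'.1 : ℕ) = h
    · simp only [e, if_true]
      refine Measurable.const_mul (M.measurable_sampleReturn h _ measurable_snd ?_) _
      exact (measurable_clip B).comp (measurable_vHat
        ((M.measurable_thetaHat (H - h) (h + 1) (by rw [Finset.mem_Icc] at hh; omega)).comp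
          measurable_fst) measurable_snd.snd)
    · simp only [e, if_false]
      exact measurable_const
  · unfold MDP.fitTerm
    by_cases e : (q'.1 : ℕ) = h
    · simp only [e, if_true]
      rw [abs_mul, abs_mul, mul_assoc]
      refine mul_le_mul_of_nonneg_left (mul_le_mul ?_ ?_ (abs_nonneg _) hΛ0) (abs_nonneg _)
      · rw [abs_mul, abs_of_nonneg (beta_nonneg _ _)]
        have : |(if q'.2.2 then 1 else -1 : ℝ)| = 1 := by split_ifs <;> simp
        rw [this, one_mul]
        exact beta_le hd hq _
      · exact (abs_add_le _ _).trans (add_le_add (M.abs_R_le h _) (abs_clip_le hB _))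
    · simp [e]
  · funext q' x
    unfold MDP.fitTerm
    rw [M.thetaHat_congr ω ω' (H - h) (h + 1) (by rw [Finset.mem_Icc] at hh; omega)
      fun q'' hq'' => hω q'' (by omega)]
  · unfold MDP.fitTerm
    rw [if_neg hq']
  · have e : ∀ q' : Query H ntot ρ, (if (q'.1 : ℕ) = h then
        |lsWeight (2 * q) ntot ρ z q'.2.1| * (Λ * (1 + B)) else 0) ^ 2 =
        if (q'.1 : ℕ) = ((⟨h, hh⟩ : Finset.Icc 1 H) : ℕ) then
          (fun (i : Item ntot ρ) (_ : Bool) => lsWeight (2 * q) ntot ρ z i ^ 2 * (Λ * (1 + B)) ^ 2)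
            q'.2.1 q'.2.2 else 0 := by
      intro q'
      split_ifs
      · rw [mul_pow, sq_abs]
      · simp
    rw [Finset.sum_congr rfl fun q' _ => e q', sum_query_ite ⟨h, hh⟩
      fun (i : Item ntot ρ) (_ : Bool) => lsWeight (2 * q) ntot ρ z i ^ 2 * (Λ * (1 + B)) ^ 2]
    have := hρ.sum_lsWeight_sq_le hn z
    rw [Finset.sum_congr rfl fun i _ => (two_mul _).symm, ← Finset.mul_sum, ← Finset.sum_mul]
    calc 2 * ((∑ i, lsWeight (2 * q) ntot ρ z i ^ 2) * (Λ * (1 + B)) ^ 2)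
        ≤ 2 * (2 * (freq (Idx dS dA) (2 * q)).card / ntot * (Λ * (1 + B)) ^ 2) := by gcongr
      _ = _ := by ring

/-- Where the truncation is inactive, the deviation is the difference between the fitted values and
the convolution of the kernel with the Bellman update of the next-stage estimate. -/
theorem MDP.deviation_eq {q : ℕ} (hq : 0 < q) (hd : 0 < Fintype.card (Idx dS dA))
    (hρ : IsQuasiOptimalDesign (2 * q) ρ) (hn : 0 < ntot) {B : ℝ} {h : ℕ}
    (hh : h ∈ Finset.Icc 1 H) (ω : Data H ntot ρ)
    (hV : ∀ s, |vHat (2 * q) (M.thetaHat (2 * q) ω (h + 1)) s| ≤ B)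
    {θ : freq (Idx dS dA) (2 * q) → ℝ} (hθ : ∀ z : Cube (Idx dS dA), conv (vpKernel (2 * q))
      (periodize (M.bellman h (qHat (2 * q) (M.thetaHat (2 * q) ω (h + 1))))) (toVec z) =
        qHat (2 * q) θ z) (z : Cube (Idx dS dA)) :
    M.deviation (2 * q) B h z ω =
      qHat (2 * q) (M.thetaHat (2 * q) ω h) z - qHat (2 * q) θ z := by
  have : Nonempty (Idx dS dA) := Fintype.card_pos_iff.1 hd
  set θ' := M.thetaHat (2 * q) ω (h + 1) with hθ'
  have hclip : (fun s => clip B (vHat (2 * q) θ' s)) = vHat (2 * q) θ' :=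
    funext fun s => clip_of_abs_le (hV s)
  let G : Item ntot ρ → Bool → ℝ := fun i b => lsWeight (2 * q) ntot ρ z i *
    ((if b then 1 else -1) * beta (Idx dS dA) (2 * q) b) *
    (M.sampleReturn h i.1.1 (vHat (2 * q) θ') (ω (⟨h, hh⟩, i, b)) -
      ∫ x, M.sampleReturn h i.1.1 (vHat (2 * q) θ') x ∂(M.queryLaw (2 * q) h i.1.1 b))
  have hsum : M.deviation (2 * q) B h z ω = ∑ i, (G i true + G i false) := by
    rw [← sum_query_ite ⟨h, hh⟩ G]
    refine Finset.sum_congr rfl fun q' _ => ?_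
    obtain ⟨⟨h', hh'⟩, i, b⟩ := q'
    unfold MDP.fitTerm
    rw [← hθ', hclip]
    by_cases e : h' = h
    · subst e
      simp only [if_true]
      rw [integral_const_mul, ← mul_sub]
    · simp [e]
  rw [hsum, M.thetaHat_of_mem _ ω hh, qHat_lsSol, ← hρ.sum_lsWeight_mul_qHat hn θ z,
    ← Finset.sum_sub_distrib]
  refine Finset.sum_congr rfl fun i _ => ?_
  have hm := M.beta_integral_sampleReturn hq h i.1.1 (f := qHat (2 * q) θ')
    (continuous_const.qHat continuous_id)
  rw [hθ] at hm
  rw [← hm, M.target_eq]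
  simp only [G, if_true, Bool.false_eq_true, if_false]
  change _ = _ * _ - _ * (_ * ∫ x, M.sampleReturn h i.1.1 (vHat (2 * q) θ') x ∂_ -
    _ * ∫ x, M.sampleReturn h i.1.1 (vHat (2 * q) θ') x ∂_)
  ring

end Deviation

/-! ### Propagation of the errors through the stages -/

section Propagation

open Filter Topology

theorem conv_sub_of_bounded {ι : Type} [Fintype ι] [DecidableEq ι] {K F G : (ι → ℝ) → ℝ}
    (hK : Continuous K) (hF : Measurable F) (hG : Measurable G) {B : ℝ} (hFB : ∀ x, |F x| ≤ B)
    (hGB : ∀ x, |G x| ≤ B) (x : ι → ℝ) :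
    conv K (fun y => F y - G y) x = conv K F x - conv K G x := by
  have hi : ∀ F : (ι → ℝ) → ℝ, Measurable F → (∀ x, |F x| ≤ B) →
      Integrable (fun t => K t * F (x + t)) (cubeMeasure ι) := fun F hF hFB =>
    Integrable.mul_bdd (c := B) (integrable_of_continuous hK)
      (hF.comp (measurable_const.add measurable_id)).aestronglyMeasurable
      (Eventually.of_forall fun t => hFB _)
  unfold conv
  rw [← integral_sub (hi F hF hFB) (hi G hG hGB)]
  congr 1
  funext t
  ring

variable {dS dA : ℕ}

/-- The Bellman operator is nonexpansive in the sup norm. -/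
theorem MDP.abs_bellman_sub_le (M : MDP dS dA) (h : ℕ) {f g : Cube (Idx dS dA) → ℝ}
    (hf : Continuous f) (hg : Continuous g) {e : ℝ} (he : ∀ z, |f z - g z| ≤ e)
    (z : Cube (Idx dS dA)) : |M.bellman h f z - M.bellman h g z| ≤ e := by
  obtain ⟨B₁, hB₁⟩ := exists_bound_cube hf
  obtain ⟨B₂, hB₂⟩ := exists_bound_cube hg
  have h1 : ∀ z, |f z| ≤ max B₁ B₂ := fun z => (hB₁ z).trans (le_max_left _ _)
  have h2 : ∀ z, |g z| ≤ max B₁ B₂ := fun z => (hB₂ z).trans (le_max_right _ _)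
  simp only [MDP.bellman]
  rw [add_sub_add_left_eq_sub, ← integral_sub]
  · exact abs_integral_le_of_abs_le fun s => abs_iSup_pair_sub_le h1 h2 he s
  · exact integrable_of_abs_le (continuous_iSup_pair hf).measurable (abs_iSup_pair_le h1)
  · exact integrable_of_abs_le (continuous_iSup_pair hg).measurable (abs_iSup_pair_le h2)

variable {M : MDP dS dA} {H ntot ν : ℕ} {ρ : Cube (Idx dS dA) →₀ ℝ} {C : ℝ≥0}

/-- The smoothing bias at an optimal state-action value function. -/
theorem MDP.IsSmooth.abs_conv_optQ_sub_le (hM : M.IsSmooth H ν C) {m q : ℕ} (hm : 2 ≤ m)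
    (hd : 0 < Fintype.card (Idx dS dA)) (hq : Fintype.card (Idx dS dA) * m ≤ q) {h : ℕ} (h1 : 1 ≤ h)
    (z : Cube (Idx dS dA)) :
    |M.optQ H h z - conv (vpKernel (2 * q)) (periodize (M.optQ H h)) (toVec z)| ≤
      (1 + lebesgueConst (Fintype.card (Idx dS dA))) *
        ((Fintype.card (Idx dS dA) : ℝ) ^ (ν + 1) * ((C : ℝ) + 1) ^ H *
          (2 * Fintype.card (Idx dS dA) / m) ^ (ν + 1)) := by
  have hmem := hM.memCp_optQ h1
  have hdiff := diffBound_periodize hmem (hM.cpNorm_optQ_le h1)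
  have := abs_sub_conv_vpKernel_le hm hq hd hmem.contDiff.continuous (isPer_periodize _) hdiff
    (by positivity) (toVec z)
  rw [show periodize (M.optQ H h) (toVec z) = M.optQ H h z from hmem.boundary z] at this
  push_cast at this
  exact this

/-- Backward induction over the stages: if all deviations on the grid are at most `t` and the
smoothing bias is at most `b`, then each stage multiplies the error by the Lebesgue constant of the
kernel and adds `b + 2 t`. The resulting bound also keeps the truncation inactive. -/
theorem MDP.IsSmooth.abs_qHat_sub_optQ_le (hM : M.IsSmooth H ν C) {q : ℕ} (hq : 0 < q)
    (hd : 0 < Fintype.card (Idx dS dA)) (hρ : IsQuasiOptimalDesign (2 * q) ρ) (hn : 0 < ntot)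
    {m : ℕ} (hm : 16 * (2 * q + 1) * (freq (Idx dS dA) (2 * q)).card ≤ m) {b t : ℝ}
    (hbias : ∀ h, 1 ≤ h → ∀ z,
      |M.optQ H h z - conv (vpKernel (2 * q)) (periodize (M.optQ H h)) (toVec z)| ≤ b)
    (ht : 0 ≤ t) (hu : (lebesgueConst (Fintype.card (Idx dS dA)) + 1) ^ H * (b + 2 * t) ≤ 1)
    {ω : Data H ntot ρ} (hdev : ∀ h ∈ Finset.Icc 1 H, ∀ j : Idx dS dA → Fin m,
      |M.deviation (2 * q) (H + 1) h (gridPt m j) ω| ≤ t) (k : ℕ) :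
    ∀ h, 1 ≤ h → h + k = H + 1 → ∀ z,
      |qHat (2 * q) (M.thetaHat (2 * q) ω h) z - M.optQ H h z| ≤
        (lebesgueConst (Fintype.card (Idx dS dA)) + 1) ^ k * (b + 2 * t) := by
  have : Nonempty (Idx dS dA) := Fintype.card_pos_iff.1 hd
  set Λ := lebesgueConst (Fintype.card (Idx dS dA)) with hΛ
  have hΛ0 : 0 ≤ Λ := (beta_nonneg _ true).trans (beta_le hd hq true)
  have hb0 : 0 ≤ b := (abs_nonneg _).trans (hbias 1 le_rfl fun _ => ⟨0, by norm_num⟩)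
  have hu0 : 0 ≤ b + 2 * t := by positivity
  induction k with
  | zero =>
    intro h _ hk z
    rw [M.thetaHat_of_not_mem _ ω (by rw [Finset.mem_Icc]; omega), M.optQ_of_gt (by omega)]
    simpa [qHat] using hu0
  | succ k ih =>
    intro h h1 hk z
    have hh : h ∈ Finset.Icc 1 H := Finset.mem_Icc.2 ⟨h1, by omega⟩
    have ih' := ih (h + 1) (by omega) (by omega)
    set Q := qHat (2 * q) (M.thetaHat (2 * q) ω (h + 1)) with hQ
    have hQc : Continuous Q := continuous_const.qHat continuous_id
    have hOc : Continuous (M.optQ H (h + 1)) := (hM.memCp_optQ (by omega)).continuous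
    -- The error of the next stage is at most `1`, so its estimate is bounded by `H + 1`, the truncation level.
    have hpow : (Λ + 1) ^ k * (b + 2 * t) ≤ 1 := le_trans (mul_le_mul_of_nonneg_right
      (pow_le_pow_right₀ (by linarith) (by omega : k ≤ H)) hu0) hu
    have hQB : ∀ z, |Q z| ≤ H + 1 := fun z => by
      have e1 := M.abs_optQ_le (H := H) (by omega : 1 ≤ h + 1) z
      have e2 := abs_sub_abs_le_abs_sub (Q z) (M.optQ H (h + 1) z)
      linarith [ih' z]
    have hOB : ∀ z, |M.optQ H (h + 1) z| ≤ H + 1 := fun z =>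
      (M.abs_optQ_le (by omega) z).trans (by linarith)
    have hper : ∀ {f : Cube (Idx dS dA) → ℝ}, Continuous f →
        Measurable (periodize (M.bellman h f)) := fun hf =>
      (M.measurable_bellman h hf).comp measurable_wrap
    obtain ⟨θ, hθ⟩ := exists_coeff_of_mem_trigSpace (conv_vpKernel_mem (2 * q)
      (isPer_periodize (M.bellman h Q)) (hper hQc)
      (fun x => M.abs_bellman_le h hQB (wrap x)))
    have hθ' : ∀ z : Cube (Idx dS dA),
        conv (vpKernel (2 * q)) (periodize (M.bellman h Q)) (toVec z) = qHat (2 * q) θ z := by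
      intro z
      rw [hθ, qHat, dotProduct]
      exact Finset.sum_congr rfl fun n _ => by rw [feature_apply, mul_comm]
    have hdevz := M.deviation_eq hq hd hρ hn hh ω (fun s => abs_iSup_pair_le hQB s) hθ'
    have htrig : ∀ z, qHat (2 * q) (M.thetaHat (2 * q) ω h) z - qHat (2 * q) θ z =
        ∑ n, (M.thetaHat (2 * q) ω h - θ) n * trigFn n.1 (toVec z) := by
      intro z
      rw [qHat, qHat, ← dotProduct_sub, dotProduct]
      exact Finset.sum_congr rfl fun n _ => by rw [feature_apply, mul_comm]
    -- The three parts of the error: the deviation, the propagated error of the next stage, the bias.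
    have t1 : |qHat (2 * q) (M.thetaHat (2 * q) ω h) z - qHat (2 * q) θ z| ≤ 2 * t := by
      rw [htrig]
      refine abs_trigPoly_le_of_grid hm _ (fun j => ?_) z
      rw [← htrig, ← hdevz]
      exact hdev h hh j
    have t2 : |qHat (2 * q) θ z -
        conv (vpKernel (2 * q)) (periodize (M.optQ H h)) (toVec z)| ≤
          Λ * ((Λ + 1) ^ k * (b + 2 * t)) := by
      rw [← hθ', M.optQ_of_le (Finset.mem_Icc.1 hh).2, ← conv_sub_of_bounded (continuous_vpKernel _)
        (hper hQc) (hper hOc) (fun x => M.abs_bellman_le h hQB (wrap x))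
        (fun x => M.abs_bellman_le h hOB (wrap x))]
      exact abs_conv_le (continuous_vpKernel _) (integral_abs_vpKernel_le hd hq)
        (fun x => M.abs_bellman_sub_le h hQc hOc ih' (wrap x)) _
    have t3 := hbias h h1 z
    rw [abs_sub_comm] at t3
    have hone : (b + 2 * t) ≤ (Λ + 1) ^ k * (b + 2 * t) :=
      le_mul_of_one_le_left hu0 (one_le_pow₀ (by linarith))
    calc _ ≤ 2 * t + Λ * ((Λ + 1) ^ k * (b + 2 * t)) + b := by
          refine (abs_sub_le _ (conv (vpKernel (2 * q)) (periodize (M.optQ H h)) (toVec z)) _).trans ?_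
          exact add_le_add ((abs_sub_le _ (qHat (2 * q) θ z) _).trans (add_le_add t1 t2)) t3
      _ ≤ Λ * ((Λ + 1) ^ k * (b + 2 * t)) + (Λ + 1) ^ k * (b + 2 * t) := by linarith
      _ = _ := by ring

/-- On data with small deviations every output is greedy for accurate estimates, hence `ε`-optimal. -/
theorem MDP.IsSmooth.succeeds_of_deviation_le (hM : M.IsSmooth H ν C) {q : ℕ} (hq : 0 < q)
    (hd : 0 < Fintype.card (Idx dS dA)) (hρ : IsQuasiOptimalDesign (2 * q) ρ) (hn : 0 < ntot)
    {m : ℕ} (hm : 16 * (2 * q + 1) * (freq (Idx dS dA) (2 * q)).card ≤ m) {b t ε : ℝ}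
    (hbias : ∀ h, 1 ≤ h → ∀ z,
      |M.optQ H h z - conv (vpKernel (2 * q)) (periodize (M.optQ H h)) (toVec z)| ≤ b)
    (ht : 0 ≤ t) (hε : ε ≤ 1) (hu : 2 * (H + 1) *
      ((lebesgueConst (Fintype.card (Idx dS dA)) + 1) ^ H * (b + 2 * t)) ≤ ε)
    {ω : Data H ntot ρ} (hdev : ∀ h ∈ Finset.Icc 1 H, ∀ j : Idx dS dA → Fin m,
      |M.deviation (2 * q) (H + 1) h (gridPt m j) ω| ≤ t) : M.Succeeds (2 * q) ε ω := by
  have : Nonempty (Idx dS dA) := Fintype.card_pos_iff.1 hd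
  have hΛ0 : 0 ≤ lebesgueConst (Fintype.card (Idx dS dA)) :=
    (beta_nonneg _ true).trans (beta_le hd hq true)
  have hb0 : 0 ≤ b := (abs_nonneg _).trans (hbias 1 le_rfl fun _ => ⟨0, by norm_num⟩)
  set u := (lebesgueConst (Fintype.card (Idx dS dA)) + 1) ^ H * (b + 2 * t) with hudef
  have hu0 : 0 ≤ u := by positivity
  have hH0 : (0 : ℝ) ≤ H := Nat.cast_nonneg _
  have hu1 : u ≤ 1 := by nlinarith
  refine ⟨M.exists_isOutput hρ hn ω, ?_⟩
  rintro π ⟨hπ, θ, hlast, hθ⟩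
  have hθeq : ∀ h ∈ Finset.Icc 1 H, θ h = M.thetaHat (2 * q) ω h := fun h hh => by
    have := Finset.mem_Icc.1 hh
    exact M.isOutput_theta_eq hρ hn hlast (fun h => (hθ h).1) (H + 1 - h) h this.1 (by omega)
  refine hM.isEpsOptimal_of_greedy π (η := u) (fun h => qHat (2 * q) (θ h))
    (by nlinarith) (fun h hh z => ?_) fun h hh => ?_
  · have hh' := Finset.mem_Icc.1 hh
    rw [hθeq h hh]
    refine (hM.abs_qHat_sub_optQ_le hq hd hρ hn hm hbias ht hu1 hdev (H + 1 - h) h hh'.1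
      (by omega) z).trans ?_
    refine mul_le_mul_of_nonneg_right (pow_le_pow_right₀ (by linarith) (by omega)) (by positivity)
  · obtain ⟨g, hgm, hg, hdet⟩ := (hθ ⟨h, hh⟩).2
    exact ⟨g, hgm, hg, hdet⟩

/-- The union bound over the stages and the grid points. -/
theorem MDP.exists_deviation_le (M : MDP dS dA) {q : ℕ} (hq : 0 < q)
    (hd : 0 < Fintype.card (Idx dS dA)) (hρ : IsQuasiOptimalDesign (2 * q) ρ) (hn : 0 < ntot)
    (m : ℕ) {t δ : ℝ} (ht : 0 ≤ t) (hδ : H * (m : ℝ) ^ Fintype.card (Idx dS dA) *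
      (2 * Real.exp (-t ^ 2 / (2 * (4 * (freq (Idx dS dA) (2 * q)).card / ntot *
        (lebesgueConst (Fintype.card (Idx dS dA)) * (1 + (H + 1))) ^ 2)))) ≤ δ) :
    ∃ G : Set (Data H ntot ρ), MeasurableSet G ∧
      (∀ ω ∈ G, ∀ h ∈ Finset.Icc 1 H, ∀ j : Idx dS dA → Fin m,
        |M.deviation (2 * q) (H + 1) h (gridPt m j) ω| ≤ t) ∧
      ENNReal.ofReal (1 - δ) ≤ M.dataLaw H (2 * q) ntot ρ G := by
  have : Nonempty (Idx dS dA) := Fintype.card_pos_iff.1 hd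
  have hprob : ∀ q' : Query H ntot ρ,
      IsProbabilityMeasure (M.queryLaw (2 * q) q'.1 q'.2.1.1.1 q'.2.2) :=
    fun q' => isProbabilityMeasure_queryLaw M hq _ _ _
  have hP : IsProbabilityMeasure (M.dataLaw H (2 * q) ntot ρ) := by
    unfold MDP.dataLaw; infer_instance
  set e := 2 * Real.exp (-t ^ 2 / (2 * (4 * (freq (Idx dS dA) (2 * q)).card / ntot *
        (lebesgueConst (Fintype.card (Idx dS dA)) * (1 + (H + 1))) ^ 2))) with he
  have he0 : 0 ≤ e := by positivity
  let E : Finset.Icc 1 H × (Idx dS dA → Fin m) → Set (Data H ntot ρ) := fun p =>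
    {ω | t ≤ |M.deviation (2 * q) (H + 1) p.1 (gridPt m p.2) ω|}
  have hE : ∀ p, MeasurableSet (E p) ∧ M.dataLaw H (2 * q) ntot ρ (E p) ≤ ENNReal.ofReal e :=
    fun p => M.measure_deviation_ge_le hq hd hρ hn (by positivity) p.1.2 _ ht
  have hbad : M.dataLaw H (2 * q) ntot ρ (⋃ p, E p) ≤ ENNReal.ofReal δ := by
    calc _ ≤ ∑ p, M.dataLaw H (2 * q) ntot ρ (E p) := measure_iUnion_fintype_le _ _
      _ ≤ ∑ _p : Finset.Icc 1 H × (Idx dS dA → Fin m), ENNReal.ofReal e :=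
        Finset.sum_le_sum fun p _ => (hE p).2
      _ = ENNReal.ofReal (H * (m : ℝ) ^ Fintype.card (Idx dS dA) * e) := by
        rw [Finset.sum_const, Finset.card_univ, Fintype.card_prod, Fintype.card_coe, Nat.card_Icc,
          Fintype.card_fun, Fintype.card_fin, ← ENNReal.ofReal_nsmul, nsmul_eq_mul]
        push_cast
        simp
      _ ≤ _ := ENNReal.ofReal_le_ofReal hδ
  have hmeas : MeasurableSet (⋃ p, E p) := MeasurableSet.iUnion fun p => (hE p).1
  refine ⟨(⋃ p, E p)ᶜ, hmeas.compl, fun ω hω h hh j => ?_, ?_⟩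
  · by_contra hlt
    exact hω (Set.mem_iUnion.2 ⟨(⟨h, hh⟩, j), (not_le.1 hlt).le⟩)
  · rw [prob_compl_eq_one_sub hmeas, ENNReal.ofReal_sub _ (le_trans (by positivity) hδ),
      ENNReal.ofReal_one]
    exact tsub_le_tsub_left hbad 1

/-- Each item of the dataset of each stage costs two samples, and rounding up adds at most one item per
support point. -/
theorem numSamples_le {ι : Type} [Fintype ι] [DecidableEq ι] {N : ℕ} {ρ : Cube ι →₀ ℝ}
    (hρ : IsQuasiOptimalDesign N ρ) :
    (numSamples H ntot ρ : ℝ) ≤ 2 * H * (ntot + ρ.support.card) := by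
  have h1 : ∑ z : ρ.support, (⌈(ntot : ℝ) * ρ z⌉₊ : ℝ) ≤ ntot + ρ.support.card := by
    calc ∑ z : ρ.support, (⌈(ntot : ℝ) * ρ z⌉₊ : ℝ) ≤ ∑ z : ρ.support, ((ntot : ℝ) * ρ z + 1) :=
          Finset.sum_le_sum fun z _ =>
            (Nat.ceil_lt_add_one (mul_nonneg (Nat.cast_nonneg _) (hρ.nonneg _))).le
      _ = ntot + ρ.support.card := by
          rw [Finset.sum_add_distrib, ← Finset.mul_sum, Finset.sum_coe_sort ρ.support, hρ.sum_eq_one]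
          simp
  have h2 : (numSamples H ntot ρ : ℝ) = 2 * H * ∑ z : ρ.support, (⌈(ntot : ℝ) * ρ z⌉₊ : ℝ) := by
    unfold numSamples
    rw [Fintype.card_prod, Fintype.card_prod, Fintype.card_sigma, Fintype.card_coe, Nat.card_Icc]
    simp only [Fintype.card_fin, Fintype.card_bool]
    push_cast
    simp
    ring
  rw [h2]
  gcongr

end Propagation

/-! ### The choice of the parameters -/

section Parameters

theorem one_le_rpow_neg {ε : ℝ} (hε : 0 < ε) (hε1 : ε ≤ 1) (ν : ℕ) :
    1 ≤ ε ^ (-(1 / ((ν : ℝ) + 1))) :=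
  Real.one_le_rpow_of_pos_of_le_one_of_nonpos hε hε1 (neg_nonpos.2 (by positivity))

theorem rpow_neg_pow {ε : ℝ} (hε : 0 < ε) (ν k : ℕ) :
    (ε ^ (-(1 / ((ν : ℝ) + 1)))) ^ k = ε ^ (-((k : ℝ) / ((ν : ℝ) + 1))) := by
  rw [← Real.rpow_natCast, ← Real.rpow_mul hε.le]
  congr 1
  ring

theorem rpow_neg_pow_succ {ε : ℝ} (hε : 0 < ε) (ν : ℕ) :
    (ε ^ (-(1 / ((ν : ℝ) + 1)))) ^ (ν + 1) = 1 / ε := by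
  rw [rpow_neg_pow hε, Nat.cast_succ, div_self (by positivity), Real.rpow_neg_one, one_div]

/-- The logarithm of `Y / δ` for a quantity `Y` that is polynomial in `ε⁻¹`, such as the number of events
in the union bound, is of the order of `1 + log (1 / (ε δ))`. -/
theorem log_div_le {ε δ E P Y : ℝ} {k : ℕ} (hε : 0 < ε) (hε1 : ε ≤ 1) (hδ : 0 < δ) (hδ1 : δ ≤ 1)
    (hE : E ≤ 1 / ε) (hE0 : 0 ≤ E) (hP : 1 ≤ P) (hY : 0 < Y) (hYP : Y ≤ P * E ^ k) :
    Real.log (Y / δ) ≤ (Real.log P + k + 1) * (1 + Real.log (1 / (ε * δ))) := by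
  have hε' : 1 ≤ 1 / ε := by rw [le_div_iff₀ hε]; linarith
  have hδ' : 1 ≤ 1 / δ := by rw [le_div_iff₀ hδ]; linarith
  have l1 := Real.log_nonneg hε'
  have l2 := Real.log_nonneg hδ'
  have l3 := Real.log_nonneg hP
  have e1 : Real.log (1 / (ε * δ)) = Real.log (1 / ε) + Real.log (1 / δ) := by
    rw [← Real.log_mul (by positivity) (by positivity)]
    congr 1
    field_simp
  have e2 : Real.log (Y / δ) ≤ Real.log P + k * Real.log (1 / ε) + Real.log (1 / δ) := by
    rw [← Real.log_pow, ← Real.log_mul (by positivity) (by positivity),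
      ← Real.log_mul (by positivity) (by positivity)]
    refine Real.log_le_log (by positivity) ?_
    rw [div_eq_mul_one_div]
    refine mul_le_mul_of_nonneg_right (hYP.trans ?_) (by positivity)
    gcongr
  rw [e1]
  have hk : (0 : ℝ) ≤ k := Nat.cast_nonneg k
  nlinarith [mul_nonneg l3 l1, mul_nonneg l3 l2, mul_nonneg hk l2]

/-- The degree that brings the bias `b₀ / m^(ν+1)` below half of the error budget `ε / A`; here `E` stands
for `ε^{-1/(ν+1)}`. -/
theorem div_pow_le_of_le {ε E A b₀ c₀ m : ℝ} {ν : ℕ} (hε : 0 < ε) (hE1 : 1 ≤ E)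
    (hEν : E ^ (ν + 1) = 1 / ε) (hA : 0 < A) (hb₀ : 0 ≤ b₀) (hc₀ : 1 ≤ c₀) (hAc : 2 * A * b₀ ≤ c₀)
    (hm : c₀ * E ≤ m) : b₀ / m ^ (ν + 1) ≤ ε / (2 * A) := by
  have h0 : 0 < c₀ * E := by positivity
  have hmpow : c₀ * (1 / ε) ≤ m ^ (ν + 1) := by
    calc c₀ * (1 / ε) ≤ c₀ ^ (ν + 1) * E ^ (ν + 1) := by
          rw [hEν]
          gcongr
          exact le_self_pow₀ hc₀ (by omega)
      _ = (c₀ * E) ^ (ν + 1) := (mul_pow _ _ _).symm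
      _ ≤ _ := pow_le_pow_left₀ h0.le hm _
  calc b₀ / m ^ (ν + 1) ≤ b₀ / (c₀ * (1 / ε)) := by gcongr
    _ = ε * b₀ / c₀ := by field_simp
    _ ≤ ε / (2 * A) := by
      rw [div_le_div_iff₀ (by linarith) (by positivity)]
      calc ε * b₀ * (2 * A) = ε * (2 * A * b₀) := by ring
        _ ≤ ε * c₀ := by gcongr

/-- The sample size per stage that makes the Hoeffding bound for a deviation of `ε / (4 A)` smaller
than `δ / Y`, where `F` is the number of features. -/
theorem exists_sampleSize {ε E A F F₀ D δ Y κ L : ℝ} {d ν : ℕ} (hε : 0 < ε) (hE1 : 1 ≤ E)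
    (hEν : E ^ (ν + 1) = 1 / ε) (hA : 0 < A) (hF : 0 < F) (hFE : F ≤ F₀ * E ^ d) (hD : 0 < D)
    (hδ : 0 < δ) (hY : 0 < Y) (hκ : 0 ≤ κ) (hL : 1 ≤ L) (hlog : Real.log (Y / δ) ≤ κ * L) :
    ∃ n : ℕ, 0 < n ∧ (n : ℝ) ≤ (8 * F₀ * D * (16 * A ^ 2) * κ + 2) * (E ^ (d + 2 * (ν + 1)) * L) ∧
      Real.exp (-(ε / (4 * A)) ^ 2 / (2 * (4 * F / n * D))) ≤ δ / Y := by
  have hE0 : 0 < E := by linarith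
  have hF₀ : 0 < F₀ := pos_of_mul_pos_left (hF.trans_le hFE) (by positivity)
  set t : ℝ := ε / (4 * A) with ht
  have ht0 : 0 < t := by positivity
  have e1 : 1 / t ^ 2 = 16 * A ^ 2 * E ^ (2 * (ν + 1)) := by
    rw [mul_comm 2 (ν + 1), pow_mul, hEν, ht]
    field_simp
    norm_num
  clear_value t
  have hRL : 1 ≤ E ^ (d + 2 * (ν + 1)) * L := one_le_mul_of_one_le_of_one_le (one_le_pow₀ hE1) hL
  obtain ⟨X, hX⟩ : ∃ X, X = 8 * F * D / t ^ 2 * (κ * L) := ⟨_, rfl⟩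
  have hX0 : 0 ≤ X := by rw [hX]; positivity
  have hXu : X ≤ 8 * F₀ * D * (16 * A ^ 2) * κ * (E ^ (d + 2 * (ν + 1)) * L) := by
    calc X = 8 * F * D * (1 / t ^ 2) * (κ * L) := by rw [hX]; ring
      _ = 8 * F * D * (16 * A ^ 2 * E ^ (2 * (ν + 1))) * (κ * L) := by rw [e1]
      _ ≤ 8 * (F₀ * E ^ d) * D * (16 * A ^ 2 * E ^ (2 * (ν + 1))) * (κ * L) := by gcongr
      _ = _ := by rw [pow_add]; ring
  refine ⟨⌈X⌉₊ + 1, Nat.succ_pos _, ?_, ?_⟩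
  · have := (Nat.ceil_lt_add_one hX0).le
    push_cast
    linarith
  · have hn : X ≤ ((⌈X⌉₊ + 1 : ℕ) : ℝ) := by
      push_cast
      linarith [Nat.le_ceil X]
    have hn0 : (0 : ℝ) < ((⌈X⌉₊ + 1 : ℕ) : ℝ) := by positivity
    generalize ((⌈X⌉₊ + 1 : ℕ) : ℝ) = n at hn hn0
    have e2 : -t ^ 2 / (2 * (4 * F / n * D)) ≤ -Real.log (Y / δ) := by
      have e3 : -t ^ 2 / (2 * (4 * F / n * D)) = -(t ^ 2 * n / (8 * F * D)) := by
        field_simp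
        norm_num
      rw [e3, neg_le_neg_iff, le_div_iff₀ (by positivity)]
      calc Real.log (Y / δ) * (8 * F * D) ≤ κ * L * (8 * F * D) := by gcongr
        _ = t ^ 2 * X := by rw [hX]; field_simp
        _ ≤ t ^ 2 * n := by gcongr
    refine (Real.exp_le_exp.2 e2).trans (le_of_eq ?_)
    rw [Real.exp_neg, Real.exp_log (by positivity), inv_div]

variable {ι : Type} [Fintype ι] [DecidableEq ι]

theorem card_freq_le {N : ℕ} (hN : 0 < N) {c E : ℝ} (hNE : (N : ℝ) ≤ c * E) :
    ((freq ι N).card : ℝ) ≤ (3 * c) ^ Fintype.card ι * E ^ Fintype.card ι := by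
  have h1 : ((freq ι N).card : ℝ) ≤ (2 * N + 1) ^ Fintype.card ι := by
    exact_mod_cast card_freq_upper (ι := ι) N
  have hN' : (1 : ℝ) ≤ N := by exact_mod_cast hN
  rw [← mul_pow]
  exact h1.trans (pow_le_pow_left₀ (by positivity) (by linarith) _)

/-- The support of a design is smaller than the sample size; the crude estimate `log log Ñ ≤ O(E)` is
enough, since `d + 1 ≤ d + 2 (ν + 1)`. -/
theorem IsQuasiOptimalDesign.card_support_le {N : ℕ} {ρ : Cube ι →₀ ℝ}
    (hρ : IsQuasiOptimalDesign N ρ) (hN : 0 < N) {c E : ℝ} (hc : 0 ≤ c) (hE : 1 ≤ E)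
    (hNE : (N : ℝ) ≤ c * E) :
    (ρ.support.card : ℝ) ≤ (12 * Fintype.card ι * c * (3 * c) ^ Fintype.card ι + 16) *
      E ^ (Fintype.card ι + 1) := by
  set d := Fintype.card ι
  have hF := card_freq_le (ι := ι) hN hNE
  have hF1 : (1 : ℝ) ≤ (freq ι N).card := by exact_mod_cast freq_card_pos (ι := ι) N
  have hN' : (1 : ℝ) ≤ N := by exact_mod_cast hN
  have hlog0 := Real.log_nonneg hF1
  have hlog : Real.log (Real.log (freq ι N).card) ≤ 3 * d * c * E := by
    refine (Real.log_le_self hlog0).trans ?_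
    have h1 : ((freq ι N).card : ℝ) ≤ (3 * N) ^ d := by
      have h2 : ((freq ι N).card : ℝ) ≤ (2 * N + 1) ^ d := by
        exact_mod_cast card_freq_upper (ι := ι) N
      exact h2.trans (pow_le_pow_left₀ (by positivity) (by linarith) _)
    calc Real.log (freq ι N).card ≤ Real.log ((3 * N) ^ d) := Real.log_le_log (by linarith) h1
      _ = d * Real.log (3 * N) := Real.log_pow _ _
      _ ≤ d * (3 * N) := by gcongr; exact Real.log_le_self (by positivity)
      _ ≤ d * (3 * (c * E)) := by gcongr
      _ = 3 * d * c * E := by ring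
  calc (ρ.support.card : ℝ) ≤ 4 * (freq ι N).card * Real.log (Real.log (freq ι N).card) + 16 :=
        hρ.card_support
    _ ≤ 4 * ((3 * c) ^ d * E ^ d) * (3 * d * c * E) + 16 * E ^ (d + 1) := by
        refine add_le_add ?_ (le_mul_of_one_le_right (by norm_num) (one_le_pow₀ hE))
        have h0 : 0 ≤ 3 * d * c * E := by positivity
        calc 4 * ((freq ι N).card : ℝ) * Real.log (Real.log (freq ι N).card)
            ≤ 4 * ((freq ι N).card : ℝ) * (3 * d * c * E) := by gcongr
          _ ≤ _ := by gcongr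
    _ = _ := by ring

end Parameters

end SmoothMDP

theorem mainTheorem1 (d H ν : ℕ) (hd : 0 < d) (C_T : NNReal) :
    ∃ (C K : ℝ) (q : ℕ), ∀ dS dA : ℕ, dS + dA = d → ∀ ε : ℝ, 0 < ε → ε ≤ 1 →
      ∃ N : ℕ, 0 < N ∧ Even N ∧ (N : ℝ) ≤ C * ε ^ (-(1 / ((ν : ℝ) + 1))) ∧
        (∃ ρ : SmoothMDP.Cube (SmoothMDP.Idx dS dA) →₀ ℝ, SmoothMDP.IsQuasiOptimalDesign N ρ) ∧
        ∀ δ : ℝ, 0 < δ → δ < 1 → ∃ ntot : ℕ,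
          ∀ ρ : SmoothMDP.Cube (SmoothMDP.Idx dS dA) →₀ ℝ, SmoothMDP.IsQuasiOptimalDesign N ρ →
            (SmoothMDP.numSamples H ntot ρ : ℝ) ≤
              K * ε ^ (-(((d : ℝ) + 2 * ((ν : ℝ) + 1)) / ((ν : ℝ) + 1))) *
                (1 + Real.log (1 / (ε * δ))) ^ q ∧
            ∀ M : SmoothMDP.MDP dS dA, M.IsSmooth H ν C_T →
              ∃ G : Set (SmoothMDP.Data H ntot ρ), MeasurableSet G ∧
                (∀ ω ∈ G, M.Succeeds N ε ω) ∧
                ENNReal.ofReal (1 - δ) ≤ M.dataLaw H N ntot ρ G := by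
  obtain ⟨Λ, hΛ⟩ : ∃ Λ, Λ = SmoothMDP.lebesgueConst d := ⟨_, rfl⟩
  have hΛ0 : 0 < Λ := by rw [hΛ, SmoothMDP.lebesgueConst]; positivity
  -- The error budget: `A (b + 2 t) = ε` with smoothing bias `b = ε / (2 A)` and statistical
  -- deviation `t = ε / (4 A)`.
  obtain ⟨A, hA⟩ : ∃ A : ℝ, A = 2 * (H + 1) * (Λ + 1) ^ H := ⟨_, rfl⟩
  have hA0 : 0 < A := by rw [hA]; positivity
  obtain ⟨b₀, hb₀⟩ : ∃ b₀ : ℝ, b₀ =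
    (1 + Λ) * ((d : ℝ) ^ (ν + 1) * ((C_T : ℝ) + 1) ^ H * (2 * d) ^ (ν + 1)) := ⟨_, rfl⟩
  have hb₀0 : 0 ≤ b₀ := by rw [hb₀]; positivity
  have hAb : 0 ≤ 2 * A * b₀ := by positivity
  have hexp0 : 0 < Real.exp (Real.exp ((d : ℝ) ^ d)) := Real.exp_pos _
  -- The summands of `c₀` make the bias small, the order `m₀ = ⌈c₀ E⌉` of the Fejér-Korovkin kernel
  -- at least `2`, and the grid a quasi-optimal design.
  obtain ⟨c₀, hc₀⟩ : ∃ c₀, c₀ = 2 * A * b₀ + 2 + Real.exp (Real.exp ((d : ℝ) ^ d)) := ⟨_, rfl⟩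
  have hc₀2 : 2 ≤ c₀ := by linarith
  have hd1 : (1 : ℝ) ≤ d := by exact_mod_cast hd
  obtain ⟨c, hc⟩ : ∃ c, c = 2 * d * (c₀ + 1) := ⟨_, rfl⟩
  have hc1 : 1 ≤ c := by rw [hc]; nlinarith
  -- `P` and `k` control the number of grid points in the union bound.
  obtain ⟨k, hk⟩ : ∃ k, k = (d + 1) * d := ⟨_, rfl⟩
  obtain ⟨P, hP⟩ : ∃ P : ℝ, P = 2 * (H + 1) * (32 * (3 * c) ^ (d + 1)) ^ d := ⟨_, rfl⟩
  have hP1 : 1 ≤ P := by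
    have h1 : (1 : ℝ) ≤ (3 * c) ^ (d + 1) := one_le_pow₀ (by linarith)
    have h2 : (1 : ℝ) ≤ (32 * (3 * c) ^ (d + 1)) ^ d := one_le_pow₀ (by linarith)
    have h3 : (0 : ℝ) ≤ H := Nat.cast_nonneg _
    rw [hP]
    nlinarith
  have hlogP := Real.log_nonneg hP1
  obtain ⟨D, hD⟩ : ∃ D : ℝ, D = (Λ * (1 + (H + 1))) ^ 2 := ⟨_, rfl⟩
  have hD0 : 0 < D := by rw [hD]; positivity
  obtain ⟨K₁, hK₁⟩ : ∃ K₁, K₁ =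
    8 * (3 * c) ^ d * D * (16 * A ^ 2) * (Real.log P + k + 1) + 2 := ⟨_, rfl⟩
  obtain ⟨K₂, hK₂⟩ : ∃ K₂, K₂ = 12 * d * c * (3 * c) ^ d + 16 := ⟨_, rfl⟩
  have hK₂0 : 0 ≤ K₂ := by rw [hK₂]; positivity
  refine ⟨c, 2 * H * (K₁ + K₂), 1, fun dS dA hdim ε hε hε1 => ?_⟩
  have hcard : Fintype.card (SmoothMDP.Idx dS dA) = d := by simp [hdim]
  have hrate : ε ^ (-(((d : ℝ) + 2 * ((ν : ℝ) + 1)) / ((ν : ℝ) + 1))) =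
      (ε ^ (-(1 / ((ν : ℝ) + 1)))) ^ (d + 2 * (ν + 1)) := by
    rw [SmoothMDP.rpow_neg_pow hε]
    push_cast
    rfl
  rw [hrate]
  have hE1 := SmoothMDP.one_le_rpow_neg hε hε1 ν
  have hEν := SmoothMDP.rpow_neg_pow_succ hε ν
  generalize ε ^ (-(1 / ((ν : ℝ) + 1))) = E at hE1 hEν ⊢
  have hE0 : 0 < E := by linarith
  have hEε : E ≤ 1 / ε := by rw [← hEν]; exact le_self_pow₀ hE1 (by omega)
  obtain ⟨m₀, hm₀⟩ : ∃ m₀, m₀ = ⌈c₀ * E⌉₊ := ⟨_, rfl⟩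
  have hm₀l : c₀ * E ≤ m₀ := by rw [hm₀]; exact Nat.le_ceil _
  have hc₀E : c₀ ≤ c₀ * E := le_mul_of_one_le_right (by linarith) hE1
  have hm₀u : (m₀ : ℝ) ≤ (c₀ + 1) * E := by
    have := (Nat.ceil_lt_add_one (show 0 ≤ c₀ * E by linarith)).le
    rw [← hm₀] at this
    linarith
  have hm₀2 : 2 ≤ m₀ := by
    have : (2 : ℝ) ≤ m₀ := by linarith
    exact_mod_cast this
  -- The Fejér-Korovkin means of order `m₀` have total degree at most `d m₀ = N / 2`.
  obtain ⟨q, hqm⟩ : ∃ q, q = d * m₀ := ⟨_, rfl⟩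
  have hq : 0 < q := by rw [hqm]; exact Nat.mul_pos hd (by omega)
  have hN : 0 < 2 * q := by omega
  have hNE : ((2 * q : ℕ) : ℝ) ≤ c * E := by
    rw [hqm]
    push_cast
    calc 2 * ((d : ℝ) * m₀) ≤ 2 * (d * ((c₀ + 1) * E)) := by gcongr
      _ = c * E := by rw [hc]; ring
  refine ⟨2 * q, hN, even_two_mul _, hNE, ?_, fun δ hδ hδ1 => ?_⟩
  · refine ⟨SmoothMDP.gridDesign _ (2 * (2 * q) + 1), ?_⟩
    have := SmoothMDP.isQuasiOptimalDesign_gridDesign (ι := SmoothMDP.Idx dS dA) (M := m₀) hd hcard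
      (by linarith)
    rwa [mul_assoc 2 d m₀, ← hqm] at this
  have hFE := SmoothMDP.card_freq_le (ι := SmoothMDP.Idx dS dA) hN hNE
  rw [hcard] at hFE
  have hF1 : (1 : ℝ) ≤ (SmoothMDP.freq (SmoothMDP.Idx dS dA) (2 * q)).card := by
    exact_mod_cast SmoothMDP.freq_card_pos (ι := SmoothMDP.Idx dS dA) (2 * q)
  obtain ⟨m, hm⟩ : ∃ m, m = 16 * (2 * q + 1) *
    (SmoothMDP.freq (SmoothMDP.Idx dS dA) (2 * q)).card := ⟨_, rfl⟩
  have hmE : (m : ℝ) ≤ 32 * (3 * c) ^ (d + 1) * E ^ (d + 1) := by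
    have hN1 : (1 : ℝ) ≤ ((2 * q : ℕ) : ℝ) := by exact_mod_cast hN
    have hcE : 0 ≤ c * E := by positivity
    rw [hm]
    push_cast at hN1 hNE ⊢
    calc 16 * (2 * (q : ℝ) + 1) * ((SmoothMDP.freq (SmoothMDP.Idx dS dA) (2 * q)).card : ℝ)
        ≤ 16 * (2 * (3 * (c * E))) * ((3 * c) ^ d * E ^ d) := by
          refine mul_le_mul ?_ hFE (by linarith) (by positivity)
          linarith
      _ = _ := by ring
  have hm1 : (0 : ℝ) < m := by
    rw [hm]
    push_cast
    positivity
  obtain ⟨Y, hY⟩ : ∃ Y : ℝ, Y = 2 * (H + 1) * (m : ℝ) ^ d := ⟨_, rfl⟩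
  have hY0 : 0 < Y := by rw [hY]; positivity
  have hYP : Y ≤ P * E ^ k := by
    calc Y ≤ 2 * (H + 1) * (32 * (3 * c) ^ (d + 1) * E ^ (d + 1)) ^ d := by rw [hY]; gcongr
      _ = P * E ^ k := by rw [hP, hk]; ring
  have hlog := SmoothMDP.log_div_le hε hε1 hδ hδ1.le hEε hE0.le hP1 hY0 hYP
  have hL1 : 1 ≤ 1 + Real.log (1 / (ε * δ)) := by
    have h1 : 1 ≤ 1 / (ε * δ) :=
      one_le_one_div (mul_pos hε hδ) (mul_le_one₀ hε1 hδ.le hδ1.le)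
    linarith [Real.log_nonneg h1]
  generalize 1 + Real.log (1 / (ε * δ)) = L at hlog hL1 ⊢
  obtain ⟨ntot, hn, hnu, hnexp⟩ := SmoothMDP.exists_sampleSize hε hE1 hEν hA0
    (by linarith) hFE hD0 hδ hY0 (by positivity) hL1 hlog
  rw [← hK₁] at hnu
  refine ⟨ntot, fun ρ hρ => ⟨?_, fun M hM => ?_⟩⟩
  · have hsupp := hρ.card_support_le hN (by linarith) hE1 hNE
    rw [hcard, ← hK₂] at hsupp
    have h1 : (ρ.support.card : ℝ) ≤ K₂ * (E ^ (d + 2 * (ν + 1)) * L) := by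
      refine hsupp.trans (mul_le_mul_of_nonneg_left ?_ hK₂0)
      calc E ^ (d + 1) ≤ E ^ (d + 2 * (ν + 1)) := pow_le_pow_right₀ hE1 (by omega)
        _ ≤ _ := le_mul_of_one_le_right (by positivity) hL1
    calc (SmoothMDP.numSamples H ntot ρ : ℝ) ≤ 2 * H * (ntot + ρ.support.card) :=
          SmoothMDP.numSamples_le hρ
      _ ≤ 2 * H * (K₁ * (E ^ (d + 2 * (ν + 1)) * L) + K₂ * (E ^ (d + 2 * (ν + 1)) * L)) := by
          gcongr
      _ = _ := by ring
  · have hd' : 0 < Fintype.card (SmoothMDP.Idx dS dA) := by rw [hcard]; exact hd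
    have hbias : ∀ h, 1 ≤ h → ∀ z, |M.optQ H h z - SmoothMDP.conv (SmoothMDP.vpKernel (2 * q))
        (SmoothMDP.periodize (M.optQ H h)) (SmoothMDP.toVec z)| ≤ ε / (2 * A) := by
      intro h h1 z
      refine (hM.abs_conv_optQ_sub_le hm₀2 hd' (by rw [hcard, hqm]) h1 z).trans ?_
      rw [hcard, ← hΛ]
      refine le_trans (le_of_eq ?_) (SmoothMDP.div_pow_le_of_le hε hE1 hEν hA0 hb₀0
        (by linarith) (by linarith) hm₀l)
      rw [hb₀, div_pow]
      ring
    obtain ⟨G, hGm, hG, hGp⟩ := M.exists_deviation_le (t := ε / (4 * A)) (δ := δ) hq hd' hρ hn m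
      (by positivity) (by
        rw [hcard, ← hΛ, ← hD]
        calc H * (m : ℝ) ^ d * (2 * Real.exp _) ≤ H * (m : ℝ) ^ d * (2 * (δ / Y)) := by gcongr
          _ = H / (H + 1) * δ := by rw [hY]; field_simp
          _ ≤ 1 * δ := by
            gcongr
            rw [div_le_one (by positivity)]
            linarith
          _ = δ := one_mul δ)
    refine ⟨G, hGm, fun ω hω => ?_, hGp⟩
    refine hM.succeeds_of_deviation_le hq hd' hρ hn hm.ge hbias (by positivity) hε1 ?_ (hG ω hω)
    rw [hcard, ← hΛ, ← mul_assoc, ← hA]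
    refine le_of_eq ?_
    field_simp
    norm_num
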